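/- Fix a finite family $\mathcal H$ of finite simple graphs and an integer $t\ge 0$, let $r=r(\mathcal H)=\max\{|V(H)|:H\in\mathcal H\}$, and assume $0\le t\le r-1$. An $\mathcal H$-subgraph of a graph $G$ is a subgraph of $G$ that is isomorphic to a member of $\mathcal H$. In the problem *$\mathcal H$-Packing with $t$-Overlap*, an instance is a finite simple graph $G$ and an integer $k\ge 0$ (the parameter), and the question is whether $G$ has at least $k$ distinct $\mathcal H$-subgraphs such that $|V(H_i)\cap V(H_j)|\le t$ for any two different subgraphs $H_i,H_j$ among them. In the problem *Induced-$\mathcal H$-Packing with $t$-Overlap*, these subgraphs are moreover required to be induced subgraphs of $G$. **Theorem.** Both problems have a kernel with $O(r^r k^{r-t-1})$ vertices, where the constant in the $O$ is absolute. That is, there is a constant $C$ such that for all $\mathcal H$ and $t$ as above, and for each of the two problems, there is an algorithm that maps every instance $(G,k)$ to an instance $(G',k')$ of the same problem with the following properties: $(G',k')$ is a yes-instance if and only if $(G,k)$ is one; $k'\le k$; $|V(G')|\le C\,r^r k^{r-t-1}$ (with $0^0=1$); and the running time is bounded by a polynomial, which may depend on $\mathcal H$ and $t$, in the length of $(G,k)$,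 where $G$ is given by its adjacency matrix and $k$ in binary. (Running time is the number of steps of a random access machine with addition and subtraction as its only arithmetic operations.) -/

import Mathlib

namespace OverlapPacking

/-! ### Finite graphs, families of graphs, packings -/

/-- A finite simple graph on the vertex set `{0, …, n - 1}`. -/
abbrev FinGraph : Type := Σ n : ℕ, SimpleGraph (Fin n)

/-- `r(𝓗)`: the largest number of vertices of a member of the finite family `𝓗`
(the value is `0` when `𝓗` is empty). -/
def maxOrder (𝓗 : Finset FinGraph) : ℕ := 𝓗.sup fun H => H.1

/-- `K` is an `𝓗`-subgraph of `G`: it is isomorphic to a member of `𝓗`. -/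
def IsHSubgraph (𝓗 : Finset FinGraph) {V : Type} {G : SimpleGraph V} (K : G.Subgraph) : Prop :=
  ∃ H ∈ 𝓗, Nonempty (K.coe ≃g H.2)

/-- Any two different subgraphs in `𝓚` have at most `t` vertices in common. -/
def PairwiseOverlapLE (t : ℕ) {V : Type} {G : SimpleGraph V} (𝓚 : Finset G.Subgraph) : Prop :=
  ∀ K ∈ 𝓚, ∀ L ∈ 𝓚, K ≠ L → (K.verts ∩ L.verts).ncard ≤ t

/-- An instance of the packing problems: a finite graph and a non-negative integer `k`,
the parameter. -/
structure PackInstance where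
  order : ℕ
  graph : SimpleGraph (Fin order)
  k : ℕ

/-- `𝓗`-Packing with `t`-Overlap: are there at least `k` different `𝓗`-subgraphs which pairwise
share at most `t` vertices? -/
def HPacking (𝓗 : Finset FinGraph) (t : ℕ) (I : PackInstance) : Prop :=
  ∃ 𝓚 : Finset I.graph.Subgraph, I.k ≤ 𝓚.card ∧ (∀ K ∈ 𝓚, IsHSubgraph 𝓗 K) ∧
    PairwiseOverlapLE t 𝓚

/-- Induced-`𝓗`-Packing with `t`-Overlap: the same question for induced subgraphs. -/
def InducedHPacking (𝓗 : Finset FinGraph) (t : ℕ) (I : PackInstance) : Prop :=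
  ∃ 𝓚 : Finset I.graph.Subgraph, I.k ≤ 𝓚.card ∧ (∀ K ∈ 𝓚, IsHSubgraph 𝓗 K ∧ K.IsInduced) ∧
    PairwiseOverlapLE t 𝓚

/-! ### Random access machine with step count

Programs for a random access machine with registers `reg 0, reg 1, …` (a program mentions only
finitely many of them) and an indirectly addressed memory `mem 0, mem 1, …`, all of which hold
natural numbers. Every assignment and every test costs one step. The only arithmetic operations
are addition and truncated subtraction, so that the numbers grow by at most one bit per step and
polynomially many steps amount to polynomial time on a Turing machine. -/

/-- The contents of the registers and of the memory. -/
structure RamState where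
  reg : ℕ → ℕ
  mem : ℕ → ℕ

/-- Programs. -/
inductive Prog : Type
  /-- `reg d := c` -/
  | const (d c : ℕ)
  /-- `reg d := reg a + reg b` -/
  | add (d a b : ℕ)
  /-- `reg d := reg a - reg b`, or `0` if `reg a < reg b` -/
  | sub (d a b : ℕ)
  /-- `reg d := mem (reg a)` -/
  | load (d a : ℕ)
  /-- `mem (reg a) := reg b` -/
  | store (a b : ℕ)
  /-- first `p`, then `q` -/
  | seq (p q : Prog)
  /-- if `reg a ≠ 0` then `p`, else `q` -/
  | ite (a : ℕ) (p q : Prog)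
  /-- while `reg a ≠ 0` do `p` -/
  | loop (a : ℕ) (p : Prog)

/-- `Exec p s T s'`: the program `p`, started in the state `s`, halts after exactly `T` steps in
the state `s'`. -/
inductive Exec : Prog → RamState → ℕ → RamState → Prop
  | const (d c : ℕ) (s : RamState) :
      Exec (.const d c) s 1 ⟨Function.update s.reg d c, s.mem⟩
  | add (d a b : ℕ) (s : RamState) :
      Exec (.add d a b) s 1 ⟨Function.update s.reg d (s.reg a + s.reg b), s.mem⟩
  | sub (d a b : ℕ) (s : RamState) :
      Exec (.sub d a b) s 1 ⟨Function.update s.reg d (s.reg a - s.reg b), s.mem⟩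
  | load (d a : ℕ) (s : RamState) :
      Exec (.load d a) s 1 ⟨Function.update s.reg d (s.mem (s.reg a)), s.mem⟩
  | store (a b : ℕ) (s : RamState) :
      Exec (.store a b) s 1 ⟨s.reg, Function.update s.mem (s.reg a) (s.reg b)⟩
  | seq {p q : Prog} {s s' s'' : RamState} {T T' : ℕ} (hp : Exec p s T s')
      (hq : Exec q s' T' s'') : Exec (.seq p q) s (T + T') s''
  | iteTrue {a : ℕ} {p q : Prog} {s s' : RamState} {T : ℕ} (ha : s.reg a ≠ 0)
      (hp : Exec p s T s') : Exec (.ite a p q) s (T + 1) s'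
  | iteFalse {a : ℕ} {p q : Prog} {s s' : RamState} {T : ℕ} (ha : s.reg a = 0)
      (hq : Exec q s T s') : Exec (.ite a p q) s (T + 1) s'
  | loopDone {a : ℕ} {p : Prog} {s : RamState} (ha : s.reg a = 0) : Exec (.loop a p) s 1 s
  | loopStep {a : ℕ} {p : Prog} {s s' s'' : RamState} {T T' : ℕ} (ha : s.reg a ≠ 0)
      (hp : Exec p s T s') (hl : Exec (.loop a p) s' T' s'') :
      Exec (.loop a p) s (T + T' + 1) s''

/-! ### Polynomial time and kernels -/

/-- The length of an instance: the entries of the adjacency matrix and the binary digits of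
`k`. -/
def PackInstance.size (I : PackInstance) : ℕ := I.order ^ 2 + Nat.size I.k

open Classical in
/-- The initial state on input `I`: `reg 0` holds the number `n` of vertices, `reg 1` holds `k`,
the cell `mem (i * n + j)` holds the entry of the adjacency matrix in row `i` and column `j`, and
everything else is `0`. -/
noncomputable def PackInstance.initState (I : PackInstance) : RamState where
  reg a := if a = 0 then I.order else if a = 1 then I.k else 0
  mem a := if ∃ i j : Fin I.order, a = i.val * I.order + j.val ∧ I.graph.Adj i j then 1 else 0

open Classical in
/-- The state `s` presents `J` as the output, in the format of the input. -/
def RamState.Outputs (s : RamState) (J : PackInstance) : Prop :=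
  s.reg 0 = J.order ∧ s.reg 1 = J.k ∧
    ∀ i j : Fin J.order, s.mem (i.val * J.order + j.val) = if J.graph.Adj i j then 1 else 0

/-- `f` is computed by one program whose number of steps is polynomially bounded in the length of
the input. -/
def PolyTimeComputable (f : PackInstance → PackInstance) : Prop :=
  ∃ (p : Prog) (b : Polynomial ℕ), ∀ I : PackInstance,
    ∃ (T : ℕ) (s : RamState), Exec p I.initState T s ∧ T ≤ b.eval I.size ∧ s.Outputs (f I)

/-- The parameterized graph problem `P` has a kernel with at most `B k` vertices: a polynomial-time
algorithm maps every instance to an equivalent instance of the same problem whose parameter is not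
larger and whose graph has at most `B k` vertices, `k` being the parameter of the given
instance. -/
def HasVertexKernel (P : PackInstance → Prop) (B : ℕ → ℕ) : Prop :=
  ∃ f : PackInstance → PackInstance, PolyTimeComputable f ∧
    ∀ I : PackInstance, (P (f I) ↔ P I) ∧ (f I).k ≤ I.k ∧ (f I).order ≤ B I.k

end OverlapPacking

/-! A subgraph with at most `t` vertices overlaps with anything in at most `t` vertices, so all of
these can be put into a packing. The members with more than `t` vertices have different vertex sets.
Hence, with κ = k − (number of small subgraphs), the question is whether κ "big" sets (vertex sets
of `𝓗`-subgraphs with more than `t`, hence at most `r`, elements) pairwise share at most `t`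
elements; see `packing_iff`. If κ = 0 the answer is yes. If `r = t + 1`, different big sets always
share at most `t` elements, and counting them decides the problem.

Let `r ≥ t + 2` and κ > 0. Choose greedily a family M of big sets such that every P with t < |P| < r
lies in at most (rκ)^(r-1-|P|) members, and |M| ≤ r^(r-1) κ^(r-t-1). Three facts carry the proof.

If M reaches its maximal size, a largest packing inside M has at least κ sets: otherwise the caps
for the (t+1)-subsets of its members would make M smaller (`IsGreedy.exists_packing_of_large`).

If not, every big set S outside M contains a saturated P. When |P| ≤ r-2, the caps one level up show
that some member of M containing P can replace S in a given packing. When |P| = r-1, saturation only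
says that P lies in a member of M. So a packing of size κ may be assumed to consist of members of M
and of sets sharing r-1 elements with a member (`IsGreedy.exists_good_packing`).

A set of the second kind that leaves V = ⋃M is P ∪ {u} with P an (r-1)-subset of a member and u
outside V. In the bipartite graph of these pairs (P, u) a crown is found: some P are matched to
private vertices m(P), and all neighbours of the other P are kept and differ from all m(P).
Replacing u by m(P) for the matched P moves the packing into the kept set W
(`IsCrown.exists_packing`). The crown comes from an auction with integer prices, cut at a price that
no object has (`Auction.Invariant.exists_crown`). At most one vertex is kept for each of the at most
r|M| sets P, and |V| ≤ r|M|, so |W| ≤ 2 r^r κ^(r-t-1). The parameter of the output is κ plus the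
number of small subgraphs inside W.

For the running time, all loops have length N = (n+2)^(r+1). Sets of at most r vertices are coded by
numbers below N, and no loop depends on the value of k: if κ > N, there are too few big sets.
Closure properties of `Comp`, `CompP`, `CompF` and `CompS` then produce the program. The numbers of
subgraphs on a set are read off from a fixed finite table of adjacency patterns. -/

namespace OverlapPacking

/-! ### Step-bounded runs -/

/-- The program `p`, started in `s`, halts within `B` steps in a state satisfying `Q`. -/
def Run (p : Prog) (s : RamState) (B : ℕ) (Q : RamState → Prop) : Prop :=
  ∃ T s', Exec p s T s' ∧ T ≤ B ∧ Q s'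

namespace Run

variable {p q : Prog} {s : RamState} {B B' : ℕ} {Q R : RamState → Prop}

theorem mono (h : Run p s B Q) (hB : B ≤ B') (hQ : ∀ s', Q s' → R s') : Run p s B' R := by
  obtain ⟨T, s', h1, h2, h3⟩ := h
  exact ⟨T, s', h1, h2.trans hB, hQ _ h3⟩

theorem seq (h : Run p s B Q) (h' : ∀ s', Q s' → Run q s' B' R) :
    Run (.seq p q) s (B + B') R := by
  obtain ⟨T, s', h1, h2, h3⟩ := h
  obtain ⟨T', s'', h1', h2', h3'⟩ := h' s' h3
  exact ⟨_, _, .seq h1 h1', by omega, h3'⟩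

theorem const {d c : ℕ} (h : Q ⟨Function.update s.reg d c, s.mem⟩) : Run (.const d c) s 1 Q :=
  ⟨_, _, .const d c s, le_rfl, h⟩

theorem add {d a b : ℕ} (h : Q ⟨Function.update s.reg d (s.reg a + s.reg b), s.mem⟩) :
    Run (.add d a b) s 1 Q :=
  ⟨_, _, .add d a b s, le_rfl, h⟩

theorem sub {d a b : ℕ} (h : Q ⟨Function.update s.reg d (s.reg a - s.reg b), s.mem⟩) :
    Run (.sub d a b) s 1 Q :=
  ⟨_, _, .sub d a b s, le_rfl, h⟩

theorem load {d a : ℕ} (h : Q ⟨Function.update s.reg d (s.mem (s.reg a)), s.mem⟩) :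
    Run (.load d a) s 1 Q :=
  ⟨_, _, .load d a s, le_rfl, h⟩

theorem store {a b : ℕ} (h : Q ⟨s.reg, Function.update s.mem (s.reg a) (s.reg b)⟩) :
    Run (.store a b) s 1 Q :=
  ⟨_, _, .store a b s, le_rfl, h⟩

theorem ite {a : ℕ} (h : s.reg a ≠ 0 → Run p s B Q) (h' : s.reg a = 0 → Run q s B Q) :
    Run (.ite a p q) s (B + 1) Q := by
  by_cases ha : s.reg a = 0
  · obtain ⟨T, s', h1, h2, h3⟩ := h' ha
    exact ⟨_, _, .iteFalse ha h1, by omega, h3⟩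
  · obtain ⟨T, s', h1, h2, h3⟩ := h ha
    exact ⟨_, _, .iteTrue ha h1, by omega, h3⟩

/-- A loop whose counter `a` runs down from `N`, with an invariant. -/
theorem loop {a N : ℕ} (Inv : ℕ → RamState → Prop)
    (hstep : ∀ i < N, ∀ s, Inv i s → s.reg a = N - i →
      Run p s B fun s' => Inv (i + 1) s' ∧ s'.reg a = N - (i + 1))
    (h0 : Inv 0 s) (ha : s.reg a = N) : Run (.loop a p) s (N * (B + 1) + 1) (Inv N) := by
  have key : ∀ m i, i + m = N → ∀ s, Inv i s → s.reg a = N - i →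
      Run (.loop a p) s (m * (B + 1) + 1) (Inv N) := by
    intro m
    induction m with
    | zero =>
      intro i hi s hs hr
      have : i = N := by omega
      subst this
      exact ⟨1, s, .loopDone (by omega), by omega, hs⟩
    | succ m ih =>
      intro i hi s hs hr
      obtain ⟨T, s', h1, h2, h3, h4⟩ := hstep i (by omega) s hs hr
      obtain ⟨T', s'', h1', h2', h3'⟩ := ih (i + 1) (by omega) s' h3 h4
      refine ⟨_, _, .loopStep (by omega) h1 h1', ?_, h3'⟩
      rw [Nat.succ_mul]
      omega
  simpa using key N 0 (by omega) s h0 (by simpa using ha)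

end Run

/-! ### Functions computable with nested loops of polynomial length -/

/-- Contents of the memory. -/
abbrev Mem : Type := ℕ → ℕ

/-- The parameters of a computation: the input numbers, and a number that determines the length of
all loops. -/
structure Glob where
  n : ℕ
  k : ℕ
  m : ℕ

/-- The length of all loops. -/
def Glob.N (g : Glob) : ℕ := (g.n + 2) ^ (g.m + 1)

theorem Glob.order_add_two_le (g : Glob) : g.n + 2 ≤ g.N := Nat.le_self_pow (by omega) _

/-- A type of variable assignments: finitely many numerical variables, of which the first three
are the global ones. -/
class Ctx (α : Type) where
  size : ℕ
  var : α → ℕ → ℕ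
  glob : α → Glob
  size_ge : 3 ≤ size
  var_zero : ∀ a, var a 0 = (glob a).N
  var_one : ∀ a, var a 1 = (glob a).n
  var_two : ∀ a, var a 2 = (glob a).k

open Ctx (glob)

instance : Ctx Glob where
  size := 3
  var g i := if i = 0 then g.N else if i = 1 then g.n else g.k
  glob g := g
  size_ge := le_rfl
  var_zero _ := rfl
  var_one _ := rfl
  var_two _ := rfl

instance {α : Type} [Ctx α] : Ctx (α × ℕ) where
  size := Ctx.size α + 1
  var p i := if i = Ctx.size α then p.2 else Ctx.var p.1 i
  glob p := glob p.1
  size_ge := by have := Ctx.size_ge (α := α); omega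
  var_zero p := by
    rw [if_neg (by have := Ctx.size_ge (α := α); omega), Ctx.var_zero]
  var_one p := by
    rw [if_neg (by have := Ctx.size_ge (α := α); omega), Ctx.var_one]
  var_two p := by
    rw [if_neg (by have := Ctx.size_ge (α := α); omega), Ctx.var_two]

variable {α : Type} [Ctx α]

/-- `f` is computed by programs that may use all registers from `d` on, where `ρ i` is the register
of the `i`-th variable, and which leave the result in register `d`; the number of steps is bounded
by a polynomial in the loop length. -/
def Comp (f : α → Mem → ℕ) : Prop :=
  ∃ b : Polynomial ℕ, ∀ (ρ : ℕ → ℕ) (d : ℕ), (∀ i < Ctx.size α, ρ i < d) → ∃ p : Prog,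
    ∀ (a : α) (s : RamState), (∀ i < Ctx.size α, s.reg (ρ i) = Ctx.var a i) →
      Run p s (b.eval (glob a).N) fun s' =>
        s'.mem = s.mem ∧ (∀ j < d, s'.reg j = s.reg j) ∧ s'.reg d = f a s.mem

/-- The same for transformations of the memory. -/
def CompS (F : α → Mem → Mem) : Prop :=
  ∃ b : Polynomial ℕ, ∀ (ρ : ℕ → ℕ) (d : ℕ), (∀ i < Ctx.size α, ρ i < d) → ∃ p : Prog,
    ∀ (a : α) (s : RamState), (∀ i < Ctx.size α, s.reg (ρ i) = Ctx.var a i) →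
      Run p s (b.eval (glob a).N) fun s' =>
        s'.mem = F a s.mem ∧ ∀ j < d, s'.reg j = s.reg j

/-- The same for predicates. -/
def CompP (P : α → Mem → Prop) : Prop :=
  ∃ f : α → Mem → ℕ, Comp f ∧ ∀ a μ, f a μ ≠ 0 ↔ P a μ

namespace Comp

variable {f g : α → Mem → ℕ}

theorem congr (hf : Comp f) (h : ∀ a μ, f a μ = g a μ) : Comp g := by
  have : f = g := funext fun a => funext fun μ => h a μ
  exact this ▸ hf

theorem const (c : ℕ) : Comp (fun (_ : α) _ => c) := by
  refine ⟨1, fun ρ d hd => ⟨.const d c, fun a s hs => ?_⟩⟩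
  refine Run.mono (Run.const ⟨rfl, ?_, ?_⟩) (by simp) fun _ h => h
  · intro j hj
    simp [Function.update_of_ne hj.ne]
  · simp

/-- Every variable is computable. -/
theorem var (i : ℕ) (hi : i < Ctx.size α) : Comp (fun (a : α) _ => Ctx.var a i) := by
  -- A register is copied by adding it to a register that holds `0`.
  refine ⟨2, fun ρ d hd => ⟨.seq (.const d 0) (.add d d (ρ i)), fun a s hs => ?_⟩⟩
  refine Run.mono (Run.seq (B := 1) (B' := 1) (Run.const rfl) ?_) (by simp) fun _ h => h
  rintro s' rfl
  refine Run.add ⟨rfl, ?_, ?_⟩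
  · intro j hj
    simp [Function.update_of_ne hj.ne]
  · simp [Function.update_of_ne (hd i hi).ne, hs i hi]

theorem bound : Comp (fun (a : α) _ => (glob a).N) :=
  (var 0 (by have := Ctx.size_ge (α := α); omega)).congr fun a _ => Ctx.var_zero a

theorem order : Comp (fun (a : α) _ => (glob a).n) :=
  (var 1 (by have := Ctx.size_ge (α := α); omega)).congr fun a _ => Ctx.var_one a

theorem param : Comp (fun (a : α) _ => (glob a).k) :=
  (var 2 (by have := Ctx.size_ge (α := α); omega)).congr fun a _ => Ctx.var_two a

theorem fst (hf : Comp f) : Comp (fun (p : α × ℕ) μ => f p.1 μ) := by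
  obtain ⟨b, hb⟩ := hf
  refine ⟨b, fun ρ d hd => ?_⟩
  have hsz : Ctx.size (α × ℕ) = Ctx.size α + 1 := rfl
  obtain ⟨p, hp⟩ := hb ρ d fun i hi => hd i (by omega)
  refine ⟨p, fun a s hs => hp a.1 s fun i hi => ?_⟩
  rw [hs i (by omega)]
  exact if_neg hi.ne

theorem snd : Comp (fun (p : α × ℕ) _ => p.2) :=
  (var (α := α × ℕ) (Ctx.size α) (Nat.lt_succ_self _)).congr fun _ _ => if_pos rfl

/-- Inserting a variable before the last one changes only the map from variables to registers. This
is needed when a predicate of a bound variable is used under one more binder. -/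
theorem middle {f : α × ℕ → Mem → ℕ} (hf : Comp f) :
    Comp (fun (p : (α × ℕ) × ℕ) μ => f (p.1.1, p.2) μ) := by
  obtain ⟨b, hb⟩ := hf
  have hsz : Ctx.size (α × ℕ) = Ctx.size α + 1 := rfl
  have hsz' : Ctx.size ((α × ℕ) × ℕ) = Ctx.size α + 2 := rfl
  refine ⟨b, fun ρ d hd => ?_⟩
  obtain ⟨p, hp⟩ := hb (fun i => if i = Ctx.size α then ρ (i + 1) else ρ i) d fun i hi => by
    split_ifs
    · exact hd _ (by omega)
    · exact hd _ (by omega)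
  refine ⟨p, fun a s hs => hp (a.1.1, a.2) s fun i hi => ?_⟩
  by_cases h : i = Ctx.size α
  · subst h
    rw [if_pos rfl, hs _ (by omega)]
    exact (if_pos rfl).trans (if_pos rfl).symm
  · rw [if_neg h, hs _ (by omega)]
    exact (if_neg (by omega)).trans ((if_neg h).trans (if_neg h).symm)

/-- Evaluate two functions, the results being left in registers `d` and `d + 1`. -/
theorem two_runs (hf : Comp f) (hg : Comp g) :
    ∃ b : Polynomial ℕ, ∀ (ρ : ℕ → ℕ) (d : ℕ), (∀ i < Ctx.size α, ρ i < d) → ∃ p : Prog,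
      ∀ (a : α) (s : RamState), (∀ i < Ctx.size α, s.reg (ρ i) = Ctx.var a i) →
        Run p s (b.eval (glob a).N) fun s' => s'.mem = s.mem ∧ (∀ j < d, s'.reg j = s.reg j) ∧
          s'.reg d = f a s.mem ∧ s'.reg (d + 1) = g a s.mem := by
  obtain ⟨b, hb⟩ := hf
  obtain ⟨b', hb'⟩ := hg
  refine ⟨b + b', fun ρ d hd => ?_⟩
  obtain ⟨p, hp⟩ := hb ρ d hd
  obtain ⟨q, hq⟩ := hb' ρ (d + 1) fun i hi => (hd i hi).trans (Nat.lt_succ_self _)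
  refine ⟨.seq p q, fun a s hs => ?_⟩
  rw [Polynomial.eval_add]
  refine Run.seq (hp a s hs) fun s' ⟨h1, h2, h3⟩ => ?_
  refine Run.mono (hq a s' fun i hi => by rw [h2 _ (hd i hi), hs i hi]) le_rfl ?_
  rintro s'' ⟨h1', h2', h3'⟩
  refine ⟨h1'.trans h1, fun j hj => ?_, ?_, ?_⟩
  · rw [h2' j (by omega), h2 j hj]
  · rw [h2' d (by omega), h3]
  · rw [h3', h1]

theorem add (hf : Comp f) (hg : Comp g) : Comp (fun a μ => f a μ + g a μ) := by
  obtain ⟨b, hb⟩ := two_runs hf hg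
  refine ⟨b + 1, fun ρ d hd => ?_⟩
  obtain ⟨p, hp⟩ := hb ρ d hd
  refine ⟨.seq p (.add d d (d + 1)), fun a s hs => ?_⟩
  rw [Polynomial.eval_add, Polynomial.eval_one]
  refine Run.seq (hp a s hs) fun s' ⟨h1, h2, h3, h4⟩ => ?_
  refine Run.add ⟨h1, fun j hj => ?_, ?_⟩
  · simp [Function.update_of_ne hj.ne, h2 j hj]
  · simp [h3, h4]

theorem sub (hf : Comp f) (hg : Comp g) : Comp (fun a μ => f a μ - g a μ) := by
  obtain ⟨b, hb⟩ := two_runs hf hg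
  refine ⟨b + 1, fun ρ d hd => ?_⟩
  obtain ⟨p, hp⟩ := hb ρ d hd
  refine ⟨.seq p (.sub d d (d + 1)), fun a s hs => ?_⟩
  rw [Polynomial.eval_add, Polynomial.eval_one]
  refine Run.seq (hp a s hs) fun s' ⟨h1, h2, h3, h4⟩ => ?_
  refine Run.sub ⟨h1, fun j hj => ?_, ?_⟩
  · simp [Function.update_of_ne hj.ne, h2 j hj]
  · simp [h3, h4]

theorem mem (hf : Comp f) : Comp (fun a μ => μ (f a μ)) := by
  obtain ⟨b, hb⟩ := hf
  refine ⟨b + 1, fun ρ d hd => ?_⟩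
  obtain ⟨p, hp⟩ := hb ρ d hd
  refine ⟨.seq p (.load d d), fun a s hs => ?_⟩
  rw [Polynomial.eval_add, Polynomial.eval_one]
  refine Run.seq (hp a s hs) fun s' ⟨h1, h2, h3⟩ => ?_
  refine Run.load ⟨h1, fun j hj => ?_, ?_⟩
  · simp [Function.update_of_ne hj.ne, h2 j hj]
  · simp [h1, h3]

theorem ite_ne_zero {c : α → Mem → ℕ} (hc : Comp c) (hf : Comp f) (hg : Comp g) :
    Comp (fun a μ => if c a μ ≠ 0 then f a μ else g a μ) := by
  obtain ⟨b, hb⟩ := hc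
  obtain ⟨b₁, hb₁⟩ := hf
  obtain ⟨b₂, hb₂⟩ := hg
  refine ⟨b + (b₁ + b₂ + 1), fun ρ d hd => ?_⟩
  obtain ⟨p, hp⟩ := hb ρ d hd
  obtain ⟨p₁, hp₁⟩ := hb₁ ρ d hd
  obtain ⟨p₂, hp₂⟩ := hb₂ ρ d hd
  refine ⟨.seq p (.ite d p₁ p₂), fun a s hs => ?_⟩
  rw [Polynomial.eval_add, Polynomial.eval_add, Polynomial.eval_one]
  refine Run.seq (hp a s hs) fun s' ⟨h1, h2, h3⟩ => ?_
  have hs' : ∀ i < Ctx.size α, s'.reg (ρ i) = Ctx.var a i := fun i hi => by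
    rw [h2 _ (hd i hi), hs i hi]
  refine Run.ite (fun h => ?_) fun h => ?_
  · refine Run.mono (hp₁ a s' hs') (by simp) ?_
    rintro s'' ⟨h1', h2', h3'⟩
    refine ⟨h1'.trans h1, fun j hj => by rw [h2' j hj, h2 j hj], ?_⟩
    simpa [h3', h1] using fun h' => (h (h3.trans h')).elim
  · refine Run.mono (hp₂ a s' hs') (by simp) ?_
    rintro s'' ⟨h1', h2', h3'⟩
    refine ⟨h1'.trans h1, fun j hj => by rw [h2' j hj, h2 j hj], ?_⟩
    simpa [h3', h1] using fun h' => (h' (h3.symm.trans h)).elim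

end Comp

/-- The state after `i` rounds of a loop with body `G`. -/
def iter {β : Type} (G : ℕ → β → β) : ℕ → β → β
  | 0, x => x
  | i + 1, x => G i (iter G i x)

/-- The frame of a loop of length `N` with accumulator in register `d` and loop variable in
register `d + 1`. -/
theorem exists_loop_prog (b : Polynomial ℕ) (ρ : ℕ → ℕ) (d : ℕ) (hd : ∀ i < Ctx.size α, ρ i < d)
    (p : Prog) (G : α → ℕ → ℕ × Mem → ℕ × Mem)
    (hp : ∀ (a : α) (s : RamState) (i : ℕ),
      (∀ i < Ctx.size α, s.reg (ρ i) = Ctx.var a i) → s.reg (d + 1) = i →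
      Run p s (b.eval (glob a).N) fun s' => (s'.reg d, s'.mem) = G a i (s.reg d, s.mem) ∧
        ∀ j < d + 4, j ≠ d → s'.reg j = s.reg j) :
    ∃ q : Prog, ∀ (a : α) (s : RamState), (∀ i < Ctx.size α, s.reg (ρ i) = Ctx.var a i) →
      Run q s ((Polynomial.X * (b + 3) + 6 : Polynomial ℕ).eval (glob a).N) fun s' =>
        (s'.reg d, s'.mem) = iter (G a) (glob a).N (0, s.mem) ∧ ∀ j < d, s'.reg j = s.reg j := by
  have hsz : 0 < Ctx.size α := by have := Ctx.size_ge (α := α); omega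
  -- Register `d` is the accumulator, `d + 1` the loop variable counting up, and `d + 2` the counter
  -- running down from `N`. Register `d + 3` is `0` while `N` is copied and then holds the constant
  -- `1` by which both counters change.
  refine ⟨.seq (.const d 0) <| .seq (.const (d + 1) 0) <| .seq (.const (d + 3) 0) <|
    .seq (.add (d + 2) (ρ 0) (d + 3)) <| .seq (.const (d + 3) 1) <| .loop (d + 2) <|
    .seq p <| .seq (.add (d + 1) (d + 1) (d + 3)) <| .sub (d + 2) (d + 2) (d + 3),
    fun a s hs => ?_⟩
  have h0 : ρ 0 < d := hd 0 hsz
  have hN : s.reg (ρ 0) = (glob a).N := (hs 0 hsz).trans (Ctx.var_zero a)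
  have hB : (Polynomial.X * (b + 3) + 6 : Polynomial ℕ).eval (glob a).N =
      1 + (1 + (1 + (1 + (1 + ((glob a).N * (b.eval (glob a).N + 2 + 1) + 1))))) := by
    simp
    ring
  rw [hB]
  refine Run.seq (Run.const rfl) ?_
  rintro _ rfl
  refine Run.seq (Run.const rfl) ?_
  rintro _ rfl
  refine Run.seq (Run.const rfl) ?_
  rintro _ rfl
  refine Run.seq (Run.add rfl) ?_
  rintro _ rfl
  refine Run.seq (Run.const rfl) ?_
  rintro _ rfl
  refine Run.mono (Run.loop (N := (glob a).N)
    (fun i s' => (s'.reg d, s'.mem) = iter (G a) i (0, s.mem) ∧ (∀ j < d, s'.reg j = s.reg j) ∧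
      s'.reg (d + 1) = i ∧ s'.reg (d + 3) = 1) ?_ ?_ ?_) le_rfl fun s' h => ⟨h.1, h.2.1⟩
  · rintro i hi s₁ ⟨h1, h2, h3, h4⟩ h5
    refine Run.seq (hp a s₁ i (fun i hi => by rw [h2 _ (hd i hi), hs i hi]) h3) ?_
    rintro s₂ ⟨h6, h7⟩
    refine Run.seq (B := 1) (B' := 1) (Run.add rfl) ?_
    rintro _ rfl
    refine Run.sub ⟨⟨?_, ?_, ?_, ?_⟩, ?_⟩
    · simpa [iter, ← h1] using h6
    · intro j hj
      have e1 : j ≠ d + 2 := by omega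
      have e2 : j ≠ d + 1 := by omega
      simp [Function.update_of_ne e1, Function.update_of_ne e2, h7 j (by omega) hj.ne, h2 j hj]
    · simp [h7 (d + 1), h7 (d + 3), h3, h4]
    · simp [h7 (d + 3), h4]
    · simp [h7 (d + 2), h7 (d + 3), h4, h5]
      omega
  · refine ⟨by simp [iter], fun j hj => ?_, by simp, by simp⟩
    have e0 : j ≠ d := by omega
    have e1 : j ≠ d + 1 := by omega
    have e2 : j ≠ d + 2 := by omega
    have e3 : j ≠ d + 3 := by omega
    simp [e0, e1, e2, e3]
  · have e0 : ρ 0 ≠ d := by omega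
    have e1 : ρ 0 ≠ d + 1 := by omega
    have e2 : ρ 0 ≠ d + 2 := by omega
    have e3 : ρ 0 ≠ d + 3 := by omega
    simp [e0, e1, e3, hN]

/-- Variables of a loop body: the loop variable is in register `d + 1`. -/
theorem loop_vars {ρ : ℕ → ℕ} {d : ℕ} (hd : ∀ i < Ctx.size α, ρ i < d) :
    (∀ i < Ctx.size (α × ℕ), Function.update ρ (Ctx.size α) (d + 1) i < d + 4) ∧
      ∀ (a : α) (s : RamState) (i : ℕ), (∀ i < Ctx.size α, s.reg (ρ i) = Ctx.var a i) →
        s.reg (d + 1) = i → ∀ j < Ctx.size (α × ℕ),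
          s.reg (Function.update ρ (Ctx.size α) (d + 1) j) = Ctx.var (a, i) j := by
  have hsz : Ctx.size (α × ℕ) = Ctx.size α + 1 := rfl
  constructor
  · intro i hi
    by_cases h : i = Ctx.size α
    · simp [h]
    · rw [Function.update_of_ne h]
      have := hd i (by omega)
      omega
  · intro a s i h1 h2 j hj
    by_cases h : j = Ctx.size α
    · subst h
      rw [Function.update_self, h2]
      exact (if_pos rfl).symm
    · rw [Function.update_of_ne h, h1 j (by omega)]
      exact (if_neg h).symm

namespace Comp

theorem sum {g : α → ℕ → Mem → ℕ} (hg : Comp (fun (p : α × ℕ) μ => g p.1 p.2 μ)) :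
    Comp (fun a μ => ∑ i ∈ Finset.range (glob a).N, g a i μ) := by
  obtain ⟨b, hb⟩ := hg
  refine ⟨Polynomial.X * (b + 1 + 3) + 6, fun ρ d hd => ?_⟩
  obtain ⟨hd', hv⟩ := loop_vars hd
  obtain ⟨p, hp⟩ := hb _ (d + 4) hd'
  -- The summand is left in `d + 4`, the first register that the loop frame does not use.
  obtain ⟨q, hq⟩ := exists_loop_prog (b + 1) ρ d hd (.seq p (.add d d (d + 4)))
    (fun a i x => (x.1 + g a i x.2, x.2)) (by
      intro a s i h1 h2
      rw [Polynomial.eval_add, Polynomial.eval_one]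
      refine Run.seq (hp (a, i) s (hv a s i h1 h2)) fun s' ⟨h3, h4, h5⟩ => ?_
      refine Run.add ⟨?_, fun j hj hj' => ?_⟩
      · simp [h3, h4, h5]
      · simp [hj', h4 j hj])
  refine ⟨q, fun a s hs => Run.mono (hq a s hs) le_rfl ?_⟩
  rintro s' ⟨h1, h2⟩
  have key : ∀ m, iter (fun i (x : ℕ × Mem) => (x.1 + g a i x.2, x.2)) m (0, s.mem) =
      (∑ i ∈ Finset.range m, g a i s.mem, s.mem) := by
    intro m
    induction m with
    | zero => simp [iter]
    | succ m ih => simp [iter, ih, Finset.sum_range_succ]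
  rw [key, Prod.mk.injEq] at h1
  exact ⟨h1.2, h2, h1.1⟩

end Comp

namespace CompS

variable {F G : α → Mem → Mem}

theorem id : CompS (fun (_ : α) μ => μ) := by
  refine ⟨1, fun ρ d hd => ⟨.const d 0, fun a s hs => ?_⟩⟩
  refine Run.mono (Run.const ⟨rfl, fun j hj => ?_⟩) (by simp) fun _ h => h
  simp [Function.update_of_ne hj.ne]

theorem store {f g : α → Mem → ℕ} (hf : Comp f) (hg : Comp g) :
    CompS (fun a μ => Function.update μ (f a μ) (g a μ)) := by
  obtain ⟨b, hb⟩ := Comp.two_runs hf hg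
  refine ⟨b + 1, fun ρ d hd => ?_⟩
  obtain ⟨p, hp⟩ := hb ρ d hd
  refine ⟨.seq p (.store d (d + 1)), fun a s hs => ?_⟩
  rw [Polynomial.eval_add, Polynomial.eval_one]
  refine Run.seq (hp a s hs) fun s' ⟨h1, h2, h3, h4⟩ => ?_
  exact Run.store ⟨by simp [h1, h3, h4], h2⟩

theorem seq (hF : CompS F) (hG : CompS G) : CompS (fun a μ => G a (F a μ)) := by
  obtain ⟨b, hb⟩ := hF
  obtain ⟨b', hb'⟩ := hG
  refine ⟨b + b', fun ρ d hd => ?_⟩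
  obtain ⟨p, hp⟩ := hb ρ d hd
  obtain ⟨q, hq⟩ := hb' ρ d hd
  refine ⟨.seq p q, fun a s hs => ?_⟩
  rw [Polynomial.eval_add]
  refine Run.seq (hp a s hs) fun s' ⟨h1, h2⟩ => ?_
  refine Run.mono (hq a s' fun i hi => by rw [h2 _ (hd i hi), hs i hi]) le_rfl ?_
  rintro s'' ⟨h1', h2'⟩
  exact ⟨by rw [h1', h1], fun j hj => by rw [h2' j hj, h2 j hj]⟩

theorem ite {P : α → Mem → Prop} {_ : ∀ a μ, Decidable (P a μ)} (hP : CompP P)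
    (hF : CompS F) (hG : CompS G) :
    CompS (fun a μ => if P a μ then F a μ else G a μ) := by
  obtain ⟨c, ⟨b, hb⟩, hc⟩ := hP
  obtain ⟨b₁, hb₁⟩ := hF
  obtain ⟨b₂, hb₂⟩ := hG
  refine ⟨b + (b₁ + b₂ + 1), fun ρ d hd => ?_⟩
  obtain ⟨p, hp⟩ := hb ρ d hd
  obtain ⟨p₁, hp₁⟩ := hb₁ ρ d hd
  obtain ⟨p₂, hp₂⟩ := hb₂ ρ d hd
  refine ⟨.seq p (.ite d p₁ p₂), fun a s hs => ?_⟩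
  rw [Polynomial.eval_add, Polynomial.eval_add, Polynomial.eval_one]
  refine Run.seq (hp a s hs) fun s' ⟨h1, h2, h3⟩ => ?_
  have hs' : ∀ i < Ctx.size α, s'.reg (ρ i) = Ctx.var a i := fun i hi => by
    rw [h2 _ (hd i hi), hs i hi]
  refine Run.ite (fun h => ?_) fun h => ?_
  · refine Run.mono (hp₁ a s' hs') (by simp) ?_
    rintro s'' ⟨h1', h2'⟩
    refine ⟨?_, fun j hj => by rw [h2' j hj, h2 j hj]⟩
    have : P a s.mem := (hc a s.mem).1 (by rwa [← h3])
    simp [h1', h1, this]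
  · refine Run.mono (hp₂ a s' hs') (by simp) ?_
    rintro s'' ⟨h1', h2'⟩
    refine ⟨?_, fun j hj => by rw [h2' j hj, h2 j hj]⟩
    have : ¬ P a s.mem := fun hPa => (hc a s.mem).2 hPa (by rw [← h3, h])
    simp [h1', h1, this]

theorem loop {F : α → ℕ → Mem → Mem} (hF : CompS (fun (p : α × ℕ) μ => F p.1 p.2 μ)) :
    CompS (fun a μ => iter (F a) (glob a).N μ) := by
  obtain ⟨b, hb⟩ := hF
  refine ⟨Polynomial.X * (b + 3) + 6, fun ρ d hd => ?_⟩
  obtain ⟨hd', hv⟩ := loop_vars hd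
  obtain ⟨p, hp⟩ := hb _ (d + 4) hd'
  obtain ⟨q, hq⟩ := exists_loop_prog b ρ d hd p (fun a i x => (x.1, F a i x.2)) (by
      intro a s i h1 h2
      refine Run.mono (hp (a, i) s (hv a s i h1 h2)) le_rfl fun s' ⟨h3, h4⟩ => ?_
      exact ⟨by simp [h3, h4], fun j hj _ => h4 j hj⟩)
  refine ⟨q, fun a s hs => Run.mono (hq a s hs) le_rfl ?_⟩
  rintro s' ⟨h1, h2⟩
  have key : ∀ m, iter (fun i (x : ℕ × Mem) => (x.1, F a i x.2)) m (0, s.mem) =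
      (0, iter (F a) m s.mem) := by
    intro m
    induction m with
    | zero => simp [iter]
    | succ m ih => simp [iter, ih]
  rw [key, Prod.mk.injEq] at h1
  exact ⟨h1.2, h2⟩

/-- Run `F` with an additional variable, whose value is given by `f`. -/
theorem bind {F : α → ℕ → Mem → Mem} {f : α → Mem → ℕ} (hf : Comp f)
    (hF : CompS (fun (p : α × ℕ) μ => F p.1 p.2 μ)) : CompS (fun a μ => F a (f a μ) μ) := by
  obtain ⟨b, hb⟩ := hf
  obtain ⟨b', hb'⟩ := hF
  refine ⟨b + b', fun ρ d hd => ?_⟩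
  have hd₁ : ∀ i < Ctx.size α, ρ i < d + 1 := fun i hi => (hd i hi).trans (Nat.lt_succ_self _)
  obtain ⟨hd', hv⟩ := loop_vars hd₁
  obtain ⟨p, hp⟩ := hb ρ (d + 2) fun i hi => (hd i hi).trans (by omega)
  obtain ⟨q, hq⟩ := hb' _ (d + 1 + 4) hd'
  refine ⟨.seq p q, fun a s hs => ?_⟩
  rw [Polynomial.eval_add]
  refine Run.seq (hp a s hs) fun s' ⟨h1, h2, h3⟩ => ?_
  refine Run.mono (hq (a, f a s.mem) s' (hv a s' _ (fun i hi => ?_) h3)) le_rfl ?_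
  · rw [h2 _ ((hd i hi).trans (by omega)), hs i hi]
  rintro s'' ⟨h1', h2'⟩
  exact ⟨by rw [h1', h1], fun j hj => by rw [h2' j (by omega), h2 j (by omega)]⟩

end CompS

end OverlapPacking

/-! ### Computable predicates, bounded quantifiers, counting and arithmetic -/

namespace OverlapPacking

open Ctx (glob)

variable {α : Type} [Ctx α]

theorem Comp.zero_one {P : α → Mem → Prop} {dec : ∀ a μ, Decidable (P a μ)} (hP : CompP P) :
    Comp (fun a μ => if P a μ then 1 else 0) := by
  obtain ⟨c, hc, hcP⟩ := hP
  exact (ite_ne_zero hc (const 1) (const 0)).congr fun a μ => by simp only [hcP]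

theorem Comp.ite {P : α → Mem → Prop} {dec : ∀ a μ, Decidable (P a μ)} {f g : α → Mem → ℕ}
    (hP : CompP P) (hf : Comp f) (hg : Comp g) :
    Comp (fun a μ => if P a μ then f a μ else g a μ) := by
  obtain ⟨c, hc, hcP⟩ := hP
  exact (ite_ne_zero hc hf hg).congr fun a μ => by simp only [hcP]

namespace CompP

variable {P Q : α → Mem → Prop} {f g : α → Mem → ℕ}

theorem congr (hP : CompP P) (h : ∀ a μ, P a μ ↔ Q a μ) : CompP Q := by
  have : P = Q := funext fun a => funext fun μ => propext (h a μ)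
  exact this ▸ hP

theorem fst (hP : CompP P) : CompP (fun (p : α × ℕ) μ => P p.1 μ) := by
  obtain ⟨c, hc, hcP⟩ := hP
  exact ⟨_, hc.fst, fun a μ => hcP a.1 μ⟩

theorem middle {P : α × ℕ → Mem → Prop} (hP : CompP P) :
    CompP (fun (p : (α × ℕ) × ℕ) μ => P (p.1.1, p.2) μ) := by
  obtain ⟨c, hc, hcP⟩ := hP
  exact ⟨_, hc.middle, fun a μ => hcP (a.1.1, a.2) μ⟩

theorem ne_zero (hf : Comp f) : CompP (fun a μ => f a μ ≠ 0) :=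
  ⟨f, hf, fun _ _ => Iff.rfl⟩

theorem lt (hf : Comp f) (hg : Comp g) : CompP (fun a μ => f a μ < g a μ) :=
  ⟨_, hg.sub hf, fun _ _ => by omega⟩

theorem not (hP : CompP P) : CompP (fun a μ => ¬ P a μ) := by
  obtain ⟨c, hc, hcP⟩ := hP
  refine ⟨_, Comp.ite_ne_zero hc (.const 0) (.const 1), fun a μ => ?_⟩
  simp [← hcP]

theorem and (hP : CompP P) (hQ : CompP Q) : CompP (fun a μ => P a μ ∧ Q a μ) := by
  obtain ⟨c, hc, hcP⟩ := hP
  obtain ⟨c', hc', hcQ⟩ := hQ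
  refine ⟨_, Comp.ite_ne_zero hc hc' (.const 0), fun a μ => ?_⟩
  simp [← hcP, ← hcQ]

theorem or (hP : CompP P) (hQ : CompP Q) : CompP (fun a μ => P a μ ∨ Q a μ) :=
  (hP.not.and hQ.not).not.congr fun a μ => by tauto

theorem imp (hP : CompP P) (hQ : CompP Q) : CompP (fun a μ => P a μ → Q a μ) :=
  (hP.not.or hQ).congr fun a μ => by tauto

theorem le (hf : Comp f) (hg : Comp g) : CompP (fun a μ => f a μ ≤ g a μ) :=
  (lt hg hf).not.congr fun _ _ => not_lt

theorem eq (hf : Comp f) (hg : Comp g) : CompP (fun a μ => f a μ = g a μ) :=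
  ((le hf hg).and (le hg hf)).congr fun _ _ => le_antisymm_iff.symm

/-- A sum of natural numbers is nonzero exactly when some summand is, so a bounded quantifier is a
loop that adds up truth values. -/
theorem ex {P : α → ℕ → Mem → Prop} (hP : CompP (fun (p : α × ℕ) μ => P p.1 p.2 μ)) :
    CompP (fun a μ => ∃ i < (glob a).N, P a i μ) := by
  obtain ⟨c, hc, hcP⟩ := hP
  refine ⟨_, Comp.sum (g := fun a i μ => c (a, i) μ) hc, fun a μ => ?_⟩
  have : ∀ i, c (a, i) μ ≠ 0 ↔ P a i μ := fun i => hcP (a, i) μ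
  simp [Finset.sum_eq_zero_iff, ← this]

theorem all {P : α → ℕ → Mem → Prop} (hP : CompP (fun (p : α × ℕ) μ => P p.1 p.2 μ)) :
    CompP (fun a μ => ∀ i < (glob a).N, P a i μ) :=
  (ex (P := fun a i μ => ¬ P a i μ) hP.not).not.congr fun a μ => by simp

/-- A finite disjunction. -/
theorem exFinite (m : ℕ) {P : ℕ → α → Mem → Prop} (hP : ∀ i < m, CompP (P i)) :
    CompP (fun a μ => ∃ i < m, P i a μ) := by
  induction m with
  | zero => exact (ne_zero (Comp.const 0)).congr fun a μ => by simp
  | succ m ih =>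
    exact ((ih fun i hi => hP i (by omega)).or (hP m (by omega))).congr fun a μ =>
      Nat.exists_lt_succ_right.symm

end CompP

namespace Comp

variable {f g : α → Mem → ℕ}

/-- Multiplication, provided that the first factor is at most the loop length. -/
theorem mul (hf : Comp f) (hg : Comp g) :
    Comp (fun a μ => min (f a μ) (glob a).N * g a μ) := by
  refine (sum (g := fun a i μ => if i < f a μ then g a μ else 0)
    (ite (CompP.lt snd hf.fst) hg.fst (const 0))).congr fun a μ => ?_
  rw [← Finset.sum_filter, Finset.sum_const, smul_eq_mul]
  congr 1
  have : (Finset.range (glob a).N).filter (· < f a μ) = Finset.range (min (f a μ) (glob a).N) := by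
    ext i
    simp [and_comm]
  rw [this, Finset.card_range]

theorem constMul (c : ℕ) (hf : Comp f) : Comp (fun a μ => c * f a μ) := by
  induction c with
  | zero => exact (const 0).congr fun a μ => by simp
  | succ c ih => exact (ih.add hf).congr fun a μ => by ring

/-- Number of `i` less than the loop length with a given property. -/
theorem count {P : α → ℕ → Mem → Prop} {dec : ∀ a i μ, Decidable (P a i μ)}
    (hP : CompP (fun (p : α × ℕ) μ => P p.1 p.2 μ)) :
    Comp (fun a μ => ((Finset.range (glob a).N).filter fun i => P a i μ).card) := by
  have h1 : Comp (fun (p : α × ℕ) μ => if P p.1 p.2 μ then 1 else 0) := zero_one hP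
  exact (sum (g := fun a i μ => if P a i μ then 1 else 0) h1).congr fun a μ =>
    (Finset.card_filter _ _).symm

/-- Any function of finitely many truth values. -/
theorem table {ι : Type} [Finite ι] {P : ι → α → Mem → Prop} (hP : ∀ i, CompP (P i))
    (F : (ι → Prop) → ℕ) : Comp (fun a μ => F fun i => P i a μ) := by
  have key : ∀ (m : ℕ) (P : Fin m → α → Mem → Prop), (∀ i, CompP (P i)) →
      ∀ F : (Fin m → Prop) → ℕ, Comp (fun a μ => F fun i => P i a μ) := by
    intro m
    induction m with
    | zero =>
      intro P _ F
      exact (const (F fun _ => True)).congr fun a μ => by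
        congr 1
        ext i
        exact i.elim0
    | succ m ih =>
      intro P hP F
      classical
      -- A decision tree: the first truth value is fixed by a branch, and at the leaves `F` has
      -- become a constant of the program. Hence `F` itself may be arbitrary.
      refine (ite (dec := fun _ _ => Classical.propDecidable _) (hP 0)
        (ih _ (fun i => hP i.succ) fun q => F (Fin.cons True q))
        (ih _ (fun i => hP i.succ) fun q => F (Fin.cons False q))).congr fun a μ => ?_
      split_ifs with h
      · congr 1
        ext i
        refine Fin.cases ?_ (fun i => ?_) i <;> simp [h]
      · congr 1
        ext i
        refine Fin.cases ?_ (fun i => ?_) i <;> simp [h]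
  obtain ⟨m, ⟨e⟩⟩ := Finite.exists_equiv_fin ι
  refine (key m (fun i => P (e.symm i)) (fun i => hP _) fun q => F fun i => q (e i)).congr
    fun a μ => ?_
  simp

theorem boundPow (e : ℕ) : Comp (fun (a : α) _ => (glob a).N ^ e) := by
  induction e with
  | zero => exact (const 1).congr fun a μ => by simp
  | succ e ih =>
    refine (mul bound ih).congr fun a μ => ?_
    rw [min_self, pow_succ']

end Comp

/-! ### From loop programs to polynomial-time maps of instances -/

theorem Polynomial.eval_le_eval (b : Polynomial ℕ) {x y : ℕ} (h : x ≤ y) :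
    b.eval x ≤ b.eval y := by
  rw [Polynomial.eval_eq_sum, Polynomial.eval_eq_sum]
  exact Finset.sum_le_sum fun i _ => Nat.mul_le_mul_left _ (Nat.pow_le_pow_left h i)

/-- The parameters on input `I`. -/
def PackInstance.glob (m : ℕ) (I : PackInstance) : Glob := ⟨I.order, I.k, m⟩

-- The loop length N = (n+2)^(m+1) is itself obtained with the loop calculus: the power program runs
-- with loop length n+2, which two instructions provide. As `m` is fixed, every time bound is a
-- polynomial in n+2.
open Classical in
theorem polyTimeComputable_of_comp (m : ℕ) {F : Glob → Mem → Mem} (hF : CompS F)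
    {fN fK : Glob → Mem → ℕ} (hN : Comp fN) (hK : Comp fK) {f : PackInstance → PackInstance}
    (hf : ∀ I, fN (I.glob m) (F (I.glob m) I.initState.mem) = (f I).order ∧
      fK (I.glob m) (F (I.glob m) I.initState.mem) = (f I).k ∧
        ∀ i j : Fin (f I).order, F (I.glob m) I.initState.mem (i.val * (f I).order + j.val) =
          if (f I).graph.Adj i j then 1 else 0) : PolyTimeComputable f := by
  obtain ⟨b₁, h₁⟩ := Comp.boundPow (α := Glob) (m + 1)
  obtain ⟨b₂, h₂⟩ := hF
  obtain ⟨b₃, h₃⟩ := Comp.two_runs hN hK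
  have hsz : Ctx.size Glob = 3 := rfl
  have hd : ∀ d, 2 ≤ d → ∀ i < Ctx.size Glob, (if i = 0 then d else i - 1) < d + 1 := by
    intro d hd i hi
    rw [hsz] at hi
    split_ifs <;> omega
  obtain ⟨p₁, hp₁⟩ := h₁ (fun i => if i = 0 then 2 else i - 1) 3 (hd 2 le_rfl)
  obtain ⟨p₂, hp₂⟩ := h₂ (fun i => if i = 0 then 3 else i - 1) 4 (hd 3 (by omega))
  obtain ⟨p₃, hp₃⟩ := h₃ (fun i => if i = 0 then 3 else i - 1) 4 (hd 3 (by omega))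
  -- Register `2` gets n+2, `p₁` puts `N` into register `3`, `p₂` transforms the memory, and `p₃`
  -- leaves the two output numbers in registers `4` and `5`. They are moved to `0` and `1` by adding
  -- register `6`, which is zero.
  refine ⟨.seq (.const 2 2) <| .seq (.add 2 0 2) <| .seq p₁ <| .seq p₂ <| .seq p₃ <|
      .seq (.const 6 0) <| .seq (.add 0 4 6) (.add 1 5 6),
    b₁.comp (Polynomial.X + 2) + (b₂.comp ((Polynomial.X + 2) ^ (m + 1)) +
      (b₃.comp ((Polynomial.X + 2) ^ (m + 1)) + 5)), fun I => ?_⟩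
  have hsize : I.order ≤ I.size := by
    unfold PackInstance.size
    nlinarith [Nat.zero_le (Nat.size I.k)]
  have hrun : Run (.seq (.const 2 2) <| .seq (.add 2 0 2) <| .seq p₁ <| .seq p₂ <| .seq p₃ <|
      .seq (.const 6 0) <| .seq (.add 0 4 6) (.add 1 5 6)) I.initState
      (1 + (1 + (b₁.eval (I.glob 0).N + (b₂.eval (I.glob m).N + (b₃.eval (I.glob m).N +
        (1 + (1 + 1)))))))
      fun s => s.Outputs (f I) := by
    refine Run.seq (Run.const rfl) ?_
    rintro _ rfl
    refine Run.seq (Run.add rfl) ?_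
    rintro _ rfl
    -- For the global parameter `m = 0` the loop length is n+2, the content of register `2`.
    refine Run.seq (hp₁ (I.glob 0) _ ?_) ?_
    · intro i hi
      rw [hsz] at hi
      interval_cases i
      · simp [Ctx.var, Glob.N, PackInstance.glob, PackInstance.initState]
      · rfl
      · rfl
    rintro s₁ ⟨e1, e2, e3⟩
    have e1' : s₁.mem = I.initState.mem := e1
    have hv : ∀ i < Ctx.size Glob, s₁.reg (if i = 0 then 3 else i - 1) =
        Ctx.var (I.glob m) i := by
      intro i hi
      rw [hsz] at hi
      interval_cases i
      · refine e3.trans ?_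
        simp [Ctx.var, Glob.N, PackInstance.glob, Ctx.glob]
      · exact e2 0 (by norm_num)
      · exact e2 1 (by norm_num)
    refine Run.seq (hp₂ (I.glob m) s₁ hv) ?_
    rintro s₂ ⟨e4, e5⟩
    refine Run.seq (hp₃ (I.glob m) s₂ fun i hi => by rw [e5 _ (hd 3 (by omega) i hi), hv i hi]) ?_
    rintro s₃ ⟨e6, e7, e8, e9⟩
    obtain ⟨g1, g2, g3⟩ := hf I
    rw [← e1', ← e4] at g1 g2 g3
    refine Run.seq (Run.const rfl) ?_
    rintro _ rfl
    refine Run.seq (Run.add rfl) ?_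
    rintro _ rfl
    refine Run.add ⟨?_, ?_, ?_⟩
    · simp [e8, g1]
    · simp [e9, g2]
    · intro i j
      rw [← g3 i j]
      simp [e6]
  obtain ⟨T, s, h1, h2, h3⟩ := hrun
  refine ⟨T, s, h1, h2.trans ?_, h3⟩
  simp only [Polynomial.eval_add, Polynomial.eval_comp, Polynomial.eval_pow, Polynomial.eval_X,
    Polynomial.eval_ofNat, PackInstance.glob, Glob.N, zero_add, pow_one]
  have hp : (I.order + 2) ^ (m + 1) ≤ (I.size + 2) ^ (m + 1) := Nat.pow_le_pow_left (by omega) _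
  have := Polynomial.eval_le_eval b₁ (show I.order + 2 ≤ I.size + 2 by omega)
  have := Polynomial.eval_le_eval b₂ hp
  have := Polynomial.eval_le_eval b₃ hp
  omega

end OverlapPacking

namespace OverlapPacking

/-! ### Weights of vertex sets -/

/-- The common form of both problems: `ind` says whether the subgraphs must be induced. -/
def Packing (𝓗 : Finset FinGraph) (ind : Prop) (t : ℕ) (I : PackInstance) : Prop :=
  ∃ 𝓚 : Finset I.graph.Subgraph, I.k ≤ 𝓚.card ∧
    (∀ K ∈ 𝓚, IsHSubgraph 𝓗 K ∧ (ind → K.IsInduced)) ∧ PairwiseOverlapLE t 𝓚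

variable (𝓗 : Finset FinGraph) (ind : Prop)

/-- The number of spanning subgraphs of `Γ` which are isomorphic to a member of `𝓗`
(and, if `ind` holds, equal to `Γ`). -/
noncomputable def spanningCount {ι : Type} (Γ : SimpleGraph ι) : ℕ :=
  Nat.card {L : SimpleGraph ι // L ≤ Γ ∧ (∃ H ∈ 𝓗, Nonempty (L ≃g H.2)) ∧ (ind → L = Γ)}

theorem spanningCount_comap_equiv {ι κ : Type} (e : ι ≃ κ) (Γ : SimpleGraph κ) :
    spanningCount 𝓗 ind (Γ.comap e) = spanningCount 𝓗 ind Γ := by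
  refine Nat.card_congr ((Equiv.simpleGraph e).subtypeEquiv fun L => ?_)
  have hL : (Equiv.simpleGraph e L) = L.comap e.symm := rfl
  rw [hL]
  have h1 : L.comap e.symm ≤ Γ ↔ L ≤ Γ.comap e := by
    constructor
    · intro h a b hab
      exact h (by simpa using hab)
    · intro h a b hab
      have := h (show L.Adj (e.symm a) (e.symm b) from hab)
      simpa using this
  have h2 : L.comap e.symm = Γ ↔ L = Γ.comap e := by
    constructor
    · rintro rfl
      ext a b
      simp
    · rintro rfl
      ext a b
      simp
  rw [h1, h2]
  have iso : L.comap e.symm ≃g L := SimpleGraph.Iso.comap e.symm L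
  have h3 : (∃ H ∈ 𝓗, Nonempty (L ≃g H.2)) ↔ ∃ H ∈ 𝓗, Nonempty (L.comap e.symm ≃g H.2) :=
    ⟨fun ⟨H, hH, ⟨f⟩⟩ => ⟨H, hH, ⟨iso.trans f⟩⟩, fun ⟨H, hH, ⟨f⟩⟩ => ⟨H, hH, ⟨iso.symm.trans f⟩⟩⟩
  rw [h3]

/-- The number of `𝓗`-subgraphs of `Γ` (induced ones, if `ind` holds) with vertex set `S`. -/
noncomputable def weight (Γ : SimpleGraph ℕ) (S : Finset ℕ) : ℕ :=
  spanningCount 𝓗 ind (Γ.comap ((↑) : S → ℕ))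

/-- The weight can be computed from any enumeration of the set without repetition. This serves both
for renaming vertices and for reading weights off from tuples. -/
theorem weight_eq_of_injective {ι : Type} (Γ : SimpleGraph ℕ) {S : Finset ℕ} {φ : ι → ℕ}
    (hφ : Function.Injective φ) (hS : Set.range φ = S) :
    weight 𝓗 ind Γ S = spanningCount 𝓗 ind (Γ.comap φ) := by
  let e : ι ≃ S := (Equiv.ofInjective φ hφ).trans (Equiv.setCongr hS)
  rw [weight, ← spanningCount_comap_equiv 𝓗 ind e]
  rfl

theorem card_le_of_weight_ne_zero {Γ : SimpleGraph ℕ} {S : Finset ℕ}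
    (h : weight 𝓗 ind Γ S ≠ 0) : S.card ≤ maxOrder 𝓗 := by
  rw [weight, spanningCount] at h
  obtain ⟨⟨L, _, ⟨H, hH, ⟨f⟩⟩, _⟩⟩ := (Nat.card_ne_zero.1 h).1
  have h1 : Nat.card S = Nat.card (Fin H.1) := Nat.card_congr f.toEquiv
  rw [Nat.card_eq_fintype_card, Fintype.card_coe, Nat.card_fin] at h1
  rw [h1]
  exact Finset.le_sup (f := fun H : FinGraph => H.1) hH

variable {𝓗 ind}

/-- A graph on `{0, …, n - 1}` as a graph on all natural numbers. -/
def natGraph {n : ℕ} (G : SimpleGraph (Fin n)) : SimpleGraph ℕ := G.map Fin.valEmbedding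

theorem natGraph_adj_val {n : ℕ} {G : SimpleGraph (Fin n)} {u v : Fin n} :
    (natGraph G).Adj u v ↔ G.Adj u v :=
  SimpleGraph.map_adj_apply (f := Fin.valEmbedding)

theorem natGraph_adj {n : ℕ} {G : SimpleGraph (Fin n)} {u v : ℕ} (hu : u < n) (hv : v < n) :
    (natGraph G).Adj u v ↔ G.Adj ⟨u, hu⟩ ⟨v, hv⟩ :=
  natGraph_adj_val (u := ⟨u, hu⟩) (v := ⟨v, hv⟩)

open Classical in
/-- The vertex set of a subgraph, as a set of numbers. -/
noncomputable def vertSet {n : ℕ} {G : SimpleGraph (Fin n)} (K : G.Subgraph) : Finset ℕ :=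
  (Finset.univ.filter (· ∈ K.verts)).map Fin.valEmbedding

section

variable {n : ℕ} {G : SimpleGraph (Fin n)}

theorem mem_vertSet {K : G.Subgraph} {u : Fin n} : u.val ∈ vertSet K ↔ u ∈ K.verts := by
  simp [vertSet, Fin.val_inj]

theorem vertSet_subset (K : G.Subgraph) : vertSet K ⊆ Finset.range n := by
  intro u hu
  simp only [vertSet, Finset.mem_map] at hu
  obtain ⟨v, _, rfl⟩ := hu
  simp

theorem ncard_inter_verts (K L : G.Subgraph) :
    (K.verts ∩ L.verts).ncard = (vertSet K ∩ vertSet L).card := by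
  classical
  rw [vertSet, vertSet, ← Finset.map_inter, Finset.card_map, ← Set.ncard_coe_finset]
  congr 1
  ext u
  simp

/-- Once the vertex set is fixed, a subgraph is the same as a graph on that set below the induced
one. Pulling back along `φ` is the bijection, and it respects the isomorphism type and inducedness.
-/
theorem card_subgraph_eq_weight {S : Finset ℕ} (hS : S ⊆ Finset.range n) :
    Nat.card {K : G.Subgraph // vertSet K = S ∧ IsHSubgraph 𝓗 K ∧ (ind → K.IsInduced)} =
      weight 𝓗 ind (natGraph G) S := by
  have hlt : ∀ x : S, x.1 < n := fun x => Finset.mem_range.1 (hS x.2)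
  let φ : S → Fin n := fun x => ⟨x.1, hlt x⟩
  have hφ : Function.Injective φ := fun x y h => Subtype.ext (congrArg Fin.val h)
  have hverts : ∀ K : G.Subgraph, vertSet K = S ↔ K.verts = Set.range φ := by
    intro K
    constructor
    · rintro rfl
      ext u
      rw [← mem_vertSet]
      constructor
      · intro h
        exact ⟨⟨u, h⟩, rfl⟩
      · rintro ⟨x, rfl⟩
        exact x.2
    · intro h
      ext u
      constructor
      · intro hu
        have hu' := Finset.mem_range.1 (vertSet_subset K hu)
        have : (⟨u, hu'⟩ : Fin n) ∈ K.verts := mem_vertSet.1 hu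
        rw [h] at this
        obtain ⟨x, hx⟩ := this
        have : x.1 = u := congrArg Fin.val hx
        exact this ▸ x.2
      · intro hu
        have : φ ⟨u, hu⟩ ∈ K.verts := h ▸ ⟨_, rfl⟩
        exact mem_vertSet.2 this
  have hΓ : (natGraph G).comap ((↑) : S → ℕ) = G.comap φ := by
    ext x y
    exact natGraph_adj (hlt x) (hlt y)
  rw [weight, spanningCount, hΓ]
  have key : ∀ K : G.Subgraph, K.verts = Set.range φ →
      ((∃ H ∈ 𝓗, Nonempty (K.spanningCoe.comap φ ≃g H.2)) ↔ IsHSubgraph 𝓗 K) ∧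
      (K.spanningCoe.comap φ = G.comap φ ↔ K.IsInduced) := by
    intro K hK
    have iso : K.spanningCoe.comap φ ≃g K.coe :=
      { toEquiv := (Equiv.ofInjective φ hφ).trans (Equiv.setCongr hK.symm)
        map_rel_iff' := Iff.rfl }
    refine ⟨⟨fun ⟨H, hH, ⟨f⟩⟩ => ⟨H, hH, ⟨iso.symm.trans f⟩⟩,
      fun ⟨H, hH, ⟨f⟩⟩ => ⟨H, hH, ⟨iso.trans f⟩⟩⟩, ?_⟩
    constructor
    · intro h u hu v hv huv
      rw [hK] at hu hv
      obtain ⟨x, rfl⟩ := hu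
      obtain ⟨y, rfl⟩ := hv
      have : (G.comap φ).Adj x y := huv
      rw [← h] at this
      exact this
    · intro h
      ext x y
      constructor
      · intro hxy
        exact K.adj_sub hxy
      · intro hxy
        exact h (hK ▸ ⟨x, rfl⟩) (hK ▸ ⟨y, rfl⟩) hxy
  refine Nat.card_congr
    { toFun := fun K => ⟨K.1.spanningCoe.comap φ, ?_⟩
      invFun := fun L => ⟨{ verts := Set.range φ
                            Adj := fun u v => ∃ x y, L.1.Adj x y ∧ φ x = u ∧ φ y = v
                            adj_sub := ?_
                            edge_vert := ?_
                            symm := ?_ }, ?_⟩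
      left_inv := ?_
      right_inv := ?_ }
  · obtain ⟨K, hK1, hK2, hK3⟩ := K
    obtain ⟨h1, h2⟩ := key K ((hverts K).1 hK1)
    exact ⟨fun x y hxy => K.adj_sub hxy, h1.2 hK2, fun hi => h2.2 (hK3 hi)⟩
  · rintro _ _ ⟨x, y, hxy, rfl, rfl⟩
    exact L.2.1 hxy
  · rintro _ _ ⟨x, y, hxy, rfl, rfl⟩
    exact ⟨x, rfl⟩
  · refine ⟨?_⟩
    rintro _ _ ⟨x, y, hxy, rfl, rfl⟩
    exact ⟨y, x, hxy.symm, rfl, rfl⟩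
  · obtain ⟨L, hL1, hL2, hL3⟩ := L
    set K : G.Subgraph := { verts := Set.range φ
                            Adj := fun u v => ∃ x y, L.Adj x y ∧ φ x = u ∧ φ y = v
                            adj_sub := _
                            edge_vert := _
                            symm := _ } with hK
    have hKL : K.spanningCoe.comap φ = L := by
      ext x y
      constructor
      · rintro ⟨x', y', h, hx, hy⟩
        rwa [hφ hx, hφ hy] at h
      · intro h
        exact ⟨x, y, h, rfl, rfl⟩
    obtain ⟨h1, h2⟩ := key K rfl
    rw [hKL] at h1 h2
    exact ⟨(hverts K).2 rfl, h1.1 hL2, fun hi => h2.1 (hL3 hi)⟩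
  · rintro ⟨K, hK1, hK2, hK3⟩
    have hK := (hverts K).1 hK1
    apply Subtype.ext
    apply SimpleGraph.Subgraph.ext
    · exact hK.symm
    · ext u v
      constructor
      · rintro ⟨x, y, h, rfl, rfl⟩
        exact h
      · intro h
        have hu := K.edge_vert h
        have hv := K.edge_vert h.symm
        rw [hK] at hu hv
        obtain ⟨x, rfl⟩ := hu
        obtain ⟨y, rfl⟩ := hv
        exact ⟨x, y, h, rfl, rfl⟩
  · rintro ⟨L, hL⟩
    apply Subtype.ext
    ext x y
    constructor
    · rintro ⟨x', y', h, hx, hy⟩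
      rwa [hφ hx, hφ hy] at h
    · intro h
      exact ⟨x, y, h, rfl, rfl⟩

end

/-! ### Packings of vertex sets -/

variable (𝓗 ind)

/-- The number of `𝓗`-subgraphs inside `W` with at most `t` vertices. -/
noncomputable def smallCount (t : ℕ) (Γ : SimpleGraph ℕ) (W : Finset ℕ) : ℕ :=
  ∑ S ∈ W.powerset with S.card ≤ t, weight 𝓗 ind Γ S

/-- There are `m` different sets inside `W` with more than `t` elements which are vertex sets of
`𝓗`-subgraphs and pairwise share at most `t` elements. -/
def SetPacking (t : ℕ) (Γ : SimpleGraph ℕ) (W : Finset ℕ) (m : ℕ) : Prop :=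
  ∃ 𝒬 : Finset (Finset ℕ), m ≤ 𝒬.card ∧
    (∀ S ∈ 𝒬, S ⊆ W ∧ t < S.card ∧ weight 𝓗 ind Γ S ≠ 0) ∧
    ∀ S ∈ 𝒬, ∀ T ∈ 𝒬, S ≠ T → (S ∩ T).card ≤ t

/-- Small subgraphs are free: they conflict with nothing, whether or not they share their vertex set
with others. Every packing may therefore be assumed to contain all of them, and only k minus their
number must come from larger ones. Truncated subtraction covers the case that the small ones
suffice. -/
theorem packing_iff (t : ℕ) (I : PackInstance) :
    Packing 𝓗 ind t I ↔ SetPacking 𝓗 ind t (natGraph I.graph) (Finset.range I.order)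
      (I.k - smallCount 𝓗 ind t (natGraph I.graph) (Finset.range I.order)) := by
  classical
  obtain ⟨n, G, k⟩ := I
  dsimp only
  let Φ : G.Subgraph → Prop := fun K => IsHSubgraph 𝓗 K ∧ (ind → K.IsInduced)
  have : Fintype G.Subgraph := Fintype.ofFinite _
  have hfiber : ∀ S ⊆ Finset.range n,
      (Finset.univ.filter fun K : G.Subgraph => vertSet K = S ∧ Φ K).card =
        weight 𝓗 ind (natGraph G) S := by
    intro S hS
    rw [← card_subgraph_eq_weight hS, Nat.card_eq_fintype_card, Fintype.card_subtype]
  have hsmall : (Finset.univ.filter fun K : G.Subgraph => Φ K ∧ (vertSet K).card ≤ t).card =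
      smallCount 𝓗 ind t (natGraph G) (Finset.range n) := by
    rw [smallCount, Finset.card_eq_sum_card_fiberwise (f := vertSet)
      (t := (Finset.range n).powerset.filter fun S => S.card ≤ t)]
    · refine Finset.sum_congr rfl fun S hS => ?_
      rw [Finset.mem_filter, Finset.mem_powerset] at hS
      rw [← hfiber S hS.1]
      congr 1
      ext K
      simp only [Finset.mem_filter, Finset.mem_univ, true_and]
      constructor
      · rintro ⟨⟨h1, h2⟩, rfl⟩
        exact ⟨rfl, h1⟩
      · rintro ⟨rfl, h1⟩
        exact ⟨⟨h1, hS.2⟩, rfl⟩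
    · intro K hK
      have hK' := (Finset.mem_filter.1 hK).2
      simp [vertSet_subset, hK'.2]
  rw [← hsmall]
  constructor
  · rintro ⟨𝓚, hk, hΦ, ht⟩
    dsimp only at 𝓚 hk hΦ ht
    have hsplit := Finset.card_filter_add_card_filter_not (s := 𝓚) fun K => (vertSet K).card ≤ t
    have hle : (𝓚.filter fun K => (vertSet K).card ≤ t).card ≤
        (Finset.univ.filter fun K : G.Subgraph => Φ K ∧ (vertSet K).card ≤ t).card := by
      refine Finset.card_le_card fun K hK => ?_
      rw [Finset.mem_filter] at hK
      exact Finset.mem_filter.2 ⟨Finset.mem_univ _, hΦ K hK.1, hK.2⟩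
    have hne : ∀ K ∈ 𝓚.filter fun K => ¬ (vertSet K).card ≤ t, ∀ L ∈ 𝓚, K ≠ L →
        (vertSet K ∩ vertSet L).card ≤ t := by
      intro K hK L hL hKL
      rw [← ncard_inter_verts]
      exact ht K (Finset.mem_filter.1 hK).1 L hL hKL
    -- Two large subgraphs with the same vertex set would share more than `t` vertices.
    have hinj : Set.InjOn vertSet
        (↑(𝓚.filter fun K => ¬ (vertSet K).card ≤ t) : Set G.Subgraph) := by
      intro K hK L hL h
      by_contra hKL
      have := hne K hK L (Finset.mem_filter.1 hL).1 hKL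
      rw [← h, Finset.inter_self] at this
      exact (Finset.mem_filter.1 hK).2 this
    refine ⟨(𝓚.filter fun K => ¬ (vertSet K).card ≤ t).image vertSet, ?_, ?_, ?_⟩
    · rw [Finset.card_image_of_injOn hinj]
      omega
    · intro S hS
      obtain ⟨K, hK, rfl⟩ := Finset.mem_image.1 hS
      rw [Finset.mem_filter] at hK
      refine ⟨vertSet_subset K, not_le.1 hK.2, ?_⟩
      rw [← hfiber _ (vertSet_subset K)]
      exact Finset.card_ne_zero_of_mem
        (Finset.mem_filter.2 ⟨Finset.mem_univ _, rfl, hΦ K hK.1⟩)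
    · intro S hS T hT hST
      obtain ⟨K, hK, rfl⟩ := Finset.mem_image.1 hS
      obtain ⟨L, hL, rfl⟩ := Finset.mem_image.1 hT
      exact hne K hK L (Finset.mem_filter.1 hL).1 fun h => hST (h ▸ rfl)
  · rintro ⟨𝒬, hk, hS, ht⟩
    have hex : ∀ S ∈ 𝒬, ∃ K : G.Subgraph, vertSet K = S ∧ Φ K := by
      intro S h
      have h' := (hS S h).2.2
      rw [← hfiber S (hS S h).1] at h'
      obtain ⟨K, hK⟩ := Finset.card_pos.1 (Nat.pos_of_ne_zero h')
      exact ⟨K, (Finset.mem_filter.1 hK).2⟩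
    choose! κ hκ using hex
    -- All small subgraphs, together with one chosen subgraph on each set of the packing.
    refine ⟨(Finset.univ.filter fun K : G.Subgraph => Φ K ∧ (vertSet K).card ≤ t) ∪ 𝒬.image κ,
      ?_, ?_, ?_⟩
    · rw [Finset.card_union_of_disjoint, Finset.card_image_of_injOn]
      · dsimp only
        omega
      · intro S h T h' hST
        rw [← (hκ S h).1, ← (hκ T h').1, hST]
      · rw [Finset.disjoint_left]
        intro K hK hK'
        obtain ⟨S, h, rfl⟩ := Finset.mem_image.1 hK'
        have h1 := (Finset.mem_filter.1 hK).2.2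
        rw [(hκ S h).1] at h1
        exact absurd (hS S h).2.1 (not_lt.2 h1)
    · intro K hK
      rcases Finset.mem_union.1 hK with hK | hK
      · exact (Finset.mem_filter.1 hK).2.1
      · obtain ⟨S, h, rfl⟩ := Finset.mem_image.1 hK
        exact (hκ S h).2
    · intro K hK L hL hKL
      rw [ncard_inter_verts]
      rcases Finset.mem_union.1 hK with hK | hK
      · exact (Finset.card_le_card Finset.inter_subset_left).trans (Finset.mem_filter.1 hK).2.2
      rcases Finset.mem_union.1 hL with hL | hL
      · exact (Finset.card_le_card Finset.inter_subset_right).trans (Finset.mem_filter.1 hL).2.2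
      obtain ⟨S, h, rfl⟩ := Finset.mem_image.1 hK
      obtain ⟨T, h', rfl⟩ := Finset.mem_image.1 hL
      rw [(hκ S h).1, (hκ T h').1]
      exact ht S h T h' fun e => hKL (e ▸ rfl)

variable {𝓗 ind}

/-! ### Invariance under renaming of vertices, and monotonicity -/

theorem SetPacking.image {t : ℕ} {Γ Γ' : SimpleGraph ℕ} {W W' : Finset ℕ} {m : ℕ} {e : ℕ → ℕ}
    (he : Set.InjOn e W') (hW : W'.image e ⊆ W)
    (hwt : ∀ S ⊆ W', weight 𝓗 ind Γ' S = weight 𝓗 ind Γ (S.image e))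
    (h : SetPacking 𝓗 ind t Γ' W' m) : SetPacking 𝓗 ind t Γ W m := by
  obtain ⟨𝒬, h1, h2, h3⟩ := h
  have hinj : Set.InjOn (fun S : Finset ℕ => S.image e) 𝒬 := by
    intro S hS T hT hST
    have := Finset.image_injOn_powerset_of_injOn he
    exact this (by simpa using (h2 S hS).1) (by simpa using (h2 T hT).1) hST
  refine ⟨𝒬.image fun S => S.image e, ?_, ?_, ?_⟩
  · rwa [Finset.card_image_of_injOn hinj]
  · intro S hS
    obtain ⟨S, hS', rfl⟩ := Finset.mem_image.1 hS
    obtain ⟨h4, h5, h6⟩ := h2 S hS'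
    refine ⟨(Finset.image_subset_image h4).trans hW, ?_, by rwa [← hwt S h4]⟩
    rwa [Finset.card_image_of_injOn (he.mono (by exact_mod_cast h4))]
  · intro S hS T hT hST
    obtain ⟨S, hS', rfl⟩ := Finset.mem_image.1 hS
    obtain ⟨T, hT', rfl⟩ := Finset.mem_image.1 hT
    rw [← Finset.image_inter_of_injOn]
    · exact Finset.card_image_le.trans (h3 S hS' T hT' fun h => hST (h ▸ rfl))
    · refine he.mono ?_
      rw [← Finset.coe_union]
      exact_mod_cast Finset.union_subset (h2 S hS').1 (h2 T hT').1

theorem smallCount_image {t : ℕ} {Γ Γ' : SimpleGraph ℕ} {W W' : Finset ℕ} {e : ℕ → ℕ}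
    (he : Set.InjOn e W') (hW : W'.image e = W)
    (hwt : ∀ S ⊆ W', weight 𝓗 ind Γ' S = weight 𝓗 ind Γ (S.image e)) :
    smallCount 𝓗 ind t Γ' W' = smallCount 𝓗 ind t Γ W := by
  subst hW
  have hcard : ∀ S ⊆ W', (S.image e).card = S.card := fun S hS =>
    Finset.card_image_of_injOn (he.mono (by exact_mod_cast hS))
  refine Finset.sum_nbij (fun S => S.image e) ?_ ?_ ?_ ?_
  · intro S hS
    rw [Finset.mem_filter, Finset.mem_powerset] at hS ⊢
    exact ⟨Finset.image_subset_image hS.1, by rw [hcard S hS.1]; exact hS.2⟩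
  · refine (Finset.image_injOn_powerset_of_injOn he).mono ?_
    exact_mod_cast Finset.filter_subset _ _
  · intro S hS
    have hS := Finset.mem_filter.1 (Finset.mem_coe.1 hS)
    rw [Finset.mem_powerset, Finset.subset_image_iff] at hS
    obtain ⟨⟨T, hT, rfl⟩, hS⟩ := hS
    refine ⟨T, ?_, rfl⟩
    have hT' : T ⊆ W' := by exact_mod_cast hT
    simp only [Finset.coe_filter, Finset.mem_powerset, Set.mem_ofPred_eq]
    exact ⟨hT', by rwa [← hcard T hT']⟩
  · intro S hS
    exact hwt S (Finset.mem_powerset.1 (Finset.mem_filter.1 hS).1)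

/-- The answer for an induced subgraph with renamed vertices. -/
theorem packing_iff_of_image {t : ℕ} {Γ : SimpleGraph ℕ} {I : PackInstance} {W : Finset ℕ}
    {e : ℕ → ℕ} (he : Set.InjOn e (Finset.range I.order)) (hW : (Finset.range I.order).image e = W)
    (hadj : ∀ i j : Fin I.order, I.graph.Adj i j ↔ Γ.Adj (e i) (e j)) :
    Packing 𝓗 ind t I ↔ SetPacking 𝓗 ind t Γ W (I.k - smallCount 𝓗 ind t Γ W) := by
  have hwt : ∀ S ⊆ Finset.range I.order,
      weight 𝓗 ind (natGraph I.graph) S = weight 𝓗 ind Γ (S.image e) := by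
    intro S hS
    have hlt : ∀ x : S, x.1 < I.order := fun x => Finset.mem_range.1 (hS x.2)
    rw [weight_eq_of_injective 𝓗 ind Γ (S := S.image e) (φ := fun x : S => e x)]
    · rw [weight]
      congr 1
      ext x y
      exact (natGraph_adj (hlt x) (hlt y)).trans (hadj _ _)
    · intro x y hxy
      exact Subtype.ext (he (hS x.2) (hS y.2) hxy)
    · ext u
      simp
  rw [packing_iff, smallCount_image he hW hwt]
  -- The converse is the same transport along the inverse `f` of the renaming on `W`.
  refine ⟨SetPacking.image he hW.le hwt, ?_⟩
  have hinv : ∀ u ∈ W, ∃ i ∈ Finset.range I.order, e i = u := by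
    intro u hu
    rw [← hW] at hu
    simpa using hu
  choose! f hf hf' using hinv
  refine SetPacking.image (e := f) ?_ ?_ ?_
  · intro u hu v hv huv
    rw [← hf' u hu, ← hf' v hv, huv]
  · intro u hu
    obtain ⟨v, hv, rfl⟩ := Finset.mem_image.1 hu
    exact hf v hv
  · intro S hS
    rw [hwt]
    · rw [Finset.image_image]
      congr 1
      ext u
      constructor
      · intro hu
        exact Finset.mem_image.2 ⟨u, hu, hf' u (hS hu)⟩
      · intro hu
        obtain ⟨v, hv, rfl⟩ := Finset.mem_image.1 hu
        simpa [hf' v (hS hv)] using hv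
    · intro u hu
      obtain ⟨v, hv, rfl⟩ := Finset.mem_image.1 hu
      exact hf v (hS hv)

theorem smallCount_mono {t : ℕ} {Γ : SimpleGraph ℕ} {W W' : Finset ℕ} (h : W ⊆ W') :
    smallCount 𝓗 ind t Γ W ≤ smallCount 𝓗 ind t Γ W' := by
  refine Finset.sum_le_sum_of_subset fun S hS => ?_
  rw [Finset.mem_filter, Finset.mem_powerset] at hS ⊢
  exact ⟨hS.1.trans h, hS.2⟩

theorem SetPacking.mono {t : ℕ} {Γ : SimpleGraph ℕ} {W W' : Finset ℕ} {m m' : ℕ} (h : W ⊆ W')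
    (hm : m' ≤ m) (hp : SetPacking 𝓗 ind t Γ W m) : SetPacking 𝓗 ind t Γ W' m' := by
  obtain ⟨𝒬, h1, h2, h3⟩ := hp
  exact ⟨𝒬, hm.trans h1, fun S hS => ⟨(h2 S hS).1.trans h, (h2 S hS).2⟩, h3⟩

end OverlapPacking

namespace OverlapPacking

/-! ### The combinatorics of the kernel -/

/-- Different members share at most `t` elements. -/
def SmallOverlap (t : ℕ) (𝒬 : Finset (Finset ℕ)) : Prop :=
  ∀ S ∈ 𝒬, ∀ T ∈ 𝒬, S ≠ T → (S ∩ T).card ≤ t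

/-- The bound for the number of sets in the greedily chosen family. -/
def familyBound (t r k : ℕ) : ℕ := r ^ (r - 1) * k ^ (r - t - 1)

/-- `M` is a family of `IsE`-sets in which no set of more than `t` and less than `r` elements is
contained in too many members, and it cannot be extended in an obvious way. -/
structure IsGreedy (IsE : Finset ℕ → Prop) (t r k : ℕ) (M : Finset (Finset ℕ)) : Prop where
  mem : ∀ S ∈ M, IsE S
  cap : ∀ P : Finset ℕ, t < P.card → P.card < r →
    (M.filter (P ⊆ ·)).card ≤ (r * k) ^ (r - 1 - P.card)
  reject : ∀ S, IsE S → S ∉ M → familyBound t r k ≤ M.card ∨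
    ∃ P ⊆ S, t < P.card ∧ P.card < r ∧ (r * k) ^ (r - 1 - P.card) ≤ (M.filter (P ⊆ ·)).card

/-- `P ↦ m P` matches the sets in `A` with elements outside `⋃ M`, which are not needed by any
other `(r - 1)`-subset of a member of `M`; and `W` contains all elements that matter. -/
structure IsCrown (IsE : Finset ℕ → Prop) (r : ℕ) (M : Finset (Finset ℕ)) (W : Finset ℕ)
    (A : Set (Finset ℕ)) (m : Finset ℕ → ℕ) : Prop where
  subset : M.sup id ⊆ W
  matched : ∀ P ∈ A, m P ∈ W ∧ m P ∉ M.sup id ∧ IsE (insert (m P) P)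
  injOn : Set.InjOn m A
  unmatched : ∀ P u, P.card + 1 = r → (∃ T ∈ M, P ⊆ T) → P ∉ A → u ∉ M.sup id →
    IsE (insert u P) → u ∈ W ∧ ∀ P' ∈ A, m P' ≠ u

variable {IsE : Finset ℕ → Prop} {t r k : ℕ} {M : Finset (Finset ℕ)}

/-- A member S' ⊇ P of `M` can conflict with another set Q of the packing only if it contains some u
∈ Q \ P; otherwise S' ∩ Q ⊆ S ∩ Q. There are at most (k-1)r such pairs (Q, u), and for each the cap
for `insert u P` allows at most (rk)^(r-2-|P|) members. The product is less than (rk)^(r-1-|P|), the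
number of members above P. The condition |P| + 2 ≤ r makes the cap for `insert u P` available. -/
theorem IsGreedy.exists_replacement (hE : ∀ S, IsE S → t < S.card ∧ S.card ≤ r)
    (hM : IsGreedy IsE t r k M) (hk : 0 < k) {𝒬 : Finset (Finset ℕ)} (h𝒬 : ∀ S ∈ 𝒬, IsE S)
    (hcard : 𝒬.card = k) (ht : SmallOverlap t 𝒬) {S P : Finset ℕ} (hS : S ∈ 𝒬) (hPS : P ⊆ S)
    (hP : t < P.card) (hPr : P.card + 2 ≤ r)
    (hlarge : (r * k) ^ (r - 1 - P.card) ≤ (M.filter (P ⊆ ·)).card) :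
    ∃ S' ∈ M, ∀ Q ∈ 𝒬.erase S, (S' ∩ Q).card ≤ t := by
  classical
  by_contra! hcon
  have hsub : M.filter (P ⊆ ·) ⊆ (𝒬.erase S).biUnion fun Q =>
      (Q \ P).biUnion fun u => M.filter (insert u P ⊆ ·) := by
    intro S' hS'
    obtain ⟨hS'M, hPS'⟩ := Finset.mem_filter.1 hS'
    obtain ⟨Q, hQ, hQt⟩ := hcon S' hS'M
    have hQ' := Finset.mem_erase.1 hQ
    have : ¬ S' ∩ Q ⊆ P := by
      intro h
      have h1 : S' ∩ Q ⊆ S ∩ Q := fun x hx =>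
        Finset.mem_inter.2 ⟨hPS (h hx), (Finset.mem_inter.1 hx).2⟩
      have h2 := ht S hS Q hQ'.2 hQ'.1.symm
      have := Finset.card_le_card h1
      omega
    obtain ⟨u, hu, huP⟩ := Finset.not_subset.1 this
    obtain ⟨hu1, hu2⟩ := Finset.mem_inter.1 hu
    simp only [Finset.mem_biUnion, Finset.mem_sdiff, Finset.mem_filter]
    exact ⟨Q, hQ, u, ⟨hu2, huP⟩, hS'M, Finset.insert_subset hu1 hPS'⟩
  have hle : (M.filter (P ⊆ ·)).card ≤ (k - 1) * (r * (r * k) ^ (r - 1 - (P.card + 1))) := by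
    refine (Finset.card_le_card hsub).trans ?_
    refine (Finset.card_biUnion_le_card_mul _ _ (r * (r * k) ^ (r - 1 - (P.card + 1))) ?_).trans ?_
    · intro Q hQ
      refine (Finset.card_biUnion_le_card_mul _ _ ((r * k) ^ (r - 1 - (P.card + 1))) ?_).trans ?_
      · intro u hu
        have hc : (insert u P).card = P.card + 1 :=
          Finset.card_insert_of_notMem (Finset.mem_sdiff.1 hu).2
        have := hM.cap (insert u P) (by omega) (by omega)
        rwa [hc] at this
      · refine Nat.mul_le_mul_right _ ((Finset.card_le_card Finset.sdiff_subset).trans ?_)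
        exact (hE Q (h𝒬 Q (Finset.mem_of_mem_erase hQ))).2
    · rw [Finset.card_erase_of_mem hS, hcard]
  have hpow : (r * k) ^ (r - 1 - P.card) = (r * k) ^ (r - 1 - (P.card + 1)) * (r * k) := by
    rw [← pow_succ]
    congr 1
    omega
  have hpos : 0 < r * (r * k) ^ (r - 1 - (P.card + 1)) := by
    have : 0 < r := by omega
    positivity
  have hlt : (k - 1) * (r * (r * k) ^ (r - 1 - (P.card + 1))) <
      k * (r * (r * k) ^ (r - 1 - (P.card + 1))) :=
    Nat.mul_lt_mul_of_pos_right (by omega) hpos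
  have : k * (r * (r * k) ^ (r - 1 - (P.card + 1))) =
      (r * k) ^ (r - 1 - (P.card + 1)) * (r * k) := by ring
  omega

theorem SmallOverlap.subset {𝒬 𝒬' : Finset (Finset ℕ)} (h : SmallOverlap t 𝒬) (h' : 𝒬' ⊆ 𝒬) :
    SmallOverlap t 𝒬' :=
  fun S hS T hT => h S (h' hS) T (h' hT)

/-- A packing can be changed so that every set is a member of `M` or shares `r - 1` elements with
one. -/
theorem IsGreedy.exists_good_packing (hE : ∀ S, IsE S → t < S.card ∧ S.card ≤ r)
    (hM : IsGreedy IsE t r k M) (hk : 0 < k) (hlt : M.card < familyBound t r k)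
    {𝒬 : Finset (Finset ℕ)} (h𝒬 : ∀ S ∈ 𝒬, IsE S) (hcard : 𝒬.card = k) (ht : SmallOverlap t 𝒬) :
    ∃ 𝒬' : Finset (Finset ℕ), 𝒬'.card = k ∧ SmallOverlap t 𝒬' ∧ ∀ S ∈ 𝒬', IsE S ∧
      (S ∈ M ∨ ∃ P ⊆ S, P.card + 1 = r ∧ ∃ T ∈ M, P ⊆ T) := by
  classical
  -- Each replacement puts in a member of `M`, so the number of sets that are not yet of the desired
  -- form drops.
  induction hb : (𝒬.filter fun S => ¬ (S ∈ M ∨ ∃ P ⊆ S, P.card + 1 = r ∧ ∃ T ∈ M, P ⊆ T)).card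
    using Nat.strong_induction_on generalizing 𝒬 with
  | _ b ih =>
  by_cases hgood : ∀ S ∈ 𝒬, S ∈ M ∨ ∃ P ⊆ S, P.card + 1 = r ∧ ∃ T ∈ M, P ⊆ T
  · exact ⟨𝒬, hcard, ht, fun S hS => ⟨h𝒬 S hS, hgood S hS⟩⟩
  obtain ⟨S, hSQ, hS⟩ : ∃ S ∈ 𝒬, ¬ (S ∈ M ∨ ∃ P ⊆ S, P.card + 1 = r ∧ ∃ T ∈ M, P ⊆ T) := by
    simpa only [not_forall, exists_prop] using hgood
  rw [not_or] at hS
  rcases hM.reject S (h𝒬 S hSQ) hS.1 with h | ⟨P, hPS, hP, hPr, hlarge⟩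
  · omega
  -- For |P| = r-1 the threshold is (rk)^0 = 1, so saturation gives a member of `M` containing P,
  -- and S would already have the desired form.
  have hPr' : P.card + 2 ≤ r := by
    by_contra hcon
    have h1 : P.card + 1 = r := by omega
    refine hS.2 ⟨P, hPS, h1, ?_⟩
    have h2 : r - 1 - P.card = 0 := by omega
    rw [h2, pow_zero] at hlarge
    obtain ⟨T, hT⟩ := Finset.card_pos.1 hlarge
    exact ⟨T, (Finset.mem_filter.1 hT).1, (Finset.mem_filter.1 hT).2⟩
  obtain ⟨S', hS'M, hS'⟩ := hM.exists_replacement hE hk h𝒬 hcard ht hSQ hPS hP hPr' hlarge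
  -- Without this the exchange could lose a set: S' has more than `t` elements, so it differs from
  -- every set that it meets in at most `t` elements.
  have hnot : S' ∉ 𝒬.erase S := by
    intro h
    have h1 := hS' S' h
    rw [Finset.inter_self] at h1
    exact absurd (hE S' (hM.mem S' hS'M)).1 (not_lt.2 h1)
  refine ih _ ?_ (𝒬 := insert S' (𝒬.erase S)) ?_ ?_ ?_ rfl
  · rw [← hb]
    refine Finset.card_lt_card ((Finset.ssubset_iff_of_subset ?_).2 ⟨S, ?_, ?_⟩)
    · intro T hT
      obtain ⟨h1, h2⟩ := Finset.mem_filter.1 hT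
      rcases Finset.mem_insert.1 h1 with rfl | h1
      · exact absurd (Or.inl hS'M) h2
      · exact Finset.mem_filter.2 ⟨Finset.mem_of_mem_erase h1, h2⟩
    · exact Finset.mem_filter.2 ⟨hSQ, by rwa [not_or]⟩
    · intro h
      rcases Finset.mem_insert.1 (Finset.mem_filter.1 h).1 with h1 | h1
      · exact hS.1 (h1 ▸ hS'M)
      · exact Finset.notMem_erase S 𝒬 h1
  · intro T hT
    rcases Finset.mem_insert.1 hT with rfl | hT
    · exact hM.mem _ hS'M
    · exact h𝒬 T (Finset.mem_of_mem_erase hT)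
  · rw [Finset.card_insert_of_notMem hnot, Finset.card_erase_of_mem hSQ]
    omega
  · intro T hT U hU hTU
    rcases Finset.mem_insert.1 hT with rfl | hT'
    · rcases Finset.mem_insert.1 hU with rfl | hU'
      · exact absurd rfl hTU
      · exact hS' U hU'
    · rcases Finset.mem_insert.1 hU with rfl | hU'
      · rw [Finset.inter_comm]
        exact hS' T hT'
      · exact ht T (Finset.mem_of_mem_erase hT') U (Finset.mem_of_mem_erase hU') hTU

/-- If `M` is as large as allowed, it contains a packing. -/
theorem IsGreedy.exists_packing_of_large (hE : ∀ S, IsE S → t < S.card ∧ S.card ≤ r)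
    (htr : t + 2 ≤ r) (hM : IsGreedy IsE t r k M) (hk : 0 < k)
    (hlarge : familyBound t r k ≤ M.card) :
    ∃ 𝒬 ⊆ M, k ≤ 𝒬.card ∧ SmallOverlap t 𝒬 := by
  classical
  -- By maximality, each member of `M` shares a (t+1)-set P with a member of 𝒩 (with itself, if it
  -- belongs to 𝒩).
  obtain ⟨𝒩, h𝒩, hmax⟩ := Finset.exists_max_image
    (M.powerset.filter fun 𝒬 => SmallOverlap t 𝒬) Finset.card
    ⟨∅, Finset.mem_filter.2 ⟨Finset.empty_mem_powerset _, by simp [SmallOverlap]⟩⟩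
  rw [Finset.mem_filter, Finset.mem_powerset] at h𝒩
  refine ⟨𝒩, h𝒩.1, ?_, h𝒩.2⟩
  by_contra! hlt
  have hsub : M ⊆ 𝒩.biUnion fun Q => (Q.powersetCard (t + 1)).biUnion fun P =>
      M.filter (P ⊆ ·) := by
    intro S hS
    have hex : ∃ Q ∈ 𝒩, t + 1 ≤ (S ∩ Q).card := by
      by_cases hSN : S ∈ 𝒩
      · exact ⟨S, hSN, by rw [Finset.inter_self]; exact (hE S (hM.mem S hS)).1⟩
      by_contra! hcon
      have hins : insert S 𝒩 ∈ M.powerset.filter fun 𝒬 => SmallOverlap t 𝒬 := by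
        rw [Finset.mem_filter, Finset.mem_powerset]
        refine ⟨Finset.insert_subset hS h𝒩.1, ?_⟩
        intro T hT U hU hTU
        rcases Finset.mem_insert.1 hT with rfl | hT'
        · rcases Finset.mem_insert.1 hU with rfl | hU'
          · exact absurd rfl hTU
          · exact Nat.lt_succ_iff.1 (hcon U hU')
        · rcases Finset.mem_insert.1 hU with rfl | hU'
          · rw [Finset.inter_comm]
            exact Nat.lt_succ_iff.1 (hcon T hT')
          · exact h𝒩.2 T hT' U hU' hTU
      have := hmax _ hins
      rw [Finset.card_insert_of_notMem hSN] at this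
      omega
    obtain ⟨Q, hQ, hSQ⟩ := hex
    obtain ⟨P, hP, hPc⟩ := Finset.exists_subset_card_eq hSQ
    simp only [Finset.mem_biUnion, Finset.mem_powersetCard, Finset.mem_filter]
    exact ⟨Q, hQ, P, ⟨hP.trans Finset.inter_subset_right, hPc⟩, hS,
      hP.trans Finset.inter_subset_left⟩
  -- At most k-1 choices of Q, at most r^(t+1) of its (t+1)-subsets P, and the cap for P, which
  -- applies because t+1 < r. With k in place of k-1 the product is exactly `familyBound t r k`.
  have hle : M.card ≤ (k - 1) * (r ^ (t + 1) * (r * k) ^ (r - 1 - (t + 1))) := by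
    refine (Finset.card_le_card hsub).trans ?_
    refine (Finset.card_biUnion_le_card_mul _ _
      (r ^ (t + 1) * (r * k) ^ (r - 1 - (t + 1))) ?_).trans ?_
    · intro Q hQ
      refine (Finset.card_biUnion_le_card_mul _ _ ((r * k) ^ (r - 1 - (t + 1))) ?_).trans ?_
      · intro P hP
        have hc := (Finset.mem_powersetCard.1 hP).2
        have := hM.cap P (by omega) (by omega)
        rwa [hc] at this
      · refine Nat.mul_le_mul_right _ ?_
        rw [Finset.card_powersetCard]
        exact (Nat.choose_le_pow _ _).trans
          (Nat.pow_le_pow_left (hE Q (hM.mem Q (h𝒩.1 hQ))).2 _)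
    · exact Nat.mul_le_mul_right _ (by omega)
  have hpos : 0 < r ^ (t + 1) * (r * k) ^ (r - 1 - (t + 1)) := by
    have : 0 < r := by omega
    positivity
  have hlt' : (k - 1) * (r ^ (t + 1) * (r * k) ^ (r - 1 - (t + 1))) <
      k * (r ^ (t + 1) * (r * k) ^ (r - 1 - (t + 1))) :=
    Nat.mul_lt_mul_of_pos_right (by omega) hpos
  have heq : k * (r ^ (t + 1) * (r * k) ^ (r - 1 - (t + 1))) = familyBound t r k := by
    obtain ⟨s, rfl⟩ : ∃ s, r = t + 2 + s := ⟨r - (t + 2), by omega⟩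
    have e1 : t + 2 + s - 1 - (t + 1) = s := by omega
    have e2 : t + 2 + s - 1 = t + 1 + s := by omega
    have e3 : t + 2 + s - t - 1 = s + 1 := by omega
    rw [familyBound, e1, e2, e3, mul_pow]
    ring
  omega

/-- Sets that stick out of `⋃ M` can be moved into `W`. -/
theorem IsCrown.exists_packing (hE : ∀ S, IsE S → t < S.card ∧ S.card ≤ r) (htr : t + 2 ≤ r)
    {W : Finset ℕ} {A : Set (Finset ℕ)} {m : Finset ℕ → ℕ} (hc : IsCrown IsE r M W A m)
    {𝒬 : Finset (Finset ℕ)} (ht : SmallOverlap t 𝒬)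
    (hgood : ∀ S ∈ 𝒬, IsE S ∧ (S ∈ M ∨ ∃ P ⊆ S, P.card + 1 = r ∧ ∃ T ∈ M, P ⊆ T)) :
    ∃ 𝒬' : Finset (Finset ℕ), 𝒬'.card = 𝒬.card ∧ SmallOverlap t 𝒬' ∧
      ∀ S ∈ 𝒬', IsE S ∧ S ⊆ W := by
  classical
  set V := M.sup id with hV
  have hMV : ∀ T ∈ M, T ⊆ V := fun T hT => Finset.le_sup (f := id) hT
  -- A set leaving `V` is not in `M`, so it has an (r-1)-subset inside `V`. With at most r elements
  -- in all, there is room for just one outside vertex, and that subset is the whole trace S ∩ V.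
  have hout : ∀ S ∈ 𝒬, ¬ S ⊆ V → (S ∩ V).card + 1 = r ∧ (∃ T ∈ M, S ∩ V ⊆ T) ∧
      ∃ u, u ∉ V ∧ S = insert u (S ∩ V) := by
    intro S hS hSV
    obtain ⟨hES, hS'⟩ := hgood S hS
    rcases hS' with h | ⟨P, hPS, hPr, T, hT, hPT⟩
    · exact absurd (hMV S h) hSV
    obtain ⟨u, huS, huV⟩ := Finset.not_subset.1 hSV
    have hPV : P ⊆ S ∩ V := Finset.subset_inter hPS (hPT.trans (hMV T hT))
    have h1 : insert u (S ∩ V) ⊆ S := Finset.insert_subset huS Finset.inter_subset_left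
    have h2 : (insert u (S ∩ V)).card = (S ∩ V).card + 1 :=
      Finset.card_insert_of_notMem fun h => huV (Finset.mem_inter.1 h).2
    have h3 := Finset.card_le_card h1
    have h4 := Finset.card_le_card hPV
    have h5 := (hE S hES).2
    have h6 : P = S ∩ V := Finset.eq_of_subset_of_card_le hPV (by omega)
    refine ⟨by omega, ⟨T, hT, h6 ▸ hPT⟩, u, huV, ?_⟩
    exact (Finset.eq_of_subset_of_card_le h1 (by omega)).symm
  -- Only the outside vertex of a set with matched trace is exchanged, so traces on `V` never
  -- change.
  let φ : Finset ℕ → Finset ℕ := fun S =>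
    if ¬ S ⊆ V ∧ S ∩ V ∈ A then insert (m (S ∩ V)) (S ∩ V) else S
  have hφE : ∀ S ∈ 𝒬, IsE (φ S) := by
    intro S hS
    by_cases h : ¬ S ⊆ V ∧ S ∩ V ∈ A
    · simp only [φ, if_pos h]
      exact (hc.matched _ h.2).2.2
    · simp only [φ, if_neg h]
      exact (hgood S hS).1
  have hφW : ∀ S ∈ 𝒬, φ S ⊆ W := by
    intro S hS
    by_cases h : ¬ S ⊆ V ∧ S ∩ V ∈ A
    · simp only [φ, if_pos h]
      exact Finset.insert_subset (hc.matched _ h.2).1 (Finset.inter_subset_right.trans hc.subset)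
    · simp only [φ, if_neg h]
      by_cases hSV : S ⊆ V
      · exact hSV.trans hc.subset
      · obtain ⟨h1, h2, u, huV, hu⟩ := hout S hS hSV
        have hA : S ∩ V ∉ A := fun hA => h ⟨hSV, hA⟩
        have h3 := hc.unmatched (S ∩ V) u h1 h2 hA huV (hu ▸ (hgood S hS).1)
        rw [hu]
        exact Finset.insert_subset h3.1 (Finset.inter_subset_right.trans hc.subset)
  have hφV : ∀ S, φ S ∩ V = S ∩ V := by
    intro S
    by_cases h : ¬ S ⊆ V ∧ S ∩ V ∈ A
    · simp only [φ, if_pos h]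
      rw [Finset.insert_inter_of_notMem (hc.matched _ h.2).2.1]
      rw [Finset.inter_assoc, Finset.inter_self]
    · simp only [φ, if_neg h]
  -- An unmoved set with an outside vertex has an unmatched trace, and the crown reserves no
  -- neighbour of an unmatched trace as some `m P'`.
  have hmixed : ∀ S ∈ 𝒬, ∀ T ∈ 𝒬, (¬ S ⊆ V ∧ S ∩ V ∈ A) → ¬ (¬ T ⊆ V ∧ T ∩ V ∈ A) →
      m (S ∩ V) ∉ T := by
    intro S hS T hT h1 h2 hmT
    have hmV := (hc.matched _ h1.2).2.1
    have hTV : ¬ T ⊆ V := fun h => hmV (h hmT)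
    obtain ⟨h3, h4, u, huV, hu⟩ := hout T hT hTV
    have h5 := hc.unmatched (T ∩ V) u h3 h4 (fun hA => h2 ⟨hTV, hA⟩) huV (hu ▸ (hgood T hT).1)
    refine h5.2 _ h1.2 ?_
    rw [hu] at hmT
    rcases Finset.mem_insert.1 hmT with h | h
    · exact h
    · exact absurd (Finset.mem_inter.1 h).2 hmV
  have hφt : ∀ S ∈ 𝒬, ∀ T ∈ 𝒬, S ≠ T → (φ S ∩ φ T).card ≤ t := by
    intro S hS T hT hST
    have hle := ht S hS T hT hST
    by_cases hsub : φ S ∩ φ T ⊆ V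
    · refine le_trans (Finset.card_le_card fun x hx => ?_) hle
      have hxV := hsub hx
      obtain ⟨h1, h2⟩ := Finset.mem_inter.1 hx
      have h3 : x ∈ S ∩ V := hφV S ▸ Finset.mem_inter.2 ⟨h1, hxV⟩
      have h4 : x ∈ T ∩ V := hφV T ▸ Finset.mem_inter.2 ⟨h2, hxV⟩
      exact Finset.mem_inter.2 ⟨(Finset.mem_inter.1 h3).1, (Finset.mem_inter.1 h4).1⟩
    -- A common vertex outside `V` is harmless if both sets are unmoved, and impossible by `hmixed`
    -- if one is moved. If both are moved, injectivity of `m` makes their traces equal, so the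
    -- original sets would share r-1 > t elements.
    obtain ⟨u, hu, huV⟩ := Finset.not_subset.1 hsub
    obtain ⟨hu1, hu2⟩ := Finset.mem_inter.1 hu
    have hins : ∀ X, u ∈ insert (m (X ∩ V)) (X ∩ V) → u = m (X ∩ V) := by
      intro X hX
      rcases Finset.mem_insert.1 hX with h | h
      · exact h
      · exact absurd (Finset.mem_inter.1 h).2 huV
    by_cases hS' : ¬ S ⊆ V ∧ S ∩ V ∈ A
    · have e1 : φ S = insert (m (S ∩ V)) (S ∩ V) := if_pos hS'
      rw [e1] at hu1
      by_cases hT' : ¬ T ⊆ V ∧ T ∩ V ∈ A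
      · have e2 : φ T = insert (m (T ∩ V)) (T ∩ V) := if_pos hT'
        rw [e2] at hu2
        have h := hc.injOn hS'.2 hT'.2 ((hins S hu1).symm.trans (hins T hu2))
        have h1 := (hout S hS hS'.1).1
        have h2 : S ∩ V ⊆ S ∩ T :=
          Finset.subset_inter Finset.inter_subset_left (h ▸ Finset.inter_subset_left)
        have := Finset.card_le_card h2
        omega
      · have e2 : φ T = T := if_neg hT'
        rw [e2] at hu2
        exact absurd (hins S hu1 ▸ hu2) (hmixed S hS T hT hS' hT')
    · have e1 : φ S = S := if_neg hS'
      rw [e1] at hu1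
      by_cases hT' : ¬ T ⊆ V ∧ T ∩ V ∈ A
      · have e2 : φ T = insert (m (T ∩ V)) (T ∩ V) := if_pos hT'
        rw [e2] at hu2
        exact absurd (hins T hu2 ▸ hu1) (hmixed T hT S hS hT' hS')
      · have e2 : φ T = T := if_neg hT'
        rw [e1, e2]
        exact hle
  have hinj : Set.InjOn φ 𝒬 := by
    intro S hS T hT h
    by_contra hST
    have h1 := hφt S hS T hT hST
    rw [← h, Finset.inter_self] at h1
    exact absurd (hE _ (hφE S hS)).1 (not_lt.2 h1)
  refine ⟨𝒬.image φ, Finset.card_image_of_injOn hinj, ?_, ?_⟩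
  · intro S hS T hT hST
    obtain ⟨S, hS', rfl⟩ := Finset.mem_image.1 hS
    obtain ⟨T, hT', rfl⟩ := Finset.mem_image.1 hT
    exact hφt S hS' T hT' fun h => hST (h ▸ rfl)
  · intro S hS
    obtain ⟨S, hS', rfl⟩ := Finset.mem_image.1 hS
    exact ⟨hφE S hS', hφW S hS'⟩

/-- If `M` is full, the packing is found inside `M`. If not, the given packing is cut down to
exactly k sets, which the replacement count requires; it is then normalised with respect to `M` and
moved along the crown. -/
theorem exists_packing_in_kernel (hE : ∀ S, IsE S → t < S.card ∧ S.card ≤ r) (htr : t + 2 ≤ r)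
    (hk : 0 < k) (hM : IsGreedy IsE t r k M) {W : Finset ℕ} {A : Set (Finset ℕ)}
    {m : Finset ℕ → ℕ} (hc : IsCrown IsE r M W A m) {𝒬 : Finset (Finset ℕ)} (hcard : k ≤ 𝒬.card)
    (h𝒬 : ∀ S ∈ 𝒬, IsE S) (ht : SmallOverlap t 𝒬) :
    ∃ 𝒬' : Finset (Finset ℕ), k ≤ 𝒬'.card ∧ (∀ S ∈ 𝒬', IsE S ∧ S ⊆ W) ∧ SmallOverlap t 𝒬' := by
  by_cases hlarge : familyBound t r k ≤ M.card
  · obtain ⟨𝒬', h1, h2, h3⟩ := hM.exists_packing_of_large hE htr hk hlarge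
    exact ⟨𝒬', h2, fun S hS => ⟨hM.mem S (h1 hS),
      (Finset.le_sup (f := id) (h1 hS)).trans hc.subset⟩, h3⟩
  · obtain ⟨𝒬₀, h1, h2⟩ := Finset.exists_subset_card_eq hcard
    obtain ⟨𝒬₁, h3, h4, h5⟩ := hM.exists_good_packing hE hk (not_le.1 hlarge)
      (fun S hS => h𝒬 S (h1 hS)) h2 (ht.subset h1)
    obtain ⟨𝒬₂, h6, h7, h8⟩ := hc.exists_packing hE htr h4 h5
    exact ⟨𝒬₂, by omega, h8, h7⟩

end OverlapPacking

namespace OverlapPacking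

/-! ### An auction for matchings -/

/-- Labels and owners of the objects; the owner `p` is stored as `p + 1`, and `0` means that there
is no owner. -/
structure Auction where
  label : ℕ → ℕ
  owner : ℕ → ℕ

namespace Auction

/-- The bidder `p` owns nothing. -/
def Free (s : Auction) (p : ℕ) : Prop := ∀ u, s.owner u ≠ p + 1

/-- `u` is an object with smallest label among those which `p` wants. -/
def IsCheapest (adj : ℕ → ℕ → Prop) (s : Auction) (p u : ℕ) : Prop :=
  adj p u ∧ ∀ v, adj p v → s.label u ≤ s.label v

/-- `p` may bid for `u`. -/
def CanBid (adj : ℕ → ℕ → Prop) (L : ℕ) (s : Auction) (p u : ℕ) : Prop :=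
  s.Free p ∧ IsCheapest adj s p u ∧ s.label u < L

/-- `p` gets `u`, and the label of `u` goes up. -/
def bid (s : Auction) (p u : ℕ) : Auction :=
  ⟨Function.update s.label u (s.label u + 1), Function.update s.owner u (p + 1)⟩

/-- The properties which all bids preserve. -/
structure Invariant (adj : ℕ → ℕ → Prop) (L : ℕ) (s : Auction) : Prop where
  label_eq_zero : ∀ u, s.label u = 0 ↔ s.owner u = 0
  adj_of_owner : ∀ u p, s.owner u = p + 1 → adj p u
  owner_inj : ∀ u v p, s.owner u = p + 1 → s.owner v = p + 1 → u = v
  label_le : ∀ u p, s.owner u = p + 1 → ∀ v, adj p v → s.label u ≤ s.label v + 1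
  label_le_bound : ∀ u, s.label u ≤ L

variable {adj : ℕ → ℕ → Prop} {L : ℕ} {s : Auction}

theorem Invariant.init : Invariant adj L ⟨fun _ => 0, fun _ => 0⟩ :=
  ⟨by simp, by simp, by simp, by simp, by simp⟩

/-- The inequality `label_le` holds for the new owner because `u` was cheapest, and stays true for
the others because labels never decrease. That `p` owned nothing before is what keeps `owner_inj`.
-/
theorem Invariant.bid (h : Invariant adj L s) {p u : ℕ} (hb : CanBid adj L s p u) :
    Invariant adj L (s.bid p u) := by
  obtain ⟨hfree, ⟨hadj, hmin⟩, hL⟩ := hb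
  have hlabel : ∀ v, s.label v ≤ (s.bid p u).label v := by
    intro v
    by_cases hv : v = u
    · subst hv
      simp [Auction.bid]
    · simp [Auction.bid, hv]
  refine ⟨fun v => ?_, fun v q => ?_, fun v w q => ?_, fun v q => ?_, fun v => ?_⟩
  · by_cases hv : v = u
    · subst hv
      simp [Auction.bid]
    · simp [Auction.bid, hv, h.label_eq_zero]
  · by_cases hv : v = u
    · subst hv
      intro hq
      have : p = q := by simpa [Auction.bid] using hq
      exact this ▸ hadj
    · simpa [Auction.bid, hv] using h.adj_of_owner v q
  · by_cases hv : v = u <;> by_cases hw : w = u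
    · intros
      rw [hv, hw]
    · subst hv
      intro h1 h2
      have h1 : p = q := by simpa [Auction.bid] using h1
      have h2 : s.owner w = q + 1 := by simpa [Auction.bid, hw] using h2
      exact absurd (h1 ▸ h2) (hfree w)
    · subst hw
      intro h2 h1
      have h1 : p = q := by simpa [Auction.bid] using h1
      have h2 : s.owner v = q + 1 := by simpa [Auction.bid, hv] using h2
      exact absurd (h1 ▸ h2) (hfree v)
    · simpa [Auction.bid, hv, hw] using h.owner_inj v w q
  · by_cases hv : v = u
    · subst hv
      intro hq w hw
      have hq : p = q := by simpa [Auction.bid] using hq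
      subst hq
      have h1 := hmin w hw
      have h2 := hlabel w
      have h3 : (s.bid p v).label v = s.label v + 1 := by simp [Auction.bid]
      omega
    · intro hq w hw
      have hq : s.owner v = q + 1 := by simpa [Auction.bid, hv] using hq
      have h1 := h.label_le v q hq w hw
      have h2 := hlabel w
      have h3 : (s.bid p u).label v = s.label v := by simp [Auction.bid, hv]
      omega
  · by_cases hv : v = u
    · subst hv
      simpa [Auction.bid] using hL
    · simpa [Auction.bid, hv] using h.label_le_bound v

/-- After sufficiently many steps nobody can bid any more. -/
theorem final (n K : ℕ) (hadj : ∀ p u, adj p u → u < n) (hK : n * L < K) (s : ℕ → Auction)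
    (h0 : s 0 = ⟨fun _ => 0, fun _ => 0⟩)
    (hstep : ∀ i < K, (∃ p u, CanBid adj L (s i) p u ∧ s (i + 1) = (s i).bid p u) ∨
      ((∀ p u, ¬ CanBid adj L (s i) p u) ∧ s (i + 1) = s i)) :
    Invariant adj L (s K) ∧ ∀ p u, ¬ CanBid adj L (s K) p u := by
  have hinv : ∀ i ≤ K, Invariant adj L (s i) := by
    intro i
    induction i with
    | zero => intro _; rw [h0]; exact Invariant.init
    | succ i ih =>
      intro hi
      rcases hstep i (by omega) with ⟨p, u, hb, he⟩ | ⟨_, he⟩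
      · rw [he]
        exact (ih (by omega)).bid hb
      · rw [he]
        exact ih (by omega)
  -- As long as a bid is possible, every step raises the sum of the labels, which can never exceed
  -- `n * L`.
  have hprog : ∀ i ≤ K, (∀ p u, ¬ CanBid adj L (s i) p u) ∨
      i ≤ ∑ u ∈ Finset.range n, (s i).label u := by
    intro i
    induction i with
    | zero => intro _; exact Or.inr (Nat.zero_le _)
    | succ i ih =>
      intro hi
      rcases hstep i (by omega) with ⟨p, u, hb, he⟩ | ⟨hno, he⟩
      · right
        have hle := (ih (by omega)).resolve_left fun h => h p u hb
        rw [he]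
        have hu := hadj p u hb.2.1.1
        refine Nat.succ_le_of_lt (hle.trans_lt (Finset.sum_lt_sum (fun v _ => ?_)
          ⟨u, Finset.mem_range.2 hu, ?_⟩))
        · by_cases hv : v = u
          · subst hv
            simp [Auction.bid]
          · simp [Auction.bid, hv]
        · simp [Auction.bid]
      · left
        rwa [he]
  refine ⟨hinv K le_rfl, (hprog K le_rfl).resolve_right fun h => ?_⟩
  have h1 : ∑ u ∈ Finset.range n, (s K).label u ≤ ∑ u ∈ Finset.range n, L :=
    Finset.sum_le_sum fun u _ => (hinv K le_rfl).label_le_bound u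
  rw [Finset.sum_const, Finset.card_range, smul_eq_mul] at h1
  omega

/-- The objects that have been sold. -/
def sold (s : Auction) (n : ℕ) : Finset ℕ := (Finset.range n).filter fun u => s.label u ≠ 0

/-- Each sold object has an owner, and different objects have different owners, all of them bidders.
-/
theorem Invariant.card_sold_le (h : Invariant adj L s) (n : ℕ) {B : Finset ℕ}
    (hB : ∀ p u, adj p u → p ∈ B) : (s.sold n).card ≤ B.card := by
  have hown : ∀ u ∈ s.sold n, s.owner u = (s.owner u - 1) + 1 := by
    intro u hu
    have : s.owner u ≠ 0 := fun h0 => (Finset.mem_filter.1 hu).2 ((h.label_eq_zero u).2 h0)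
    omega
  refine Finset.card_le_card_of_injOn (fun u => s.owner u - 1) ?_ ?_
  · intro u hu
    exact hB _ u (h.adj_of_owner u _ (hown u hu))
  · intro u hu v hv huv
    refine h.owner_inj u v (s.owner u - 1) (hown u hu) ?_
    rw [hown v hv]
    exact congrArg (· + 1) huv.symm

theorem exists_isCheapest {n p u : ℕ} (hadj : ∀ p u, adj p u → u < n) (hpu : adj p u) :
    ∃ v, IsCheapest adj s p v := by
  classical
  obtain ⟨v, hv, hmin⟩ := Finset.exists_min_image ((Finset.range n).filter (adj p ·)) s.label
    ⟨u, Finset.mem_filter.2 ⟨Finset.mem_range.2 (hadj p u hpu), hpu⟩⟩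
  refine ⟨v, (Finset.mem_filter.1 hv).2, fun w hw => ?_⟩
  exact hmin w (Finset.mem_filter.2 ⟨Finset.mem_range.2 (hadj p w hw), hw⟩)

/-- The crown structure at the end of the auction. -/
theorem Invariant.exists_crown (h : Invariant adj L s) (hno : ∀ p u, ¬ CanBid adj L s p u)
    {n : ℕ} (hadj : ∀ p u, adj p u → u < n) {B : Finset ℕ} (hB : ∀ p u, adj p u → p ∈ B)
    (hL : B.card < L) :
    ∃ (A : Set ℕ) (m : ℕ → ℕ), (∀ p ∈ A, adj p (m p) ∧ m p ∈ s.sold n) ∧ Set.InjOn m A ∧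
      ∀ p u, adj p u → p ∉ A → u ∈ s.sold n ∧ ∀ q ∈ A, m q ≠ u := by
  classical
  have hsold : ∀ u, s.label u ≠ 0 → u ∈ s.sold n := by
    intro u hu
    refine Finset.mem_filter.2 ⟨?_, hu⟩
    have : s.owner u ≠ 0 := fun h0 => hu ((h.label_eq_zero u).2 h0)
    exact Finset.mem_range.2 (hadj _ u (h.adj_of_owner u (s.owner u - 1) (by omega)))
  -- Pigeonhole: fewer than `L` objects are sold, so one of the labels 1, …, L does not occur. This
  -- gap separates the two sides of the crown.
  obtain ⟨ℓ, hℓ, hgap⟩ : ∃ ℓ ∈ Finset.Icc 1 L, ℓ ∉ (s.sold n).image s.label := by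
    by_contra! hcon
    have h1 := Finset.card_le_card (show Finset.Icc 1 L ⊆ (s.sold n).image s.label from hcon)
    have h2 : ((s.sold n).image s.label).card ≤ (s.sold n).card := Finset.card_image_le
    have h3 := h.card_sold_le n hB
    rw [Nat.card_Icc] at h1
    omega
  rw [Finset.mem_Icc] at hℓ
  have hgap' : ∀ u, s.label u ≠ ℓ := fun u hu =>
    hgap (Finset.mem_image.2 ⟨u, hsold u (by omega), hu⟩)
  -- The matched bidders are the owners of objects below the gap.
  let A : Set ℕ := {p | ∃ u, s.owner u = p + 1 ∧ s.label u < ℓ}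
  have hA : ∀ p ∈ A, ∃ u, s.owner u = p + 1 ∧ s.label u < ℓ := fun p hp => hp
  choose! m hm1 hm2 using hA
  refine ⟨A, m, fun p hp => ⟨h.adj_of_owner _ p (hm1 p hp), hsold _ fun h0 => ?_⟩, ?_, ?_⟩
  · have := (h.label_eq_zero _).1 h0
    have := hm1 p hp
    omega
  · intro p hp q hq hpq
    have h1 := hm1 p hp
    have h2 := hm1 q hq
    rw [hpq] at h1
    omega
  · intro p u hpu hpA
    -- A free bidder cannot bid, so all labels it wants are at least L ≥ ℓ. A bidder outside `A`
    -- that owns something owns it at a label above ℓ, and the labels it wants are smaller by at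
    -- most one. Either way they are at least ℓ, and ℓ itself does not occur.
    have hu : ℓ < s.label u := by
      refine lt_of_le_of_ne ?_ (hgap' u).symm
      by_cases hfree : s.Free p
      · by_contra! hlt
        obtain ⟨v, hv, hvmin⟩ := exists_isCheapest (s := s) hadj hpu
        exact hno p v ⟨hfree, ⟨hv, hvmin⟩, by have := hvmin u hpu; omega⟩
      · simp only [Free, not_forall, not_not] at hfree
        obtain ⟨v, hv⟩ := hfree
        have h1 : ¬ s.label v < ℓ := fun h1 => hpA ⟨v, hv, h1⟩
        have h2 := hgap' v
        have h3 := h.label_le v p hv u hpu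
        omega
    exact ⟨hsold u (by omega), fun q hq hqu => by have := hm2 q hq; rw [hqu] at this; omega⟩

end Auction

end OverlapPacking

namespace OverlapPacking

open Ctx (glob)

variable {α : Type} [Ctx α]

/-! ### Computable sets of vertices -/

theorem CompP.exOrder {P : α → ℕ → Mem → Prop} (hP : CompP (fun (p : α × ℕ) μ => P p.1 p.2 μ)) :
    CompP (fun a μ => ∃ u < (glob a).n, P a u μ) := by
  refine (ex (P := fun a u μ => u < (glob a).n ∧ P a u μ)
    ((lt Comp.snd Comp.order.fst).and hP)).congr fun a μ => ⟨?_, ?_⟩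
  · rintro ⟨u, _, h1, h2⟩
    exact ⟨u, h1, h2⟩
  · rintro ⟨u, h1, h2⟩
    exact ⟨u, by have := (glob a).order_add_two_le; omega, h1, h2⟩

theorem CompP.allOrder {P : α → ℕ → Mem → Prop} (hP : CompP (fun (p : α × ℕ) μ => P p.1 p.2 μ)) :
    CompP (fun a μ => ∀ u < (glob a).n, P a u μ) :=
  (exOrder (P := fun a u μ => ¬ P a u μ) hP.not).not.congr fun a μ => by simp

/-- `S` is a computable set of vertices. -/
structure CompF (S : α → Mem → Finset ℕ) : Prop where
  subset_range : ∀ a μ, S a μ ⊆ Finset.range (glob a).n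
  mem_snd : CompP (fun (p : α × ℕ) μ => p.2 ∈ S p.1 μ)

namespace CompF

variable {S T : α → Mem → Finset ℕ}

theorem lt_order (hS : CompF S) {a : α} {μ : Mem} {u : ℕ} (h : u ∈ S a μ) : u < (glob a).n :=
  Finset.mem_range.1 (hS.subset_range a μ h)

/-- The field `mem_snd` only treats a variable. A computed value is substituted through a quantifier
over vertices; values that are not below `n` make both sides false. -/
theorem mem (hS : CompF S) {f : α → Mem → ℕ} (hf : Comp f) : CompP (fun a μ => f a μ ∈ S a μ) := by
  refine (CompP.exOrder (P := fun a u μ => u = f a μ ∧ u ∈ S a μ)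
    ((CompP.eq Comp.snd hf.fst).and hS.mem_snd)).congr fun a μ => ⟨?_, ?_⟩
  · rintro ⟨u, _, rfl, h⟩
    exact h
  · exact fun h => ⟨_, hS.lt_order h, rfl, h⟩

theorem fst (hS : CompF S) : CompF (fun (p : α × ℕ) μ => S p.1 μ) :=
  ⟨fun p μ => hS.subset_range p.1 μ, hS.mem_snd.middle⟩

theorem subset (hS : CompF S) (hT : CompF T) : CompP (fun a μ => S a μ ⊆ T a μ) := by
  refine (CompP.allOrder (P := fun a u μ => u ∈ S a μ → u ∈ T a μ)
    (hS.mem_snd.imp hT.mem_snd)).congr fun a μ => ⟨?_, ?_⟩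
  · exact fun h u hu => h u (hS.lt_order hu) hu
  · exact fun h u _ hu => h hu

theorem eq (hS : CompF S) (hT : CompF T) : CompP (fun a μ => S a μ = T a μ) :=
  ((hS.subset hT).and (hT.subset hS)).congr fun _ _ => Finset.Subset.antisymm_iff.symm

theorem card (hS : CompF S) : Comp (fun a μ => (S a μ).card) := by
  classical
  refine (Comp.count (dec := fun _ _ _ => inferInstance)
    (P := fun a u μ => u ∈ S a μ) hS.mem_snd).congr fun a μ => ?_
  congr 1
  ext u
  rw [Finset.mem_filter, Finset.mem_range, and_iff_right_iff_imp]
  intro hu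
  have := hS.lt_order hu
  have := (glob a).order_add_two_le
  omega

theorem filter {P : α → ℕ → Mem → Prop} {_ : ∀ a μ u, Decidable (P a u μ)}
    (hP : CompP (fun (p : α × ℕ) μ => P p.1 p.2 μ)) :
    CompF (fun a μ => (Finset.range (glob a).n).filter fun u => P a u μ) :=
  ⟨fun _ _ => Finset.filter_subset _ _,
    ((CompP.lt Comp.snd Comp.order.fst).and hP).congr fun a μ => by
      rw [Finset.mem_filter, Finset.mem_range]⟩

theorem range : CompF (fun (a : α) _ => Finset.range (glob a).n) :=
  ⟨fun _ _ => Finset.Subset.refl _, (CompP.lt Comp.snd Comp.order.fst).congr fun a μ => by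
    rw [Finset.mem_range]⟩

theorem ite {P : α → Mem → Prop} {_ : ∀ a μ, Decidable (P a μ)} (hP : CompP P)
    (hS : CompF S) (hT : CompF T) :
    CompF (fun a μ => if P a μ then S a μ else T a μ) := by
  refine ⟨fun a μ => ?_, ((hP.fst.and hS.mem_snd).or (hP.fst.not.and hT.mem_snd)).congr
    fun a μ => ?_⟩
  · split_ifs
    · exact hS.subset_range a μ
    · exact hT.subset_range a μ
  · split_ifs with h <;> simp [h]

end CompF

/-! ### Arithmetic -/

namespace Comp

variable {f g : α → Mem → ℕ}

theorem mul_of_le (hf : Comp f) (hg : Comp g) (h : ∀ a μ, f a μ ≤ (glob a).N) :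
    Comp (fun a μ => f a μ * g a μ) :=
  (mul hf hg).congr fun a μ => by rw [min_eq_left (h a μ)]

theorem pow_of_le (hf : Comp f) (h : ∀ a μ, f a μ ≤ (glob a).N) (e : ℕ) :
    Comp (fun a μ => f a μ ^ e) := by
  induction e with
  | zero => exact (const 1).congr fun a μ => by simp
  | succ e ih => exact (hf.mul_of_le ih h).congr fun a μ => (pow_succ' _ _).symm

theorem min_bound (hf : Comp f) : Comp (fun a μ => min (f a μ) (glob a).N) :=
  (ite (CompP.le hf bound) hf bound).congr fun a μ => by rw [min_def]

/-- Division by counting: the quotient is the number of positive multiples of n+1 that do not exceed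
the dividend, and at most `N` candidates have to be tried. -/
theorem div_order_succ (hf : Comp f) (h : ∀ a μ, f a μ ≤ (glob a).N) :
    Comp (fun a μ => f a μ / ((glob a).n + 1)) := by
  refine (count (dec := fun _ _ _ => inferInstance)
    (P := fun a q μ => (q + 1) * ((glob a).n + 1) ≤ f a μ) ?_).congr fun a μ => ?_
  · refine (CompP.le (mul_of_le (order.fst.add (const 1)) (snd.add (const 1)) fun p μ => ?_)
      hf.fst).congr fun p μ => by rw [mul_comm]
    have := (glob p).order_add_two_le
    change (glob p).n + 1 ≤ _
    omega
  · have : (Finset.range (glob a).N).filter (fun q => (q + 1) * ((glob a).n + 1) ≤ f a μ) =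
        Finset.range (f a μ / ((glob a).n + 1)) := by
      ext q
      rw [Finset.mem_filter, Finset.mem_range, Finset.mem_range, Nat.lt_iff_add_one_le,
        Nat.lt_iff_add_one_le, Nat.le_div_iff_mul_le (by omega)]
      refine and_iff_right_of_imp fun hq => ?_
      nlinarith [h a μ, Nat.zero_le ((q + 1) * (glob a).n)]
    rw [this, Finset.card_range]

end Comp

end OverlapPacking

namespace OverlapPacking

open Ctx (glob)

variable {α : Type} [Ctx α]

/-! ### Codes of vertex sets -/

/-- The `j`-th digit of `c` in base `n + 1`. -/
def digit (g : Glob) (c j : ℕ) : ℕ := min c g.N / (g.n + 1) ^ j % (g.n + 1)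

open Classical in
/-- The set of at most `r` vertices with code `c`; the digit `n` does not stand for a vertex. -/
def codeSet (r : ℕ) (g : Glob) (c : ℕ) : Finset ℕ :=
  (Finset.range g.n).filter fun u => ∃ j < r, digit g c j = u

/-- No smaller code has the same set. -/
def IsCanonical (r : ℕ) (g : Glob) (c : ℕ) : Prop :=
  ∀ c' < g.N, c' < c → codeSet r g c' ≠ codeSet r g c

theorem digit_le (g : Glob) (c j : ℕ) : digit g c j ≤ g.n :=
  Nat.lt_succ_iff.1 (Nat.mod_lt _ (Nat.succ_pos _))

theorem comp_digit {f : α → Mem → ℕ} (hf : Comp f) (j : ℕ) :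
    Comp (fun a μ => digit (glob a) (f a μ) j) := by
  have hdiv : ∀ j, Comp (fun a μ => min (f a μ) (glob a).N / ((glob a).n + 1) ^ j) := by
    intro j
    induction j with
    | zero => exact hf.min_bound.congr fun a μ => by simp
    | succ j ih =>
      refine (ih.div_order_succ fun a μ => (Nat.div_le_self _ _).trans (min_le_right _ _)).congr
        fun a μ => ?_
      rw [Nat.div_div_eq_div_mul, pow_succ]
  refine ((hdiv j).sub (((Comp.order.add (Comp.const 1)).mul_of_le (hdiv (j + 1)))
    fun a μ => ?_)).congr fun a μ => ?_
  · have := (glob a).order_add_two_le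
    omega
  · rw [digit, pow_succ, ← Nat.div_div_eq_div_mul]
    exact (Nat.mod_eq_sub_mul_div ..).symm

theorem compF_codeSet (r : ℕ) {f : α → Mem → ℕ} (hf : Comp f) :
    CompF (fun a μ => codeSet r (glob a) (f a μ)) :=
  CompF.filter (P := fun a u μ => ∃ j < r, digit (glob a) (f a μ) j = u)
    (CompP.exFinite r fun j _ => CompP.eq (comp_digit hf.fst j) Comp.snd)

theorem compP_isCanonical (r : ℕ) {f : α → Mem → ℕ} (hf : Comp f) :
    CompP (fun a μ => IsCanonical r (glob a) (f a μ)) :=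
  CompP.all (P := fun a c' μ => c' < f a μ → codeSet r (glob a) c' ≠ codeSet r (glob a) (f a μ))
    ((CompP.lt Comp.snd hf.fst).imp
      ((compF_codeSet r Comp.snd).eq (compF_codeSet r hf.fst)).not)

/-- The elements are written as digits in base n+1 and padded with the digit `n`, which stands for
no vertex. With r digits the code is below (n+1)^r ≤ N. The least code of the set is canonical. -/
theorem exists_code {r : ℕ} {g : Glob} (hr : r ≤ g.m) {S : Finset ℕ} (hS : S ⊆ Finset.range g.n)
    (hc : S.card ≤ r) : ∃ c < g.N, IsCanonical r g c ∧ codeSet r g c = S := by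
  classical
  have hex : ∃ c, c < g.N ∧ codeSet r g c = S := by
    let l := S.toList
    have hl : l.length = S.card := S.length_toList
    let v : Fin r → Fin (g.n + 1) := fun j => Fin.ofNat _ (l.getD j g.n)
    have hv : ∀ j, (v j).val = l.getD j g.n := by
      intro j
      refine Nat.mod_eq_of_lt ?_
      by_cases h : j < l.length
      · rw [List.getD_eq_getElem _ _ h]
        have : l[(j : ℕ)] ∈ S := Finset.mem_toList.1 (List.getElem_mem h)
        have := Finset.mem_range.1 (hS this)
        omega
      · rw [List.getD_eq_default _ _ (not_lt.1 h)]
        omega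
    let c := finFunctionFinEquiv v
    have hcN : c.val < g.N := by
      refine c.2.trans_le ?_
      calc (g.n + 1) ^ r ≤ (g.n + 2) ^ r := Nat.pow_le_pow_left (by omega) r
        _ ≤ (g.n + 2) ^ (g.m + 1) := Nat.pow_le_pow_right (by omega) (by omega)
    have hdig : ∀ j : Fin r, digit g c j = l.getD j g.n := by
      intro j
      rw [digit, min_eq_left hcN.le, ← hv, ← finFunctionFinEquiv_symm_apply_val]
      · exact congrArg Fin.val (congrFun (finFunctionFinEquiv.symm_apply_apply v) j)
    refine ⟨c, hcN, ?_⟩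
    ext u
    rw [codeSet, Finset.mem_filter, Finset.mem_range]
    constructor
    · rintro ⟨hu, j, hj, rfl⟩
      have h1 := hdig ⟨j, hj⟩
      dsimp only at h1
      by_cases h : j < l.length
      · rw [h1, List.getD_eq_getElem _ _ h]
        exact Finset.mem_toList.1 (List.getElem_mem h)
      · rw [h1, List.getD_eq_default _ _ (not_lt.1 h)] at hu
        omega
    · intro hu
      obtain ⟨j, hj, he⟩ := List.getElem_of_mem (Finset.mem_toList.2 hu)
      have hjr : j < r := hj.trans_le (hl.le.trans hc)
      refine ⟨Finset.mem_range.1 (hS hu), j, hjr, ?_⟩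
      have h1 := hdig ⟨j, hjr⟩
      dsimp only at h1
      rw [h1, List.getD_eq_getElem _ _ hj, he]
  refine ⟨Nat.find hex, (Nat.find_spec hex).1, ?_, (Nat.find_spec hex).2⟩
  intro c' hc' hlt he
  exact Nat.find_min hex hlt ⟨hc', he.trans (Nat.find_spec hex).2⟩

theorem IsCanonical.injOn (r : ℕ) (g : Glob) :
    Set.InjOn (codeSet r g) {c | c < g.N ∧ IsCanonical r g c} := by
  intro c hc c' hc' h
  rcases lt_trichotomy c c' with hlt | heq | hlt
  · exact absurd h (hc'.2 c hc.1 hlt)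
  · exact heq
  · exact absurd h.symm (hc.2 c' hc'.1 hlt)

theorem card_codeSet_le (r : ℕ) (g : Glob) (c : ℕ) : (codeSet r g c).card ≤ r := by
  classical
  calc (codeSet r g c).card ≤ ((Finset.range r).image (digit g c)).card := by
        refine Finset.card_le_card fun u hu => ?_
        obtain ⟨j, hj, h⟩ := (Finset.mem_filter.1 hu).2
        exact Finset.mem_image.2 ⟨j, Finset.mem_range.2 hj, h⟩
    _ ≤ r := Finset.card_image_le.trans (Finset.card_range r).le

theorem codeSet_subset_range (r : ℕ) (g : Glob) (c : ℕ) : codeSet r g c ⊆ Finset.range g.n :=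
  Finset.filter_subset _ _

/-! ### Weights from adjacency patterns -/

variable (𝓗 : Finset FinGraph) (ind : Prop)

/-- Which entries of a tuple are equal vertices, and which are adjacent. -/
def pattern {r : ℕ} (n : ℕ) (R : ℕ → ℕ → Prop) (v : Fin r → ℕ) : Fin r × Fin r × Bool → Prop
  | (i, j, true) => v i = v j ∧ v i < n
  | (i, j, false) => v i < n ∧ v j < n ∧ R (v i) (v j)

/-- The weight of a vertex set, computed from a pattern: the first occurrences of the vertices
are kept. -/
noncomputable def patternWeight {r : ℕ} (q : Fin r × Fin r × Bool → Prop) : ℕ :=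
  spanningCount 𝓗 ind (SimpleGraph.fromRel
    fun x y : {j : Fin r // q (j, j, true) ∧ ∀ i < j, ¬ q (i, j, true)} => q (x, y, false))

/-- The positions where a vertex occurs for the first time enumerate `S` without repetition, so the
graph on these positions is a copy of the induced graph on `S`. As adjacency is already symmetric
and irreflexive, `fromRel` changes nothing. -/
theorem patternWeight_pattern {r n : ℕ} {R : ℕ → ℕ → Prop} {Γ : SimpleGraph ℕ}
    (hR : ∀ u < n, ∀ v < n, R u v ↔ Γ.Adj u v) (v : Fin r → ℕ) {S : Finset ℕ}
    (hS : ∀ u, u ∈ S ↔ u < n ∧ ∃ j, v j = u) :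
    patternWeight 𝓗 ind (pattern n R v) = weight 𝓗 ind Γ S := by
  have hinj : Function.Injective fun x : {j : Fin r // pattern n R v (j, j, true) ∧
      ∀ i < j, ¬ pattern n R v (i, j, true)} => v x.1 := by
    rintro ⟨x, hx1, hx2⟩ ⟨y, hy1, hy2⟩ h
    dsimp only at h
    apply Subtype.ext
    rcases lt_trichotomy x y with hlt | heq | hlt
    · exact absurd ⟨h, hx1.2⟩ (hy2 x hlt)
    · exact heq
    · exact absurd ⟨h.symm, hy1.2⟩ (hx2 y hlt)
  rw [weight_eq_of_injective 𝓗 ind Γ hinj, patternWeight]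
  · congr 1
    ext x y
    rw [SimpleGraph.fromRel_adj, SimpleGraph.comap_adj]
    have hx := x.2.1.2
    have hy := y.2.1.2
    have e1 : pattern n R v (x, y, false) ↔ Γ.Adj (v x) (v y) :=
      ⟨fun h => (hR _ hx _ hy).1 h.2.2, fun h => ⟨hx, hy, (hR _ hx _ hy).2 h⟩⟩
    have e2 : pattern n R v (y, x, false) ↔ Γ.Adj (v y) (v x) :=
      ⟨fun h => (hR _ hy _ hx).1 h.2.2, fun h => ⟨hy, hx, (hR _ hy _ hx).2 h⟩⟩
    rw [e1, e2, Γ.adj_comm (v y), or_self, and_iff_right_iff_imp]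
    rintro h rfl
    exact Γ.loopless.irrefl _ h
  · ext u
    rw [Finset.mem_coe, hS]
    constructor
    · rintro ⟨x, rfl⟩
      exact ⟨x.2.1.2, x.1, rfl⟩
    · rintro ⟨hu, hj⟩
      classical
      have hne : ((Finset.univ : Finset (Fin r)).filter fun j => v j = u).Nonempty := by
        obtain ⟨j, hj⟩ := hj
        exact ⟨j, by simp [hj]⟩
      obtain ⟨j, hj1, hj2⟩ := Finset.exists_min_image _ id hne
      have hj1 : v j = u := (Finset.mem_filter.1 hj1).2
      refine ⟨⟨j, ⟨rfl, hj1 ▸ hu⟩, fun i hi h => ?_⟩, hj1⟩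
      have := hj2 i (Finset.mem_filter.2 ⟨Finset.mem_univ _, h.1.trans hj1⟩)
      exact absurd hi (not_lt.2 this)

/-- The weight of the set with code `c`, computed from the adjacency matrix `ad`. -/
noncomputable def codeWeight (r : ℕ) (g : Glob) (ad : ℕ → ℕ) (c : ℕ) : ℕ :=
  patternWeight 𝓗 ind
    (pattern g.n (fun u v => ad (u * g.n + v) ≠ 0) fun j : Fin r => digit g c j)

theorem codeWeight_eq (r : ℕ) (g : Glob) {ad : ℕ → ℕ} {Γ : SimpleGraph ℕ}
    (had : ∀ u < g.n, ∀ v < g.n, ad (u * g.n + v) ≠ 0 ↔ Γ.Adj u v) (c : ℕ) :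
    codeWeight 𝓗 ind r g ad c = weight 𝓗 ind Γ (codeSet r g c) := by
  refine patternWeight_pattern 𝓗 ind had _ fun u => ?_
  rw [codeSet, Finset.mem_filter, Finset.mem_range]
  refine and_congr_right fun _ => ⟨fun ⟨j, hj, h⟩ => ⟨⟨j, hj⟩, h⟩, fun ⟨j, h⟩ => ⟨j, j.2, h⟩⟩

end OverlapPacking

namespace OverlapPacking

open Ctx (glob)

variable {α : Type} [Ctx α]

/-! ### The algorithm -/

/-- The `j`-th of the consecutive parts of length `N` of the memory. -/
def region (g : Glob) (μ : Mem) (j a : ℕ) : ℕ := if a < g.N then μ (j * g.N + a) else 0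

theorem comp_region (j : ℕ) {f : α → Mem → ℕ} (hf : Comp f) :
    Comp (fun a μ => region (glob a) μ j (f a μ)) :=
  Comp.ite (CompP.lt hf Comp.bound) (Comp.mem ((Comp.constMul j Comp.bound).add hf)) (Comp.const 0)

theorem region_update_self {g : Glob} {μ : Mem} {j a v : ℕ} (ha : a < g.N) :
    region g (Function.update μ (j * g.N + a) v) j = Function.update (region g μ j) a v := by
  ext b
  by_cases hb : b = a
  · subst hb
    simp [region, ha]
  · rw [Function.update_of_ne hb, region, region, Function.update_of_ne (by omega)]

theorem region_update_of_ne {g : Glob} {μ : Mem} {i j a v : ℕ} (ha : a < g.N) (hij : i ≠ j) :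
    region g (Function.update μ (j * g.N + a) v) i = region g μ i := by
  ext b
  rw [region, region]
  split_ifs with hb
  · rw [Function.update_of_ne]
    intro h
    rcases Nat.lt_or_gt_of_ne hij with hlt | hlt
    · have := Nat.mul_le_mul_right g.N hlt
      rw [Nat.succ_mul] at this
      omega
    · have := Nat.mul_le_mul_right g.N hlt
      rw [Nat.succ_mul] at this
      omega
  · rfl

section

open Classical

/-- The least number less than `N` with the property `P`, if there is one. -/
noncomputable def least (N : ℕ) (P : ℕ → Prop) : ℕ :=
  ((Finset.range N).filter fun i => ∀ j < N, j ≤ i → ¬ P j).card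

/-- The numbers with no witness up to them are exactly those below the first witness, so their count
is that witness. In this form the minimum is computed by a counting loop. -/
theorem least_spec {N : ℕ} {P : ℕ → Prop} (h : ∃ i < N, P i) : least N P < N ∧ P (least N P) := by
  have h0 := Nat.find_spec h
  have : (Finset.range N).filter (fun i => ∀ j < N, j ≤ i → ¬ P j) =
      Finset.range (Nat.find h) := by
    ext i
    rw [Finset.mem_filter, Finset.mem_range, Finset.mem_range]
    constructor
    · rintro ⟨_, h2⟩
      by_contra! hle
      exact h2 _ h0.1 hle h0.2
    · intro hi
      exact ⟨hi.trans h0.1, fun j hj hji hP => Nat.find_min h (hji.trans_lt hi) ⟨hj, hP⟩⟩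
  rw [least, this, Finset.card_range]
  exact h0

theorem comp_least {P : α → ℕ → Mem → Prop} (hP : CompP (fun (p : α × ℕ) μ => P p.1 p.2 μ)) :
    Comp (fun a μ => least (glob a).N fun i => P a i μ) := by
  unfold least
  exact Comp.count (P := fun a i μ => ∀ j < (glob a).N, j ≤ i → ¬ P a j μ)
    (CompP.all (P := fun (p : α × ℕ) j μ => j ≤ p.2 → ¬ P p.1 j μ)
      ((CompP.le Comp.snd Comp.snd.fst).imp hP.middle.not))

variable (𝓗 : Finset FinGraph) (ind : Prop) (t r : ℕ) (g : Glob) (ad bit : ℕ → ℕ)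

/-- The number of `𝓗`-subgraphs with at most `t` vertices inside `W`. -/
noncomputable def smallSum (W : Finset ℕ) : ℕ :=
  ∑ c ∈ Finset.range g.N,
    if IsCanonical r g c ∧ (codeSet r g c).card ≤ t ∧ codeSet r g c ⊆ W
    then codeWeight 𝓗 ind r g ad c else 0

/-- The number of sets with more than `t` elements that are needed. -/
noncomputable def rest : ℕ := g.k - smallSum 𝓗 ind t r g ad (Finset.range g.n)

/-- `c` is the code of the vertex set of an `𝓗`-subgraph with more than `t` vertices. -/
def IsBig (c : ℕ) : Prop :=
  IsCanonical r g c ∧ t < (codeSet r g c).card ∧ codeWeight 𝓗 ind r g ad c ≠ 0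

/-- The number of selected sets which contain the set with code `p`. -/
noncomputable def supersets (p : ℕ) : ℕ :=
  ((Finset.range g.N).filter fun c => bit c ≠ 0 ∧ codeSet r g p ⊆ codeSet r g c).card

/-- The code `c` may be selected. -/
def Accept (c : ℕ) : Prop :=
  IsBig 𝓗 ind t r g ad c ∧
    ((Finset.range g.N).filter fun c => bit c ≠ 0).card <
      -- The truncation at `N` makes the powers computable. It has no effect on the output, since
      -- the family is used only when `rest` is at most `N`.
      familyBound t r (min (rest 𝓗 ind t r g ad) g.N) ∧
    ∀ p < g.N, codeSet r g p ⊆ codeSet r g c →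
      -- The cardinality is named `i` so that the program, a finite disjunction over `i`, only needs
      -- powers with constant exponents.
      ¬ ∃ i < r, t < i ∧ (codeSet r g p).card = i ∧
        (r * min (rest 𝓗 ind t r g ad) g.N) ^ (r - 1 - i) ≤ supersets r g bit p

/-- The union of the selected sets. -/
noncomputable def familyVerts : Finset ℕ :=
  (Finset.range g.n).filter fun u => ∃ c < g.N, bit c ≠ 0 ∧ u ∈ codeSet r g c

/-- The bids of the auction: `p` is the code of an `(r - 1)`-subset of a selected set, and becomes
the vertex set of an `𝓗`-subgraph if the outside vertex `u` is added. -/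
def Wants (p u : ℕ) : Prop :=
  p < g.N ∧ IsCanonical r g p ∧ (codeSet r g p).card + 1 = r ∧
    (∃ c < g.N, bit c ≠ 0 ∧ codeSet r g p ⊆ codeSet r g c) ∧
    u < g.n ∧ u ∉ familyVerts r g bit ∧
    ∃ c < g.N, IsBig 𝓗 ind t r g ad c ∧ codeSet r g p ⊆ codeSet r g c ∧ u ∈ codeSet r g c

/-- The state of the auction. -/
def auctionOf (μ : Mem) : Auction := ⟨region g μ 2, region g μ 3⟩

/-- `p` can bid for `u`. -/
def MayBid (μ : Mem) (p u : ℕ) : Prop :=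
  Auction.CanBid (Wants 𝓗 ind t r g (region g μ 0) (region g μ 1)) (g.N + 1) (auctionOf g μ) p u

/-- First phase: selection of a family. -/
noncomputable def selectFamily (μ : Mem) : Mem :=
  iter (fun c μ => if Accept 𝓗 ind t r g (region g μ 0) (region g μ 1) c
    then Function.update μ (1 * g.N + c) 1 else μ) g.N μ

/-- One step of the auction. -/
noncomputable def auctionStep (μ : Mem) : Mem :=
  if ∃ p < g.N, ∃ u < g.n, MayBid 𝓗 ind t r g μ p u then
    -- Bidder, object and new label are evaluated before the memory changes; the nesting is the one
    -- produced by `CompS.bind`.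
    (fun p => (fun u => (fun l => Function.update (Function.update μ (2 * g.N + u) l)
        (3 * g.N + u) (p + 1))
      (region g μ 2 u + 1))
      (least g.N fun u => MayBid 𝓗 ind t r g μ p u))
      (least g.N fun p => ∃ u < g.n, MayBid 𝓗 ind t r g μ p u)
  else μ

/-- Second phase: the auction. -/
noncomputable def runAuction (μ : Mem) : Mem :=
  iter (fun _ μ => iter (fun _ μ => auctionStep 𝓗 ind t r g μ) g.N μ) g.N μ

/-- The vertices of the kernel. -/
noncomputable def keptSet (μ : Mem) : Finset ℕ :=
  -- The two cases in which the answer is known: nothing is left to be found, or more sets are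
  -- wanted than there are codes.
  if rest 𝓗 ind t r g (region g μ 0) = 0 ∨ g.N < rest 𝓗 ind t r g (region g μ 0) then ∅
  else (Finset.range g.n).filter fun u => u ∈ familyVerts r g (region g μ 1) ∨ region g μ 2 u ≠ 0

/-- The parameter of the kernel. -/
noncomputable def newParam (μ : Mem) : ℕ :=
  if rest 𝓗 ind t r g (region g μ 0) = 0 then 0
  else if g.N < rest 𝓗 ind t r g (region g μ 0) then g.k
  else rest 𝓗 ind t r g (region g μ 0) +
    smallSum 𝓗 ind t r g (region g μ 0) (keptSet 𝓗 ind t r g μ)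

/-- The number of elements of `W` below `u`. -/
def rank (W : Finset ℕ) (u : ℕ) : ℕ := (W.filter (· < u)).card

/-- Entry number `a` of the adjacency matrix of the graph induced by `W`. -/
def IsEntry (W : Finset ℕ) (a : ℕ) : Prop :=
  ∃ u < g.n, ∃ v < g.n, u ∈ W ∧ v ∈ W ∧ ad (u * g.n + v) ≠ 0 ∧ rank W u * W.card + rank W v = a

/-- Third phase: computation of the new adjacency matrix, and copying it to its place. -/
noncomputable def writeMatrix (μ : Mem) : Mem :=
  -- The new matrix is built in region 4, because the old one in region 0 is needed until the last
  -- entry is known.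
  (fun μ => iter (fun a μ => Function.update μ a (region g μ 4 a)) g.N μ)
    (iter (fun a μ => Function.update μ (4 * g.N + a)
      (if IsEntry g (region g μ 0) (keptSet 𝓗 ind t r g μ) a then 1 else 0)) g.N μ)

/-- The numbers of the output are put in a safe place. -/
noncomputable def writeNumbers (μ : Mem) : Mem :=
  (fun μ => Function.update μ (5 * g.N + 1) (newParam 𝓗 ind t r g μ))
    (Function.update μ (5 * g.N + 0) (keptSet 𝓗 ind t r g μ).card)

/-- The algorithm. -/
noncomputable def kernelize (μ : Mem) : Mem :=
  -- The numbers are saved before the matrix is written, since that overwrites the adjacency matrix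
  -- from which they are computed.
  writeMatrix 𝓗 ind t r g (writeNumbers 𝓗 ind t r g
    (runAuction 𝓗 ind t r g (selectFamily 𝓗 ind t r g μ)))

/-! ### The algorithm is computable -/

variable {t r} {g ad bit} {f h : α → Mem → ℕ}

/-- Counting subgraphs is not programmed: the weight depends only on 2r² truth values about the
digits, and the program contains the table of all its values. -/
theorem comp_codeWeight (hf : Comp f) :
    Comp (fun a μ => codeWeight 𝓗 ind r (glob a) (region (glob a) μ 0) (f a μ)) := by
  refine Comp.table (P := fun i a μ => pattern (glob a).n
    (fun u v => region (glob a) μ 0 (u * (glob a).n + v) ≠ 0)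
      (fun j : Fin r => digit (glob a) (f a μ) j) i) ?_ (patternWeight 𝓗 ind)
  rintro ⟨i, j, b⟩
  have hn : ∀ i, CompP (fun a μ => digit (glob a) (f a μ) i < (glob a).n) := fun i =>
    CompP.lt (comp_digit hf i) Comp.order
  cases b
  · refine (hn i).and ((hn j).and (CompP.ne_zero (comp_region 0
      (((comp_digit hf i).mul_of_le Comp.order fun a μ => ?_).add (comp_digit hf j)))))
    have := digit_le (glob a) (f a μ) i
    have := (glob a).order_add_two_le
    omega
  · exact (CompP.eq (comp_digit hf i) (comp_digit hf j)).and (hn i)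

theorem comp_smallSum {W : α → Mem → Finset ℕ} (hW : CompF W) :
    Comp (fun a μ => smallSum 𝓗 ind t r (glob a) (region (glob a) μ 0) (W a μ)) :=
  Comp.sum (g := fun a c μ => if IsCanonical r (glob a) c ∧ (codeSet r (glob a) c).card ≤ t ∧
      codeSet r (glob a) c ⊆ W a μ
    then codeWeight 𝓗 ind r (glob a) (region (glob a) μ 0) c else 0)
    (Comp.ite ((compP_isCanonical r Comp.snd).and
      ((CompP.le (compF_codeSet r Comp.snd).card (Comp.const t)).and
        ((compF_codeSet r Comp.snd).subset hW.fst)))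
      (comp_codeWeight 𝓗 ind Comp.snd) (Comp.const 0))

theorem comp_rest :
    Comp (fun (a : α) μ => rest 𝓗 ind t r (glob a) (region (glob a) μ 0)) :=
  Comp.param.sub (comp_smallSum 𝓗 ind CompF.range)

theorem compP_isBig (hf : Comp f) :
    CompP (fun a μ => IsBig 𝓗 ind t r (glob a) (region (glob a) μ 0) (f a μ)) :=
  (compP_isCanonical r hf).and ((CompP.lt (Comp.const t) (compF_codeSet r hf).card).and
    (CompP.ne_zero (comp_codeWeight 𝓗 ind hf)))

theorem comp_supersets (hf : Comp f) :
    Comp (fun a μ => supersets r (glob a) (region (glob a) μ 1) (f a μ)) :=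
  Comp.count (P := fun a c μ => region (glob a) μ 1 c ≠ 0 ∧
      codeSet r (glob a) (f a μ) ⊆ codeSet r (glob a) c)
    ((CompP.ne_zero (comp_region 1 Comp.snd)).and
      ((compF_codeSet r hf.fst).subset (compF_codeSet r Comp.snd)))

theorem comp_min_rest_pow (e : ℕ) :
    Comp (fun (a : α) μ => min (rest 𝓗 ind t r (glob a) (region (glob a) μ 0)) (glob a).N ^ e) :=
  (comp_rest 𝓗 ind).min_bound.pow_of_le (fun _ _ => min_le_right _ _) e

theorem compP_accept (hf : Comp f) :
    CompP (fun a μ => Accept 𝓗 ind t r (glob a) (region (glob a) μ 0) (region (glob a) μ 1)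
      (f a μ)) := by
  refine (compP_isBig 𝓗 ind hf).and (CompP.and (CompP.lt ?_ ?_) ?_)
  · exact Comp.count (P := fun a c μ => region (glob a) μ 1 c ≠ 0)
      (CompP.ne_zero (comp_region 1 Comp.snd))
  · exact Comp.constMul _ (comp_min_rest_pow 𝓗 ind _)
  · refine CompP.all (P := fun a p μ => codeSet r (glob a) p ⊆ codeSet r (glob a) (f a μ) →
      ¬ ∃ i < r, t < i ∧ (codeSet r (glob a) p).card = i ∧
        (r * min (rest 𝓗 ind t r (glob a) (region (glob a) μ 0)) (glob a).N) ^ (r - 1 - i) ≤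
          supersets r (glob a) (region (glob a) μ 1) p)
      (((compF_codeSet r Comp.snd).subset (compF_codeSet r hf.fst)).imp
        (CompP.exFinite r fun i _ => ?_).not)
    refine (CompP.lt (Comp.const t) (Comp.const i)).and
      ((CompP.eq (compF_codeSet r Comp.snd).card (Comp.const i)).and (CompP.le ?_
        (comp_supersets Comp.snd)))
    refine (Comp.constMul (r ^ (r - 1 - i))
      (comp_min_rest_pow (t := t) (r := r) 𝓗 ind (r - 1 - i))).congr
      fun p μ => ?_
    rw [mul_pow]
    rfl

theorem compF_familyVerts :
    CompF (fun (a : α) μ => familyVerts r (glob a) (region (glob a) μ 1)) :=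
  CompF.filter (P := fun a u μ => ∃ c < (glob a).N, region (glob a) μ 1 c ≠ 0 ∧
      u ∈ codeSet r (glob a) c)
    (CompP.ex (P := fun (p : α × ℕ) c μ => region (glob p) μ 1 c ≠ 0 ∧
        p.2 ∈ codeSet r (glob p) c)
      ((CompP.ne_zero (comp_region 1 Comp.snd)).and ((compF_codeSet r Comp.snd).mem Comp.snd.fst)))

theorem compP_wants (hf : Comp f) (hh : Comp h) :
    CompP (fun a μ => Wants 𝓗 ind t r (glob a) (region (glob a) μ 0) (region (glob a) μ 1)
      (f a μ) (h a μ)) := by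
  refine (CompP.lt hf Comp.bound).and ((compP_isCanonical r hf).and
    ((CompP.eq ((compF_codeSet r hf).card.add (Comp.const 1)) (Comp.const r)).and
    (CompP.and ?_ ((CompP.lt hh Comp.order).and ((compF_familyVerts.mem hh).not.and ?_)))))
  · exact CompP.ex (P := fun a c μ => region (glob a) μ 1 c ≠ 0 ∧
        codeSet r (glob a) (f a μ) ⊆ codeSet r (glob a) c)
      ((CompP.ne_zero (comp_region 1 Comp.snd)).and
        ((compF_codeSet r hf.fst).subset (compF_codeSet r Comp.snd)))
  · exact CompP.ex (P := fun a c μ => IsBig 𝓗 ind t r (glob a) (region (glob a) μ 0) c ∧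
        codeSet r (glob a) (f a μ) ⊆ codeSet r (glob a) c ∧ h a μ ∈ codeSet r (glob a) c)
      ((compP_isBig 𝓗 ind Comp.snd).and
        (((compF_codeSet r hf.fst).subset (compF_codeSet r Comp.snd)).and
          ((compF_codeSet r Comp.snd).mem hh.fst)))

theorem compP_mayBid (hf : Comp f) (hh : Comp h) :
    CompP (fun a μ => MayBid 𝓗 ind t r (glob a) μ (f a μ) (h a μ)) := by
  refine ((CompP.all (P := fun a v μ => region (glob a) μ 3 v ≠ f a μ + 1)
    (CompP.eq (comp_region 3 Comp.snd) (hf.fst.add (Comp.const 1))).not).and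
    (((compP_wants (t := t) (r := r) 𝓗 ind hf hh).and (CompP.allOrder (P := fun a v μ =>
      Wants 𝓗 ind t r (glob a) (region (glob a) μ 0) (region (glob a) μ 1) (f a μ) v →
        region (glob a) μ 2 (h a μ) ≤ region (glob a) μ 2 v)
      ((compP_wants 𝓗 ind hf.fst Comp.snd).imp
        (CompP.le (comp_region 2 hh.fst) (comp_region 2 Comp.snd))))).and
    (CompP.lt (comp_region 2 hh) (Comp.bound.add (Comp.const 1))))).congr fun a μ => ?_
  refine and_congr ⟨fun H v => ?_, fun H v _ => H v⟩ (and_congr_left fun _ =>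
    and_congr_right fun _ => ⟨fun H v hv => H v hv.2.2.2.2.1 hv, fun H v _ hv => H v hv⟩)
  -- Beyond `N` a region reads `0`, which never has the form `p + 1`; so the bounded search suffices
  -- for `Free`.
  by_cases hv : v < (glob a).N
  · exact H v hv
  · change region _ _ _ _ ≠ _
    rw [region, if_neg hv]
    omega

theorem compS_selectFamily : CompS (fun (a : α) μ => selectFamily 𝓗 ind t r (glob a) μ) :=
  CompS.loop (F := fun a c μ =>
      if Accept 𝓗 ind t r (glob a) (region (glob a) μ 0) (region (glob a) μ 1) c
      then Function.update μ (1 * (glob a).N + c) 1 else μ)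
    (CompS.ite (compP_accept 𝓗 ind Comp.snd)
      (CompS.store ((Comp.constMul 1 Comp.bound).add Comp.snd) (Comp.const 1)) CompS.id)

theorem compS_auctionStep : CompS (fun (a : α) μ => auctionStep 𝓗 ind t r (glob a) μ) := by
  refine CompS.ite (CompP.ex (P := fun a p μ => ∃ u < (glob a).n, MayBid 𝓗 ind t r (glob a) μ p u)
    (CompP.exOrder (P := fun (q : α × ℕ) u μ => MayBid 𝓗 ind t r (glob q) μ q.2 u)
      (compP_mayBid 𝓗 ind Comp.snd.fst Comp.snd))) ?_ CompS.id
  refine CompS.bind (F := fun a p μ => (fun u => (fun l => Function.update (Function.update μ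
      (2 * (glob a).N + u) l) (3 * (glob a).N + u) (p + 1)) (region (glob a) μ 2 u + 1))
      (least (glob a).N fun u => MayBid 𝓗 ind t r (glob a) μ p u))
    (comp_least (P := fun a p μ => ∃ u < (glob a).n, MayBid 𝓗 ind t r (glob a) μ p u)
      (CompP.exOrder (P := fun (q : α × ℕ) u μ => MayBid 𝓗 ind t r (glob q) μ q.2 u)
        (compP_mayBid 𝓗 ind Comp.snd.fst Comp.snd))) ?_
  refine CompS.bind (F := fun (q : α × ℕ) u μ => (fun l => Function.update (Function.update μ
      (2 * (glob q).N + u) l) (3 * (glob q).N + u) (q.2 + 1)) (region (glob q) μ 2 u + 1))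
    (comp_least (P := fun (q : α × ℕ) u μ => MayBid 𝓗 ind t r (glob q) μ q.2 u)
      (compP_mayBid 𝓗 ind Comp.snd.fst Comp.snd)) ?_
  refine CompS.bind (F := fun (q : (α × ℕ) × ℕ) l μ => Function.update (Function.update μ
      (2 * (glob q).N + q.2) l) (3 * (glob q).N + q.2) (q.1.2 + 1))
    ((comp_region 2 Comp.snd).add (Comp.const 1)) ?_
  exact CompS.seq
    (CompS.store ((Comp.constMul 2 Comp.bound).add Comp.snd.fst) Comp.snd)
    (CompS.store ((Comp.constMul 3 Comp.bound).add Comp.snd.fst)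
      (Comp.snd.fst.fst.add (Comp.const 1)))

theorem compS_runAuction : CompS (fun (a : α) μ => runAuction 𝓗 ind t r (glob a) μ) :=
  CompS.loop (F := fun a _ μ => iter (fun _ μ => auctionStep 𝓗 ind t r (glob a) μ) (glob a).N μ)
    (CompS.loop (F := fun (p : α × ℕ) _ μ => auctionStep 𝓗 ind t r (glob p) μ)
      (compS_auctionStep 𝓗 ind))

theorem compF_keptSet : CompF (fun (a : α) μ => keptSet 𝓗 ind t r (glob a) μ) := by
  refine CompF.ite ((CompP.eq (comp_rest 𝓗 ind) (Comp.const 0)).or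
    (CompP.lt Comp.bound (comp_rest 𝓗 ind))) ?_ ?_
  · exact ⟨fun _ _ => Finset.empty_subset _, (CompP.ne_zero (Comp.const 0)).congr fun a μ => by simp⟩
  · exact CompF.filter (P := fun a u μ => u ∈ familyVerts r (glob a) (region (glob a) μ 1) ∨
      region (glob a) μ 2 u ≠ 0)
      (compF_familyVerts.mem_snd.or (CompP.ne_zero (comp_region 2 Comp.snd)))

theorem comp_newParam : Comp (fun (a : α) μ => newParam 𝓗 ind t r (glob a) μ) :=
  Comp.ite (CompP.eq (comp_rest 𝓗 ind) (Comp.const 0)) (Comp.const 0)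
    (Comp.ite (CompP.lt Comp.bound (comp_rest 𝓗 ind)) Comp.param
      ((comp_rest 𝓗 ind).add (comp_smallSum 𝓗 ind (compF_keptSet 𝓗 ind))))

theorem comp_rank {W : α → Mem → Finset ℕ} (hW : CompF W) (hf : Comp f) :
    Comp (fun a μ => rank (W a μ) (f a μ)) := by
  have : CompF (fun a μ => (Finset.range (glob a).n).filter fun u => u ∈ W a μ ∧ u < f a μ) :=
    CompF.filter (P := fun a u μ => u ∈ W a μ ∧ u < f a μ)
      (hW.mem_snd.and (CompP.lt Comp.snd hf.fst))
  refine this.card.congr fun a μ => ?_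
  rw [rank]
  congr 1
  ext u
  simp only [Finset.mem_filter, Finset.mem_range]
  exact ⟨fun H => H.2, fun H => ⟨hW.lt_order H.1, H⟩⟩

theorem compP_isEntry {W : α → Mem → Finset ℕ} (hW : CompF W) (hf : Comp f) :
    CompP (fun a μ => IsEntry (glob a) (region (glob a) μ 0) (W a μ) (f a μ)) := by
  have hle : ∀ (a : α) μ, (W a μ).card ≤ (glob a).N := by
    intro a μ
    have h1 := Finset.card_le_card (hW.subset_range a μ)
    have := (glob a).order_add_two_le
    rw [Finset.card_range] at h1
    omega
  refine CompP.exOrder (P := fun a u μ => ∃ v < (glob a).n, u ∈ W a μ ∧ v ∈ W a μ ∧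
    region (glob a) μ 0 (u * (glob a).n + v) ≠ 0 ∧
      rank (W a μ) u * (W a μ).card + rank (W a μ) v = f a μ) ?_
  refine CompP.exOrder (P := fun (q : α × ℕ) v μ => q.2 ∈ W q.1 μ ∧ v ∈ W q.1 μ ∧
    region (glob q) μ 0 (q.2 * (glob q).n + v) ≠ 0 ∧
      rank (W q.1 μ) q.2 * (W q.1 μ).card + rank (W q.1 μ) v = f q.1 μ) ?_
  refine hW.mem_snd.fst.and (hW.mem_snd.middle.and (CompP.and (CompP.ne_zero (comp_region 0
    (Comp.add ?_ Comp.snd))) (CompP.eq (Comp.add ?_ (comp_rank hW.fst.fst Comp.snd))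
      hf.fst.fst)))
  · refine (Comp.mul_of_le Comp.order Comp.snd.fst fun q μ => ?_).congr fun q μ => mul_comm _ _
    have := (glob q).order_add_two_le
    omega
  · exact Comp.mul_of_le (comp_rank hW.fst.fst Comp.snd.fst) hW.fst.fst.card fun q μ =>
      (Finset.card_filter_le _ _).trans (hle q.1.1 μ)

theorem compS_writeMatrix : CompS (fun (a : α) μ => writeMatrix 𝓗 ind t r (glob a) μ) := by
  refine CompS.seq (F := fun a μ => iter (fun b μ => Function.update μ (4 * (glob a).N + b)
      (if IsEntry (glob a) (region (glob a) μ 0) (keptSet 𝓗 ind t r (glob a) μ) b then 1 else 0))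
      (glob a).N μ)
    (G := fun a μ => iter (fun b μ => Function.update μ b (region (glob a) μ 4 b)) (glob a).N μ)
    (CompS.loop ?_) (CompS.loop ?_)
  · exact CompS.store ((Comp.constMul 4 Comp.bound).add Comp.snd)
      (Comp.zero_one (compP_isEntry (compF_keptSet 𝓗 ind) Comp.snd))
  · exact CompS.store Comp.snd (comp_region 4 Comp.snd)

theorem compS_writeNumbers : CompS (fun (a : α) μ => writeNumbers 𝓗 ind t r (glob a) μ) :=
  (CompS.store ((Comp.constMul 5 Comp.bound).add (Comp.const 0)) (compF_keptSet 𝓗 ind).card).seq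
    (CompS.store ((Comp.constMul 5 Comp.bound).add (Comp.const 1)) (comp_newParam 𝓗 ind))

theorem compS_kernelize : CompS (fun (a : α) μ => kernelize 𝓗 ind t r (glob a) μ) :=
  (((compS_selectFamily 𝓗 ind).seq (compS_runAuction 𝓗 ind)).seq (compS_writeNumbers 𝓗 ind)).seq
    (compS_writeMatrix 𝓗 ind)

end

end OverlapPacking

namespace OverlapPacking

/-! ### Correctness of the algorithm -/

section Spec

variable {𝓗 : Finset FinGraph} {ind : Prop} {t r : ℕ} {g : Glob} {ad bit : ℕ → ℕ}
  {Γ : SimpleGraph ℕ}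

/-- `ad` is the adjacency matrix of `Γ` on the first `n` vertices. -/
def Represents (g : Glob) (ad : ℕ → ℕ) (Γ : SimpleGraph ℕ) : Prop :=
  ∀ u < g.n, ∀ v < g.n, ad (u * g.n + v) ≠ 0 ↔ Γ.Adj u v

variable (𝓗 ind t g Γ) in
/-- `S` is the vertex set of an `𝓗`-subgraph with more than `t` vertices. -/
def IsBigSet (S : Finset ℕ) : Prop :=
  S ⊆ Finset.range g.n ∧ t < S.card ∧ weight 𝓗 ind Γ S ≠ 0

/-- Canonical codes are in bijection with the vertex sets of at most `r` elements, so summing over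
them counts each set once. The condition t ≤ r ensures that every small set has a code. -/
theorem smallSum_eq (hr : r ≤ g.m) (htr : t ≤ r) (had : Represents g ad Γ) {W : Finset ℕ}
    (hW : W ⊆ Finset.range g.n) : smallSum 𝓗 ind t r g ad W = smallCount 𝓗 ind t Γ W := by
  classical
  rw [smallSum, ← Finset.sum_filter, smallCount]
  refine Finset.sum_nbij (codeSet r g) ?_ ?_ ?_ ?_
  · intro c hc
    obtain ⟨_, _, h1, h2⟩ := Finset.mem_filter.1 hc
    exact Finset.mem_filter.2 ⟨Finset.mem_powerset.2 h2, h1⟩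
  · refine (IsCanonical.injOn r g).mono fun c hc => ?_
    obtain ⟨h1, h2, _⟩ := Finset.mem_filter.1 (Finset.mem_coe.1 hc)
    exact ⟨Finset.mem_range.1 h1, h2⟩
  · intro S hS
    obtain ⟨h1, h2⟩ := Finset.mem_filter.1 (Finset.mem_coe.1 hS)
    have h1 := Finset.mem_powerset.1 h1
    obtain ⟨c, hc1, hc2, rfl⟩ := exists_code hr (h1.trans hW) (h2.trans htr)
    exact ⟨c, Finset.mem_coe.2 (Finset.mem_filter.2 ⟨Finset.mem_range.2 hc1, hc2, h2, h1⟩), rfl⟩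
  · intro c _
    exact codeWeight_eq 𝓗 ind r g had c

theorem isBig_iff (had : Represents g ad Γ) (c : ℕ) :
    IsBig 𝓗 ind t r g ad c ↔ IsCanonical r g c ∧ IsBigSet 𝓗 ind t g Γ (codeSet r g c) := by
  rw [IsBig, IsBigSet, codeWeight_eq 𝓗 ind r g had,
    and_iff_right (codeSet_subset_range r g c)]

theorem IsBigSet.card_le {S : Finset ℕ} (h : IsBigSet 𝓗 ind t g Γ S) : S.card ≤ maxOrder 𝓗 :=
  card_le_of_weight_ne_zero 𝓗 ind h.2.2

theorem IsBigSet.exists_isBig (hr : r ≤ g.m) (hmax : maxOrder 𝓗 ≤ r) (had : Represents g ad Γ)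
    {S : Finset ℕ} (h : IsBigSet 𝓗 ind t g Γ S) :
    ∃ c < g.N, IsBig 𝓗 ind t r g ad c ∧ codeSet r g c = S := by
  obtain ⟨c, h1, h2, rfl⟩ := exists_code hr h.1 (h.card_le.trans hmax)
  exact ⟨c, h1, (isBig_iff had c).2 ⟨h2, h⟩, rfl⟩

/-! #### Selection of the family -/

open Classical in
/-- The codes of the selected sets. -/
noncomputable def selected (g : Glob) (bit : ℕ → ℕ) : Finset ℕ :=
  (Finset.range g.N).filter fun c => bit c ≠ 0

theorem supersets_eq (p : ℕ) : supersets r g bit p =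
    ((selected g bit).filter (codeSet r g p ⊆ codeSet r g ·)).card := by
  classical
  rw [supersets, selected, Finset.filter_filter]

variable (𝓗 ind t r g ad) in
/-- What is known after the codes less than `i` have been considered. -/
structure SelectInv (κ i : ℕ) (bit : ℕ → ℕ) : Prop where
  lt : ∀ c ∈ selected g bit, c < i
  isBig : ∀ c ∈ selected g bit, IsBig 𝓗 ind t r g ad c
  cap : ∀ P : Finset ℕ, t < P.card → P.card < r →
    ((selected g bit).filter (P ⊆ codeSet r g ·)).card ≤ (r * κ) ^ (r - 1 - P.card)
  card_le : (selected g bit).card ≤ familyBound t r κ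
  reject : ∀ c < i, IsBig 𝓗 ind t r g ad c → c ∉ selected g bit →
    familyBound t r κ ≤ (selected g bit).card ∨ ∃ P ⊆ codeSet r g c, t < P.card ∧ P.card < r ∧
      (r * κ) ^ (r - 1 - P.card) ≤ ((selected g bit).filter (P ⊆ codeSet r g ·)).card

theorem selected_update {c : ℕ} (hc : c < g.N) :
    selected g (Function.update bit c 1) = insert c (selected g bit) := by
  ext d
  rw [selected, Finset.mem_filter, Finset.mem_insert, selected, Finset.mem_filter]
  by_cases h : d = c
  · subst h
    simp [hc]
  · simp [h]

/-- Acceptance tests exactly what the caps and the size bound require for the enlarged family. The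
numbers of supersets only grow, so the reason for an earlier rejection remains valid. -/
theorem SelectInv.step (hr : r ≤ g.m) {i : ℕ} (hi : i < g.N)
    (h : SelectInv 𝓗 ind t r g ad (min (rest 𝓗 ind t r g ad) g.N) i bit) :
    (Accept 𝓗 ind t r g ad bit i → SelectInv 𝓗 ind t r g ad (min (rest 𝓗 ind t r g ad) g.N) (i + 1)
      (Function.update bit i 1)) ∧
    (¬ Accept 𝓗 ind t r g ad bit i →
      SelectInv 𝓗 ind t r g ad (min (rest 𝓗 ind t r g ad) g.N) (i + 1) bit) := by
  classical
  set κ := min (rest 𝓗 ind t r g ad) g.N with hκ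
  constructor
  · rintro ⟨hbig, htotal, hacc⟩
    have htotal : (selected g bit).card < familyBound t r κ := by
      convert htotal using 2
      rw [selected]
    have hmono : ∀ P : Finset ℕ, ((selected g bit).filter (P ⊆ codeSet r g ·)).card ≤
        ((insert i (selected g bit)).filter (P ⊆ codeSet r g ·)).card := fun P =>
      Finset.card_le_card (Finset.filter_subset_filter _ (Finset.subset_insert _ _))
    have hcard := Finset.card_insert_le i (selected g bit)
    have hcard' := Finset.card_le_card (Finset.subset_insert i (selected g bit))
    refine ⟨?_, ?_, ?_, ?_, ?_⟩ <;> rw [selected_update hi]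
    · intro c hc
      rcases Finset.mem_insert.1 hc with rfl | hc
      · omega
      · have := h.lt c hc
        omega
    · intro c hc
      rcases Finset.mem_insert.1 hc with rfl | hc
      · exact hbig
      · exact h.isBig c hc
    · intro P hP hPr
      rw [Finset.filter_insert]
      split_ifs with hPi
      -- P lies in the accepted set, so it has a code, and the test for this code showed that the
      -- cap leaves room for one more member.
      · obtain ⟨p, hp, _, rfl⟩ := exists_code hr (hPi.trans (codeSet_subset_range r g i)) hPr.le
        have h1 := hacc p hp hPi
        have h2 : supersets r g bit p < (r * κ) ^ (r - 1 - (codeSet r g p).card) := by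
          by_contra! hcon
          exact h1 ⟨_, hPr, hP, rfl, hcon⟩
        rw [supersets_eq] at h2
        exact (Finset.card_insert_le _ _).trans h2
      · exact h.cap P hP hPr
    · omega
    · intro c hc hcbig hcs
      have hne : c ≠ i := fun e => hcs (e ▸ Finset.mem_insert_self _ _)
      rcases h.reject c (by omega) hcbig fun hc' => hcs (Finset.mem_insert_of_mem hc') with h1 | h1
      · left
        omega
      · right
        obtain ⟨P, h2, h3, h4, h5⟩ := h1
        exact ⟨P, h2, h3, h4, h5.trans (hmono P)⟩
  · intro hacc
    refine ⟨fun c hc => (h.lt c hc).trans (Nat.lt_succ_self i), h.isBig, h.cap, h.card_le, ?_⟩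
    intro c hc hcbig hcs
    rcases Nat.lt_succ_iff_lt_or_eq.1 hc with hc | rfl
    · exact h.reject c hc hcbig hcs
    by_contra! hcon
    refine hacc ⟨hcbig, ?_, ?_⟩
    · exact hcon.1
    · rintro p hp hsub ⟨j, hj, htj, hcj, hle⟩
      subst hcj
      have := hcon.2 _ hsub htj hj
      rw [supersets_eq, ← hκ] at hle
      omega

variable {μ : Mem}

theorem region_selectFamily (hr : r ≤ g.m) (h1 : region g μ 1 = fun _ => 0) :
    (∀ j, j ≠ 1 → region g (selectFamily 𝓗 ind t r g μ) j = region g μ j) ∧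
      SelectInv 𝓗 ind t r g (region g μ 0)
        (min (rest 𝓗 ind t r g (region g μ 0)) g.N) g.N
        (region g (selectFamily 𝓗 ind t r g μ) 1) := by
  rw [selectFamily]
  set F : ℕ → Mem → Mem := _ with hF
  suffices ∀ i ≤ g.N, (∀ j, j ≠ 1 → region g (iter F i μ) j = region g μ j) ∧
      SelectInv 𝓗 ind t r g (region g μ 0) (min (rest 𝓗 ind t r g (region g μ 0)) g.N) i
        (region g (iter F i μ) 1) from this g.N le_rfl
  intro i
  induction i with
  | zero =>
    intro _
    refine ⟨fun j _ => rfl, ?_⟩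
    have hs : selected g (region g μ 1) = ∅ := by
      rw [h1, selected]
      simp
    refine ⟨?_, ?_, ?_, ?_, ?_⟩ <;> simp [iter, hs]
  | succ i ih =>
    intro hi
    obtain ⟨ih1, ih2⟩ := ih (by omega)
    have e0 : region g (iter F i μ) 0 = region g μ 0 := ih1 0 (by omega)
    have hst := ih2.step hr (show i < g.N by omega)
    have hiter : iter F (i + 1) μ = F i (iter F i μ) := rfl
    rw [hiter, hF]
    dsimp only
    rw [← hF, e0]
    split_ifs with hacc
    · refine ⟨fun j hj => ?_, ?_⟩
      · rw [region_update_of_ne (by omega) hj, ih1 j hj]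
      · rw [region_update_self (by omega)]
        exact hst.1 hacc
    · exact ⟨ih1, hst.2 hacc⟩

/-- The selected sets. -/
noncomputable def selectedSets (r : ℕ) (g : Glob) (bit : ℕ → ℕ) : Finset (Finset ℕ) :=
  (selected g bit).image (codeSet r g)

theorem SelectInv.injOn {κ : ℕ} (h : SelectInv 𝓗 ind t r g ad κ g.N bit) :
    Set.InjOn (codeSet r g) (selected g bit) := by
  refine (IsCanonical.injOn r g).mono fun c hc => ?_
  exact ⟨h.lt c hc, (h.isBig c hc).1⟩

theorem SelectInv.isGreedy (hr : r ≤ g.m) (hmax : maxOrder 𝓗 ≤ r) (had : Represents g ad Γ)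
    {κ : ℕ} (h : SelectInv 𝓗 ind t r g ad κ g.N bit) :
    IsGreedy (IsBigSet 𝓗 ind t g Γ) t r κ (selectedSets r g bit) := by
  classical
  have hfilter : ∀ P : Finset ℕ, ((selectedSets r g bit).filter (P ⊆ ·)).card =
      ((selected g bit).filter (P ⊆ codeSet r g ·)).card := by
    intro P
    rw [selectedSets, Finset.filter_image, Finset.card_image_of_injOn]
    exact h.injOn.mono (by exact_mod_cast Finset.filter_subset _ _)
  have hcard : (selectedSets r g bit).card = (selected g bit).card :=
    Finset.card_image_of_injOn h.injOn
  refine ⟨?_, ?_, ?_⟩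
  · intro S hS
    obtain ⟨c, hc, rfl⟩ := Finset.mem_image.1 hS
    exact ((isBig_iff had c).1 (h.isBig c hc)).2
  · intro P hP hPr
    rw [hfilter]
    exact h.cap P hP hPr
  · intro S hS hSM
    obtain ⟨c, hc, hbig, rfl⟩ := hS.exists_isBig hr hmax had
    simp only [hfilter, hcard]
    exact h.reject c hc hbig fun hcs => hSM (Finset.mem_image_of_mem _ hcs)

theorem sup_selectedSets : (selectedSets r g bit).sup id = familyVerts r g bit := by
  classical
  ext u
  rw [Finset.mem_sup, familyVerts, Finset.mem_filter]
  constructor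
  · rintro ⟨S, hS, hu⟩
    obtain ⟨c, hc, rfl⟩ := Finset.mem_image.1 hS
    obtain ⟨h1, h2⟩ := Finset.mem_filter.1 hc
    exact ⟨codeSet_subset_range r g c hu, c, Finset.mem_range.1 h1, h2, hu⟩
  · rintro ⟨_, c, h1, h2, hu⟩
    exact ⟨_, Finset.mem_image_of_mem _ (Finset.mem_filter.2 ⟨Finset.mem_range.2 h1, h2⟩), hu⟩

/-! #### The auction -/

theorem iter_const {β : Type} (f : β → β) (m : ℕ) (x : β) : iter (fun _ => f) m x = f^[m] x := by
  induction m with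
  | zero => rfl
  | succ m ih => rw [Function.iterate_succ_apply', ← ih, iter]

theorem runAuction_eq (μ : Mem) :
    runAuction 𝓗 ind t r g μ = (auctionStep 𝓗 ind t r g)^[g.N * g.N] μ := by
  have : (fun μ => iter (fun _ μ => auctionStep 𝓗 ind t r g μ) g.N μ) =
      (auctionStep 𝓗 ind t r g)^[g.N] := funext fun μ => iter_const _ _ _
  rw [runAuction, this, iter_const, ← Function.iterate_mul]

theorem auctionStep_spec (μ : Mem) :
    (∀ j, j ≠ 2 → j ≠ 3 → region g (auctionStep 𝓗 ind t r g μ) j = region g μ j) ∧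
    ((∃ p u, MayBid 𝓗 ind t r g μ p u ∧
        auctionOf g (auctionStep 𝓗 ind t r g μ) = (auctionOf g μ).bid p u) ∨
      ((∀ p u, ¬ MayBid 𝓗 ind t r g μ p u) ∧
        auctionOf g (auctionStep 𝓗 ind t r g μ) = auctionOf g μ)) := by
  rw [auctionStep]
  split_ifs with h
  · obtain ⟨hp, hp'⟩ := least_spec h
    set p := least g.N fun p => ∃ u < g.n, MayBid 𝓗 ind t r g μ p u
    have hn := g.order_add_two_le
    have hex : ∃ u < g.N, MayBid 𝓗 ind t r g μ p u := by
      obtain ⟨u, hu, hb⟩ := hp'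
      exact ⟨u, by omega, hb⟩
    obtain ⟨hu, hu'⟩ := least_spec hex
    set u := least g.N fun u => MayBid 𝓗 ind t r g μ p u
    refine ⟨fun j h2 h3 => ?_, Or.inl ⟨p, u, hu', ?_⟩⟩
    · rw [region_update_of_ne hu h3, region_update_of_ne hu h2]
    · rw [auctionOf, region_update_of_ne hu (by omega), region_update_self hu,
        region_update_self hu, region_update_of_ne hu (by omega)]
      rfl
  · refine ⟨fun _ _ _ => rfl, Or.inr ⟨fun p u hb => h ?_, rfl⟩⟩
    exact ⟨p, hb.2.1.1.1, u, hb.2.1.1.2.2.2.2.1, hb⟩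

theorem runAuction_spec (h2 : region g μ 2 = fun _ => 0) (h3 : region g μ 3 = fun _ => 0) :
    (∀ j, j ≠ 2 → j ≠ 3 → region g (runAuction 𝓗 ind t r g μ) j = region g μ j) ∧
    Auction.Invariant (Wants 𝓗 ind t r g (region g μ 0) (region g μ 1)) (g.N + 1)
      (auctionOf g (runAuction 𝓗 ind t r g μ)) ∧
    ∀ p u, ¬ Auction.CanBid (Wants 𝓗 ind t r g (region g μ 0) (region g μ 1)) (g.N + 1)
      (auctionOf g (runAuction 𝓗 ind t r g μ)) p u := by
  rw [runAuction_eq]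
  have hreg : ∀ i j, j ≠ 2 → j ≠ 3 →
      region g ((auctionStep 𝓗 ind t r g)^[i] μ) j = region g μ j := by
    intro i j hj2 hj3
    induction i with
    | zero => rfl
    | succ i ih => rw [Function.iterate_succ_apply', (auctionStep_spec _).1 j hj2 hj3, ih]
  refine ⟨hreg _, ?_⟩
  refine Auction.final (adj := Wants 𝓗 ind t r g (region g μ 0) (region g μ 1)) (L := g.N + 1)
    g.n (g.N * g.N) (fun p u h => h.2.2.2.2.1) ?_
    (fun i => auctionOf g ((auctionStep 𝓗 ind t r g)^[i] μ)) ?_ ?_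
  -- The number N² of steps is enough: n(N+1) < N² because N ≥ n+2.
  · have := g.order_add_two_le
    nlinarith
  · change Auction.mk _ _ = _
    simp only [Function.iterate_zero, id, h2, h3]
  · intro i _
    have := (auctionStep_spec (𝓗 := 𝓗) (ind := ind) (t := t) (r := r) (g := g)
      ((auctionStep 𝓗 ind t r g)^[i] μ)).2
    simp only [MayBid, hreg i 0 (by omega) (by omega), hreg i 1 (by omega) (by omega)] at this
    simpa only [Function.iterate_succ_apply'] using this

open Classical in
/-- The bidders of the auction. -/
noncomputable def bidders (r : ℕ) (g : Glob) (bit : ℕ → ℕ) : Finset ℕ :=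
  (Finset.range g.N).filter fun p => IsCanonical r g p ∧ (codeSet r g p).card + 1 = r ∧
    ∃ c < g.N, bit c ≠ 0 ∧ codeSet r g p ⊆ codeSet r g c

theorem Wants.mem_bidders {p u : ℕ} (h : Wants 𝓗 ind t r g ad bit p u) : p ∈ bidders r g bit := by
  classical
  rw [bidders, Finset.mem_filter]
  exact ⟨Finset.mem_range.2 h.1, h.2.1, h.2.2.1, h.2.2.2.1⟩

/-- Different bidders code different sets, and a selected set, having at most r elements, has at
most r subsets of size r-1. -/
theorem card_bidders_le (hr : 0 < r) : (bidders r g bit).card ≤ r * (selected g bit).card := by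
  classical
  have hinj : Set.InjOn (codeSet r g) (bidders r g bit) :=
    (IsCanonical.injOn r g).mono fun p hp => by
      rw [bidders, Finset.mem_coe, Finset.mem_filter] at hp
      exact ⟨Finset.mem_range.1 hp.1, hp.2.1⟩
  rw [← Finset.card_image_of_injOn hinj]
  have hsub : (bidders r g bit).image (codeSet r g) ⊆
      (selected g bit).biUnion fun c => (codeSet r g c).powersetCard (r - 1) := by
    intro P hP
    obtain ⟨p, hp, rfl⟩ := Finset.mem_image.1 hP
    rw [bidders, Finset.mem_filter] at hp
    obtain ⟨_, _, h1, c, h2, h3, h4⟩ := hp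
    rw [Finset.mem_biUnion]
    refine ⟨c, Finset.mem_filter.2 ⟨Finset.mem_range.2 h2, h3⟩, ?_⟩
    rw [Finset.mem_powersetCard]
    exact ⟨h4, by omega⟩
  refine (Finset.card_le_card hsub).trans ?_
  rw [mul_comm]
  refine Finset.card_biUnion_le_card_mul _ _ _ fun c _ => ?_
  rw [Finset.card_powersetCard]
  refine (Nat.choose_le_choose _ (card_codeSet_le r g c)).trans ?_
  obtain ⟨s, rfl⟩ : ∃ s, r = s + 1 := ⟨r - 1, by omega⟩
  simp

theorem card_familyVerts_le : (familyVerts r g bit).card ≤ r * (selected g bit).card := by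
  classical
  have hsub : familyVerts r g bit ⊆ (selected g bit).biUnion (codeSet r g) := by
    intro u hu
    obtain ⟨_, c, h1, h2, h3⟩ := Finset.mem_filter.1 hu
    exact Finset.mem_biUnion.2 ⟨c, Finset.mem_filter.2 ⟨Finset.mem_range.2 h1, h2⟩, h3⟩
  refine (Finset.card_le_card hsub).trans ?_
  rw [mul_comm]
  exact Finset.card_biUnion_le_card_mul _ _ _ fun c _ => card_codeSet_le r g c

/-- The end of the auction gives a crown. -/
theorem exists_isCrown (hr : r ≤ g.m) (hmax : maxOrder 𝓗 ≤ r) (had : Represents g ad Γ)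
    {s : Auction} (hinv : Auction.Invariant (Wants 𝓗 ind t r g ad bit) (g.N + 1) s)
    (hno : ∀ p u, ¬ Auction.CanBid (Wants 𝓗 ind t r g ad bit) (g.N + 1) s p u) :
    ∃ A m, IsCrown (IsBigSet 𝓗 ind t g Γ) r (selectedSets r g bit)
      (familyVerts r g bit ∪ s.sold g.n) A m := by
  classical
  -- Bidders are codes below `N`, so the label bound `N + 1` exceeds their number.
  obtain ⟨A, m, hA, hinj, hun⟩ := hinv.exists_crown hno (n := g.n) (fun p u h => h.2.2.2.2.1)
    (fun p u h => h.mem_bidders) (Nat.lt_succ_of_le ((Finset.card_filter_le _ _).trans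
      (Finset.card_range g.N).le))
  have hcode : Set.InjOn (codeSet r g) A := by
    refine (IsCanonical.injOn r g).mono fun p hp => ?_
    exact ⟨(hA p hp).1.1, (hA p hp).1.2.1⟩
  have hleft : ∀ p ∈ A, Function.invFunOn (codeSet r g) A (codeSet r g p) = p := fun p hp =>
    hcode.leftInvOn_invFunOn hp
  -- The auction deals with codes, the crown with sets; `codeSet` is injective on canonical codes
  -- and is inverted there.
  refine ⟨codeSet r g '' A, m ∘ Function.invFunOn (codeSet r g) A, ?_, ?_, ?_, ?_⟩
  · rw [sup_selectedSets]
    exact Finset.subset_union_left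
  · rintro _ ⟨p, hp, rfl⟩
    rw [Function.comp_apply, hleft p hp, sup_selectedSets]
    obtain ⟨⟨h1, h2, h3, ⟨d, h4, h5, h6⟩, h7, h8, c, h9, h10, h11, h12⟩, h13⟩ := hA p hp
    refine ⟨Finset.mem_union_right _ h13, h8, ?_⟩
    have hnot : m p ∉ codeSet r g p := fun h => h8 (Finset.mem_filter.2
      ⟨Finset.mem_range.2 h7, d, h4, h5, h6 h⟩)
    -- The left side has exactly r elements and lies in a coded set, which has at most r.
    have heq : insert (m p) (codeSet r g p) = codeSet r g c := by
      refine Finset.eq_of_subset_of_card_le (Finset.insert_subset h12 h11) ?_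
      rw [Finset.card_insert_of_notMem hnot, h3]
      exact card_codeSet_le r g c
    rw [heq]
    exact ((isBig_iff had c).1 h10).2
  · rintro _ ⟨p, hp, rfl⟩ _ ⟨q, hq, rfl⟩ h
    rw [Function.comp_apply, Function.comp_apply, hleft p hp, hleft q hq] at h
    rw [hinj hp hq h]
  · rintro P u hPr ⟨T, hT, hPT⟩ hPA hu hE
    obtain ⟨d, hd, rfl⟩ := Finset.mem_image.1 hT
    obtain ⟨hd1, hd2⟩ := Finset.mem_filter.1 hd
    obtain ⟨p, hp, hpc, rfl⟩ := exists_code hr (hPT.trans (codeSet_subset_range r g d))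
      (show P.card ≤ r by omega)
    rw [sup_selectedSets] at hu
    obtain ⟨c, hc1, hc2, hc3⟩ := hE.exists_isBig hr hmax had
    have hw : Wants 𝓗 ind t r g ad bit p u :=
      ⟨hp, hpc, hPr, ⟨d, Finset.mem_range.1 hd1, hd2, hPT⟩,
        Finset.mem_range.1 (hE.1 (Finset.mem_insert_self _ _)), hu, c, hc1, hc2,
        hc3 ▸ Finset.subset_insert _ _, hc3 ▸ Finset.mem_insert_self _ _⟩
    obtain ⟨h1, h2⟩ := hun p u hw fun hpA => hPA ⟨p, hpA, rfl⟩
    refine ⟨Finset.mem_union_right _ h1, ?_⟩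
    rintro _ ⟨q, hq, rfl⟩
    rw [Function.comp_apply, hleft q hq]
    exact h2 q hq

end Spec

end OverlapPacking

namespace OverlapPacking

section Spec

variable {𝓗 : Finset FinGraph} {ind : Prop} {t r : ℕ} {g : Glob} {Γ : SimpleGraph ℕ} {μ : Mem}

/-! #### The output -/

theorem keptSet_congr {μ μ' : Mem} (h : ∀ j < 3, region g μ j = region g μ' j) :
    keptSet 𝓗 ind t r g μ = keptSet 𝓗 ind t r g μ' := by
  rw [keptSet, keptSet, h 0 (by omega), h 1 (by omega), h 2 (by omega)]

theorem newParam_congr {μ μ' : Mem} (h : ∀ j < 3, region g μ j = region g μ' j) :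
    newParam 𝓗 ind t r g μ = newParam 𝓗 ind t r g μ' := by
  rw [newParam, newParam, keptSet_congr h, h 0 (by omega)]

theorem writeNumbers_spec (μ : Mem) :
    (∀ j < 5, region g (writeNumbers 𝓗 ind t r g μ) j = region g μ j) ∧
    region g (writeNumbers 𝓗 ind t r g μ) 5 0 = (keptSet 𝓗 ind t r g μ).card ∧
    region g (writeNumbers 𝓗 ind t r g μ) 5 1 = newParam 𝓗 ind t r g μ := by
  have h0 : 0 < g.N := by have := g.order_add_two_le; omega
  have h1 : 1 < g.N := by have := g.order_add_two_le; omega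
  rw [writeNumbers]
  refine ⟨fun j hj => ?_, ?_, ?_⟩
  · rw [region_update_of_ne h1 (by omega), region_update_of_ne h0 (by omega)]
  · rw [region_update_self h1, Function.update_of_ne (by omega), region_update_self h0,
      Function.update_self]
  · rw [region_update_self h1, Function.update_self]
    exact newParam_congr fun j hj => region_update_of_ne h0 (by omega)

open Classical in
theorem writeMatrix_spec (μ : Mem) :
    region g (writeMatrix 𝓗 ind t r g μ) 5 = region g μ 5 ∧
    ∀ a < g.N, writeMatrix 𝓗 ind t r g μ a =
      if IsEntry g (region g μ 0) (keptSet 𝓗 ind t r g μ) a then 1 else 0 := by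
  set F : ℕ → Mem → Mem := fun a μ => Function.update μ (4 * g.N + a)
    (if IsEntry g (region g μ 0) (keptSet 𝓗 ind t r g μ) a then 1 else 0) with hF
  have h1 : ∀ i ≤ g.N, (∀ j, j ≠ 4 → region g (iter F i μ) j = region g μ j) ∧
      ∀ a < i, region g (iter F i μ) 4 a =
        if IsEntry g (region g μ 0) (keptSet 𝓗 ind t r g μ) a then 1 else 0 := by
    intro i
    induction i with
    | zero => exact fun _ => ⟨fun _ _ => rfl, by simp⟩
    | succ i ih =>
      intro hi
      obtain ⟨ih1, ih2⟩ := ih (by omega)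
      have hiter : iter F (i + 1) μ = Function.update (iter F i μ) (4 * g.N + i)
          (if IsEntry g (region g μ 0) (keptSet 𝓗 ind t r g μ) i then 1 else 0) := by
        rw [iter, hF]
        dsimp only
        -- So far only region 4 has changed, so the entries are still those of the initial memory.
        rw [← hF, ih1 0 (by omega), keptSet_congr fun j hj => ih1 j (by omega)]
      rw [hiter]
      refine ⟨fun j hj => ?_, fun a ha => ?_⟩
      · rw [region_update_of_ne (by omega) hj, ih1 j hj]
      · rw [region_update_self (by omega)]
        by_cases hai : a = i
        · rw [hai, Function.update_self]
        · rw [Function.update_of_ne hai, ih2 a (by omega)]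
  set F' : ℕ → Mem → Mem := fun a μ => Function.update μ a (region g μ 4 a) with hF'
  have h2 : ∀ μ, ∀ i ≤ g.N, (∀ j, j ≠ 0 → region g (iter F' i μ) j = region g μ j) ∧
      ∀ a < i, iter F' i μ a = region g μ 4 a := by
    intro μ i
    induction i with
    | zero => exact fun _ => ⟨fun _ _ => rfl, by simp⟩
    | succ i ih =>
      intro hi
      obtain ⟨ih1, ih2⟩ := ih (by omega)
      have hiter : iter F' (i + 1) μ =
          Function.update (iter F' i μ) i (region g μ 4 i) := by
        rw [iter, hF']
        dsimp only
        rw [← hF', ih1 4 (by omega)]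
      rw [hiter]
      refine ⟨fun j hj => ?_, fun a ha => ?_⟩
      · have := region_update_of_ne (g := g) (μ := iter F' i μ) (a := i)
          (v := region g μ 4 i) (by omega) hj
        rw [zero_mul, zero_add] at this
        rw [this, ih1 j hj]
      · by_cases hai : a = i
        · rw [hai, Function.update_self]
        · rw [Function.update_of_ne hai, ih2 a (by omega)]
  have hw : writeMatrix 𝓗 ind t r g μ = iter F' g.N (iter F g.N μ) := rfl
  rw [hw]
  refine ⟨?_, fun a ha => ?_⟩
  · rw [(h2 _ _ le_rfl).1 5 (by omega), (h1 _ le_rfl).1 5 (by omega)]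
  · rw [(h2 _ _ le_rfl).2 a ha, (h1 _ le_rfl).2 a ha]

/-! ### Enumeration of the kept vertices and the induced instance -/

/-- Number `i` of the elements of `W`. -/
noncomputable def element (W : Finset ℕ) (i : ℕ) : ℕ := Nat.nth (· ∈ W) i

theorem element_mem {W : Finset ℕ} {i : ℕ} (hi : i < W.card) : element W i ∈ W := by
  refine Nat.nth_mem i fun hf => ?_
  have : hf.toFinset = W := by
    ext u
    simp
  rwa [this]

theorem rank_eq_count (W : Finset ℕ) (u : ℕ) : rank W u = Nat.count (· ∈ W) u := by
  rw [rank, Nat.count_eq_card_filter_range]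
  congr 1
  ext v
  simp [and_comm]

theorem element_rank {W : Finset ℕ} {u : ℕ} (hu : u ∈ W) : element W (rank W u) = u := by
  rw [element, rank_eq_count]
  exact Nat.nth_count hu

theorem rank_element {W : Finset ℕ} {i : ℕ} (hi : i < W.card) : rank W (element W i) = i := by
  rw [element, rank_eq_count]
  refine Nat.count_nth fun hf => ?_
  have : hf.toFinset = W := by
    ext u
    simp
  rwa [this]

theorem rank_lt {W : Finset ℕ} {u : ℕ} (hu : u ∈ W) : rank W u < W.card := by
  refine Finset.card_lt_card ((Finset.ssubset_iff_of_subset (Finset.filter_subset _ _)).2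
    ⟨u, hu, ?_⟩)
  simp

theorem element_injOn (W : Finset ℕ) : Set.InjOn (element W) (Finset.range W.card) := by
  intro i hi j hj h
  rw [← rank_element (Finset.mem_range.1 hi), h, rank_element (Finset.mem_range.1 hj)]

theorem image_element (W : Finset ℕ) : (Finset.range W.card).image (element W) = W := by
  ext u
  rw [Finset.mem_image]
  constructor
  · rintro ⟨i, hi, rfl⟩
    exact element_mem (Finset.mem_range.1 hi)
  · exact fun hu => ⟨rank W u, Finset.mem_range.2 (rank_lt hu), element_rank hu⟩

theorem isEntry_iff {ad : ℕ → ℕ} (had : Represents g ad Γ) {W : Finset ℕ}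
    (hW : W ⊆ Finset.range g.n) {i j : ℕ} (hi : i < W.card) (hj : j < W.card) :
    IsEntry g ad W (i * W.card + j) ↔ Γ.Adj (element W i) (element W j) := by
  have hlt : ∀ u ∈ W, u < g.n := fun u hu => Finset.mem_range.1 (hW hu)
  constructor
  · rintro ⟨u, hu, v, hv, huW, hvW, h, he⟩
    have h1 := rank_lt huW
    have h2 := rank_lt hvW
    have h3 : rank W v = j := by
      have := congrArg (· % W.card) he
      simpa [Nat.mul_add_mod_self_right, Nat.mod_eq_of_lt h2, Nat.mod_eq_of_lt hj] using this
    have h4 : rank W u = i := by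
      rw [h3] at he
      exact Nat.eq_of_mul_eq_mul_right (show 0 < W.card by omega) (by omega)
    rw [← h4, ← h3, element_rank huW, element_rank hvW]
    exact (had u hu v hv).1 h
  · intro h
    have hiW := element_mem hi
    have hjW := element_mem hj
    refine ⟨_, hlt _ hiW, _, hlt _ hjW, hiW, hjW, (had _ (hlt _ hiW) _ (hlt _ hjW)).2 h, ?_⟩
    rw [rank_element hi, rank_element hj]

/-- The instance given by the induced subgraph on `W`, with renamed vertices. -/
noncomputable def inducedInstance (Γ : SimpleGraph ℕ) (W : Finset ℕ) (k : ℕ) : PackInstance where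
  order := W.card
  graph := Γ.comap fun i : Fin W.card => element W i
  k := k

theorem packing_inducedInstance (t : ℕ) (Γ : SimpleGraph ℕ) (W : Finset ℕ) (k : ℕ) :
    Packing 𝓗 ind t (inducedInstance Γ W k) ↔
      SetPacking 𝓗 ind t Γ W (k - smallCount 𝓗 ind t Γ W) :=
  packing_iff_of_image (I := inducedInstance Γ W k) (element_injOn W) (image_element W)
    fun _ _ => Iff.rfl

theorem setPacking_zero (t : ℕ) (Γ : SimpleGraph ℕ) (W : Finset ℕ) : SetPacking 𝓗 ind t Γ W 0 :=
  ⟨∅, by simp, by simp, by simp⟩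

theorem not_setPacking_empty {m : ℕ} (hm : 0 < m) : ¬ SetPacking 𝓗 ind t Γ ∅ m := by
  rintro ⟨𝒬, h1, h2, _⟩
  obtain ⟨S, hS⟩ := Finset.card_pos.1 (hm.trans_le h1)
  obtain ⟨h3, h4, _⟩ := h2 S hS
  rw [Finset.subset_empty.1 h3] at h4
  simp at h4

theorem setPacking_iff {m : ℕ} {W : Finset ℕ} (hW : W ⊆ Finset.range g.n) :
    SetPacking 𝓗 ind t Γ W m ↔ ∃ 𝒬 : Finset (Finset ℕ), m ≤ 𝒬.card ∧
      (∀ S ∈ 𝒬, IsBigSet 𝓗 ind t g Γ S ∧ S ⊆ W) ∧ SmallOverlap t 𝒬 := by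
  refine exists_congr fun 𝒬 => and_congr_right fun _ => and_congr_left fun _ =>
    forall₂_congr fun S _ => ?_
  constructor
  · exact fun h => ⟨⟨h.1.trans hW, h.2⟩, h.1⟩
  · exact fun h => ⟨h.2, h.1.2⟩

/-- The number of big sets is at most the loop length. -/
theorem SetPacking.le (hr : r ≤ g.m) (hmax : maxOrder 𝓗 ≤ r) {m : ℕ}
    (h : SetPacking 𝓗 ind t Γ (Finset.range g.n) m) : m ≤ g.N := by
  obtain ⟨𝒬, h1, h2, _⟩ := h
  refine h1.trans ?_
  have hsub : 𝒬 ⊆ (Finset.range g.N).image (codeSet r g) := by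
    intro S hS
    obtain ⟨h3, _, h5⟩ := h2 S hS
    obtain ⟨c, hc, _, rfl⟩ := exists_code hr h3 ((card_le_of_weight_ne_zero 𝓗 ind h5).trans hmax)
    exact Finset.mem_image_of_mem _ (Finset.mem_range.2 hc)
  exact (Finset.card_le_card hsub).trans (Finset.card_image_le.trans (Finset.card_range _).le)

/-- What the algorithm achieves. -/
theorem kernelize_spec (hr : r ≤ g.m) (hmax : maxOrder 𝓗 ≤ r) (htr : t + 2 ≤ r)
    (had : Represents g (region g μ 0) Γ) (h1 : region g μ 1 = fun _ => 0)
    (h2 : region g μ 2 = fun _ => 0) (h3 : region g μ 3 = fun _ => 0) :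
    ∃ (W : Finset ℕ) (k' : ℕ),
      (region g (kernelize 𝓗 ind t r g μ) 5 0 = W.card ∧
        region g (kernelize 𝓗 ind t r g μ) 5 1 = k' ∧
        ∀ i < W.card, ∀ j < W.card, (kernelize 𝓗 ind t r g μ (i * W.card + j) = 1 ∧
          Γ.Adj (element W i) (element W j)) ∨ (kernelize 𝓗 ind t r g μ (i * W.card + j) = 0 ∧
          ¬ Γ.Adj (element W i) (element W j))) ∧
      (SetPacking 𝓗 ind t Γ W (k' - smallCount 𝓗 ind t Γ W) ↔
        SetPacking 𝓗 ind t Γ (Finset.range g.n)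
          (g.k - smallCount 𝓗 ind t Γ (Finset.range g.n))) ∧
      k' ≤ g.k ∧ W.card ≤ 2 * (r ^ r * g.k ^ (r - t - 1)) := by
  classical
  set μ₁ := selectFamily 𝓗 ind t r g μ with hμ₁
  set μ₂ := runAuction 𝓗 ind t r g μ₁ with hμ₂
  set ad := region g μ 0 with hadd
  set κ := rest 𝓗 ind t r g ad with hκ
  obtain ⟨hs1, hs2⟩ := region_selectFamily (𝓗 := 𝓗) (ind := ind) (t := t) hr h1
  rw [← hμ₁] at hs1 hs2
  obtain ⟨hu1, hu2, hu3⟩ := runAuction_spec (𝓗 := 𝓗) (ind := ind) (t := t) (r := r)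
    ((hs1 2 (by omega)).trans h2) ((hs1 3 (by omega)).trans h3)
  rw [hs1 0 (by omega)] at hu2 hu3
  rw [← hμ₂] at hu1 hu2 hu3
  have e0 : region g μ₂ 0 = ad := (hu1 0 (by omega) (by omega)).trans (hs1 0 (by omega))
  have e1 : region g μ₂ 1 = region g μ₁ 1 := hu1 1 (by omega) (by omega)
  set W := keptSet 𝓗 ind t r g μ₂ with hW
  obtain ⟨hn1, hn2, hn3⟩ := writeNumbers_spec (𝓗 := 𝓗) (ind := ind) (t := t) (r := r)
    (g := g) μ₂
  obtain ⟨hm1, hm2⟩ := writeMatrix_spec (𝓗 := 𝓗) (ind := ind) (t := t) (r := r) (g := g)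
    (writeNumbers 𝓗 ind t r g μ₂)
  have hker : kernelize 𝓗 ind t r g μ =
      writeMatrix 𝓗 ind t r g (writeNumbers 𝓗 ind t r g μ₂) := rfl
  rw [← hker] at hm1 hm2
  rw [hn1 0 (by omega), e0, keptSet_congr fun j hj => hn1 j (by omega), ← hW] at hm2
  have hWn : W ⊆ Finset.range g.n := (compF_keptSet (α := Glob) 𝓗 ind).subset_range g μ₂
  have hWcard : W.card ≤ g.n := (Finset.card_le_card hWn).trans (Finset.card_range _).le
  have hκ' : κ = g.k - smallCount 𝓗 ind t Γ (Finset.range g.n) := by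
    rw [hκ, rest, smallSum_eq hr (by omega) had (Finset.Subset.refl _)]
  have hparam : newParam 𝓗 ind t r g μ₂ = if κ = 0 then 0 else if g.N < κ then g.k
      else κ + smallCount 𝓗 ind t Γ W := by
    rw [newParam, e0, ← hW, smallSum_eq hr (by omega) had hWn]
  have hkept : W = if κ = 0 ∨ g.N < κ then ∅ else (Finset.range g.n).filter fun u =>
      u ∈ familyVerts r g (region g μ₁ 1) ∨ region g μ₂ 2 u ≠ 0 := by
    rw [hW, keptSet, e0, e1]
  refine ⟨W, newParam 𝓗 ind t r g μ₂, ⟨by rw [hm1, hn2], by rw [hm1, hn3],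
    fun i hi j hj => ?_⟩, ?_⟩
  · have hlt : i * W.card + j < g.N := by
      have hN : g.n * g.n ≤ g.N := by
        calc g.n * g.n ≤ (g.n + 2) ^ 2 := by nlinarith
          _ ≤ g.N := Nat.pow_le_pow_right (by omega) (by omega)
      calc i * W.card + j < (i + 1) * W.card := by rw [Nat.succ_mul]; omega
        _ ≤ g.n * g.n := Nat.mul_le_mul (by omega) hWcard
        _ ≤ g.N := hN
    rw [hm2 _ hlt]
    have := isEntry_iff had hWn hi hj
    by_cases hadj : Γ.Adj (element W i) (element W j)
    · left
      exact ⟨if_pos (this.2 hadj), hadj⟩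
    · right
      exact ⟨if_neg fun h => hadj (this.1 h), hadj⟩
  rw [hparam]
  rw [← hκ']
  -- If κ = 0, the small subgraphs alone answer yes, and the output is the empty graph with
  -- parameter `0`.
  by_cases hzero : κ = 0
  · rw [if_pos hzero, hkept, if_pos (Or.inl hzero), hzero]
    exact ⟨by simp [setPacking_zero], by omega, by simp⟩
  rw [if_neg hzero]
  -- No packing has more than `N` big sets, so the input is a no-instance. So is the empty graph
  -- with the old parameter: it has no big sets and at most as many small subgraphs as the input,
  -- hence still too few.
  by_cases hbig : g.N < κ
  · rw [if_pos hbig, hkept, if_pos (Or.inr hbig)]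
    refine ⟨iff_of_false (not_setPacking_empty ?_) fun h => ?_, le_rfl, by simp⟩
    · have : smallCount 𝓗 ind t Γ ∅ ≤ smallCount 𝓗 ind t Γ (Finset.range g.n) :=
        smallCount_mono (Finset.empty_subset _)
      omega
    · have := h.le hr hmax
      omega
  rw [if_neg hbig]
  have hmin : min κ g.N = κ := min_eq_left (not_lt.1 hbig)
  rw [hmin] at hs2
  rw [if_neg (by tauto)] at hkept
  have hW' : W = familyVerts r g (region g μ₁ 1) ∪ (auctionOf g μ₂).sold g.n := by
    rw [hkept]
    ext u
    rw [Finset.mem_filter, Finset.mem_union, Auction.sold, Finset.mem_filter]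
    constructor
    · rintro ⟨h, h' | h'⟩
      · exact Or.inl h'
      · exact Or.inr ⟨h, h'⟩
    · rintro (h | h)
      · exact ⟨Finset.filter_subset _ _ h, Or.inl h⟩
      · exact ⟨h.1, Or.inr h.2⟩
  have hE : ∀ S, IsBigSet 𝓗 ind t g Γ S → t < S.card ∧ S.card ≤ r := fun S hS =>
    ⟨hS.2.1, hS.card_le.trans hmax⟩
  have hgreedy := hs2.isGreedy hr hmax had
  obtain ⟨A, m, hcrown⟩ := exists_isCrown hr hmax had hu2 hu3
  rw [← hW'] at hcrown
  refine ⟨?_, ?_, ?_⟩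
  -- The new parameter is κ plus the number of small subgraphs inside `W`; exactly κ big sets are
  -- again required.
  · rw [Nat.add_sub_cancel]
    refine ⟨fun h => h.mono hWn le_rfl, fun h => ?_⟩
    obtain ⟨𝒬, hq1, hq2, hq3⟩ := (setPacking_iff (g := g) (Finset.Subset.refl _)).1 h
    exact (setPacking_iff (g := g) hWn).2 (exists_packing_in_kernel hE htr
      (Nat.pos_of_ne_zero hzero) hgreedy hcrown hq1 (fun S hS => (hq2 S hS).1) hq3)
  · have : smallCount 𝓗 ind t Γ W ≤ smallCount 𝓗 ind t Γ (Finset.range g.n) := smallCount_mono hWn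
    omega
  -- The union of the family and the set of sold vertices each have at most r|M| ≤ r^r κ^(r-t-1)
  -- elements, and κ ≤ k. This is where the factor 2 comes from.
  · have hc1 := hu2.card_sold_le g.n fun p u h => h.mem_bidders
    have hc2 := card_bidders_le (g := g) (bit := region g μ₁ 1) (show 0 < r by omega)
    have hc3 := card_familyVerts_le (r := r) (g := g) (bit := region g μ₁ 1)
    have hc4 := Nat.mul_le_mul_left r hs2.card_le
    have hc5 := Finset.card_union_le (familyVerts r g (region g μ₁ 1)) ((auctionOf g μ₂).sold g.n)
    rw [← hW'] at hc5
    have hc6 : r * familyBound t r κ ≤ r ^ r * g.k ^ (r - t - 1) := by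
      rw [familyBound, ← mul_assoc, ← pow_succ', Nat.sub_add_cancel (by omega)]
      exact Nat.mul_le_mul_left _ (Nat.pow_le_pow_left (by omega) _)
    omega

end Spec

end OverlapPacking

namespace OverlapPacking

/-! ### The kernels -/

section Kernel

variable {𝓗 : Finset FinGraph} {ind : Prop} {t r : ℕ}

theorem PackInstance.order_sq_le_bound {m : ℕ} (hm : 1 ≤ m) (I : PackInstance) :
    I.order * I.order ≤ (I.glob m).N :=
  calc I.order * I.order ≤ (I.order + 2) ^ 2 := by nlinarith
    _ ≤ (I.order + 2) ^ (m + 1) := Nat.pow_le_pow_right (by omega) (by omega)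

theorem mul_add_lt_sq {n u v : ℕ} (hu : u < n) (hv : v < n) : u * n + v < n * n :=
  calc u * n + v < (u + 1) * n := by rw [Nat.succ_mul]; omega
    _ ≤ n * n := Nat.mul_le_mul_right _ hu

theorem represents_initState {m : ℕ} (hm : 1 ≤ m) (I : PackInstance) :
    Represents (I.glob m) (region (I.glob m) I.initState.mem 0) (natGraph I.graph) := by
  intro u hu v hv
  have hu : u < I.order := hu
  have hv : v < I.order := hv
  have hlt := (mul_add_lt_sq hu hv).trans_le (I.order_sq_le_bound hm)
  change region (I.glob m) I.initState.mem 0 (u * I.order + v) ≠ 0 ↔ _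
  rw [region, if_pos hlt, zero_mul, zero_add, natGraph_adj hu hv]
  simp only [PackInstance.initState, ne_eq, ite_eq_right_iff, one_ne_zero, imp_false, not_not]
  constructor
  · rintro ⟨i, j, h, hadj⟩
    have hv' : v = j.val := by
      have := congrArg (· % I.order) h
      simpa [Nat.mul_add_mod_self_right, Nat.mod_eq_of_lt hv, Nat.mod_eq_of_lt j.isLt] using this
    have hu' : u = i.val := by
      rw [hv'] at h
      exact Nat.eq_of_mul_eq_mul_right (show 0 < I.order by omega) (by omega)
    subst hv' hu'
    exact hadj
  · exact fun h => ⟨_, _, rfl, h⟩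

theorem region_initState {m j : ℕ} (hm : 1 ≤ m) (hj : 1 ≤ j) (I : PackInstance) :
    region (I.glob m) I.initState.mem j = fun _ => 0 := by
  ext a
  rw [region]
  split_ifs with ha
  · refine if_neg ?_
    rintro ⟨i, i', h, _⟩
    have h1 := mul_add_lt_sq i.isLt i'.isLt
    have h2 := I.order_sq_le_bound hm
    have h3 := Nat.mul_le_mul_right (I.glob m).N hj
    omega
  · rfl

/-- A computable choice of a vertex set and a parameter which preserve the answer gives a
kernel. -/
theorem hasVertexKernel_of_comp (m : ℕ) {B : ℕ → ℕ} {F : Glob → Mem → Mem} (hF : CompS F)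
    {fN fK : Glob → Mem → ℕ} (hN : Comp fN) (hK : Comp fK)
    (h : ∀ I : PackInstance, ∃ (W : Finset ℕ) (k' : ℕ),
      (fN (I.glob m) (F (I.glob m) I.initState.mem) = W.card ∧
        fK (I.glob m) (F (I.glob m) I.initState.mem) = k' ∧
        ∀ i < W.card, ∀ j < W.card,
          (F (I.glob m) I.initState.mem (i * W.card + j) = 1 ∧
            (natGraph I.graph).Adj (element W i) (element W j)) ∨
          (F (I.glob m) I.initState.mem (i * W.card + j) = 0 ∧
            ¬ (natGraph I.graph).Adj (element W i) (element W j))) ∧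
      (SetPacking 𝓗 ind t (natGraph I.graph) W (k' - smallCount 𝓗 ind t (natGraph I.graph) W) ↔
        SetPacking 𝓗 ind t (natGraph I.graph) (Finset.range I.order)
          (I.k - smallCount 𝓗 ind t (natGraph I.graph) (Finset.range I.order))) ∧
      k' ≤ I.k ∧ W.card ≤ B I.k) :
    HasVertexKernel (Packing 𝓗 ind t) B := by
  choose W k' hout hiff hk hcard using h
  refine ⟨fun I => inducedInstance (natGraph I.graph) (W I) (k' I),
    polyTimeComputable_of_comp m hF hN hK fun I => ⟨(hout I).1, (hout I).2.1, fun i j => ?_⟩,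
    fun I => ⟨?_, hk I, hcard I⟩⟩
  · rcases (hout I).2.2 i.val i.isLt j.val j.isLt with ⟨h1, h2⟩ | ⟨h1, h2⟩
    · exact h1.trans (if_pos h2).symm
    · exact h1.trans (if_neg h2).symm
  · rw [packing_inducedInstance, packing_iff, hiff]

/-- Big sets now all have exactly t+1 elements, so two different ones share at most `t`. All of them
together form a packing, and only their number matters. -/
theorem setPacking_iff_card_isBig {g : Glob} {ad : ℕ → ℕ} {Γ : SimpleGraph ℕ} (hr : r ≤ g.m)
    (hmax : maxOrder 𝓗 ≤ r) (htr : r ≤ t + 1) (had : Represents g ad Γ) (κ : ℕ)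
    {dec : ∀ c, Decidable (IsBig 𝓗 ind t r g ad c)} :
    SetPacking 𝓗 ind t Γ (Finset.range g.n) κ ↔
      κ ≤ ((Finset.range g.N).filter fun c => IsBig 𝓗 ind t r g ad c).card := by
  classical
  rw [setPacking_iff (Finset.Subset.refl _)]
  set D := (Finset.range g.N).filter fun c => IsBig 𝓗 ind t r g ad c with hD
  constructor
  · rintro ⟨𝒬, h1, h2, _⟩
    refine h1.trans ((Finset.card_le_card ?_).trans
      (Finset.card_image_le (s := D) (f := codeSet r g)))
    intro S hS
    obtain ⟨c, hc, hbig, rfl⟩ := (h2 S hS).1.exists_isBig hr hmax had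
    exact Finset.mem_image_of_mem _ (Finset.mem_filter.2 ⟨Finset.mem_range.2 hc, hbig⟩)
  · intro h
    have hinj : Set.InjOn (codeSet r g) D := (IsCanonical.injOn r g).mono fun c hc => by
      rw [hD, Finset.mem_coe, Finset.mem_filter] at hc
      exact ⟨Finset.mem_range.1 hc.1, hc.2.1⟩
    have hbig : ∀ S ∈ D.image (codeSet r g), IsBigSet 𝓗 ind t g Γ S := by
      intro S hS
      obtain ⟨c, hc, rfl⟩ := Finset.mem_image.1 hS
      exact ((isBig_iff had c).1 (Finset.mem_filter.1 hc).2).2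
    refine ⟨D.image (codeSet r g), by rwa [Finset.card_image_of_injOn hinj], fun S hS =>
      ⟨hbig S hS, (hbig S hS).1⟩, fun S hS T hT hne => ?_⟩
    by_contra! hlt
    have hS' := (hbig S hS).card_le.trans (hmax.trans htr)
    have hT' := (hbig T hT).card_le.trans (hmax.trans htr)
    exact hne ((Finset.eq_of_subset_of_card_le Finset.inter_subset_left (by omega)).symm.trans
      (Finset.eq_of_subset_of_card_le Finset.inter_subset_right (by omega)))

-- In this case the problem is decided in polynomial time. The output is the empty graph, with
-- parameter `0` for yes and the old parameter for no, so any bound `B` is respected.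
open Classical in
theorem hasVertexKernel_of_eq (hmax : maxOrder 𝓗 ≤ r) (h1 : 1 ≤ r) (htr : r = t + 1)
    (B : ℕ → ℕ) : HasVertexKernel (Packing 𝓗 ind t) B := by
  have hrest : Comp (fun (g : Glob) μ => rest 𝓗 ind t r g (region g μ 0)) := comp_rest 𝓗 ind
  have hcount : Comp (fun (g : Glob) μ =>
      ((Finset.range g.N).filter fun c => IsBig 𝓗 ind t r g (region g μ 0) c).card) :=
    Comp.count (P := fun g c μ => IsBig 𝓗 ind t r g (region g μ 0) c) (compP_isBig 𝓗 ind Comp.snd)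
  have hle := CompP.le hrest hcount
  have hk : Comp (fun (g : Glob) μ => if rest 𝓗 ind t r g (region g μ 0) ≤
      ((Finset.range g.N).filter fun c => IsBig 𝓗 ind t r g (region g μ 0) c).card then 0
      else g.k) := Comp.ite hle (Comp.const 0) Comp.param
  refine hasVertexKernel_of_comp r CompS.id (Comp.const 0) hk fun I =>
    ⟨∅, _, ⟨by simp, rfl, by simp⟩,
    ?_, ?_, by simp⟩
  · have had := represents_initState h1 I
    have key := setPacking_iff_card_isBig (r := r) (ind := ind) (g := I.glob r)
      le_rfl hmax htr.le had
      (rest 𝓗 ind t r (I.glob r) (region (I.glob r) I.initState.mem 0))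
      (dec := fun _ => Classical.propDecidable _)
    have hre : rest 𝓗 ind t r (I.glob r) (region (I.glob r) I.initState.mem 0) = I.k -
        smallCount 𝓗 ind t (natGraph I.graph) (Finset.range I.order) := by
      rw [rest, smallSum_eq (r := r) le_rfl (by omega) had (Finset.Subset.refl _)]
      rfl
    have hmono : smallCount 𝓗 ind t (natGraph I.graph) ∅ ≤
      smallCount 𝓗 ind t (natGraph I.graph) (Finset.range I.order) :=
      smallCount_mono (Finset.empty_subset _)
    split_ifs with hc
    · rw [Nat.zero_sub, ← hre]
      exact iff_of_true (setPacking_zero _ _ _) (key.2 hc)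
    · have hno := fun h => hc (key.1 h)
      rw [hre] at hno hc
      refine iff_of_false (not_setPacking_empty ?_) hno
      change 0 < I.k - _
      omega
  · split_ifs
    · exact Nat.zero_le _
    · exact le_rfl

theorem hasVertexKernel_packing (hmax : maxOrder 𝓗 ≤ r) (htr : t + 1 ≤ r) :
    HasVertexKernel (Packing 𝓗 ind t) (fun k => 2 * (r ^ r * k ^ (r - t - 1))) := by
  rcases htr.eq_or_lt with h | h
  · exact hasVertexKernel_of_eq hmax (by omega) h.symm _
  · have h1 : 1 ≤ r := by omega
    exact hasVertexKernel_of_comp r (compS_kernelize 𝓗 ind)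
      (comp_region 5 (Comp.const 0)) (comp_region 5 (Comp.const 1)) fun I =>
      kernelize_spec le_rfl hmax h (represents_initState h1 I) (region_initState h1 le_rfl I)
        (region_initState h1 (by omega) I) (region_initState h1 (by omega) I)

end Kernel

end OverlapPacking

theorem mainTheorem6 :
    ∃ C : ℕ, ∀ (𝓗 : Finset OverlapPacking.FinGraph) (t r : ℕ),
      r = OverlapPacking.maxOrder 𝓗 → t + 1 ≤ r →
        OverlapPacking.HasVertexKernel (OverlapPacking.HPacking 𝓗 t)
            (fun k => C * (r ^ r * k ^ (r - t - 1))) ∧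
          OverlapPacking.HasVertexKernel (OverlapPacking.InducedHPacking 𝓗 t)
            (fun k => C * (r ^ r * k ^ (r - t - 1))) := by
  refine ⟨2, fun 𝓗 t r hr htr => ⟨?_, ?_⟩⟩
  · have h : OverlapPacking.Packing 𝓗 False t = OverlapPacking.HPacking 𝓗 t := by
      ext I
      simp [OverlapPacking.Packing, OverlapPacking.HPacking]
    exact h ▸ OverlapPacking.hasVertexKernel_packing hr.ge htr
  · have h : OverlapPacking.Packing 𝓗 True t = OverlapPacking.InducedHPacking 𝓗 t := by
      ext I
      simp [OverlapPacking.Packing, OverlapPacking.InducedHPacking]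
    exact h ▸ OverlapPacking.hasVertexKernel_packing hr.ge htr
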